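/- All logarithms are to base $2$ and $0\log 0=0$. An *implicit set problem* $\mathcal P$ is a set of instances $(E,\mathcal F,B,\mathsf{oracle})$, where $E$ is a finite set (of bit strings), $\mathcal F\subseteq 2^E$, $B\in\{0,1\}^*$ is the encoding of the instance and $\mathsf{oracle}:2^E\times\mathbb N\to\{0,1\}$. Algorithms are oracle Turing machines which receive $B$ (and possibly further inputs) and have $\mathsf{oracle}$ as their oracle; randomized algorithms may flip fair coins, and running times bound the number of steps for all outcomes of the coins. It is assumed that $\mathcal P$ is *polynomial time computable*: deterministic algorithms compute $E$ from $B$, and decide $S\in\mathcal F$ from $B$ and $S\subseteq E$, in time $\mathrm{poly}(|B|)$. For $X\subseteq E$ and $\ell\in\mathbb N$, a set $S\subseteq E\setminus X$ is an *$\ell$-extension* of $X$ if $X\cup S\in\mathcal F$ and $|S|=\ell$. For $g:\mathbb N\to\mathbb N$, a *random extension algorithm of time $g$* for $\mathcal P$ is a randomized algorithm which on input $(B,X,\ell)$ with $X\subseteq E$ and $\ell\in\mathbb N$ runs in time $g(\ell)\cdot\mathrm{poly}(|B|)$, always returns either $\bot$ or an $\ell$-extension of $X$, and returns an $\ell$-extension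 of $X$ with probability at least $1/2$ if one exists. A *randomized algorithm for $\mathcal P$* is a randomized algorithm which on input $B$ answers "yes" or "no"; it answers "yes" with probability at least $1/2$ if $\mathcal F\neq\emptyset$, and "no" with probability $1$ if $\mathcal F=\emptyset$. Let $\alpha>0$ be a real number, let $g_\alpha(\ell)=\lfloor 2^{\alpha\,\ell\log\ell}\rfloor$, and for $g:\mathbb N\to\mathbb N$ let $$\Phi_g(n)=\max\Big\{\ell\log\Big(\frac{n}{4\ell}\Big)-\log g(\ell)\;:\;\ell\in\mathbb N,\ 0\le\ell\le n/4\Big\},$$ where the first term is read as $0$ for $\ell=0$. Then: 1. $\Phi_{g_\alpha}(n)=\Omega\big(n^{1/(1+\alpha)}\big)$. 2. There is a function $f(n)=\Omega\big(n^{1/(1+\alpha)}\big)$, depending only on $\alpha$, such that every polynomial time computable implicit set problem $\mathcal P$ which has a random extension algorithm of time $g_\alpha$ has a randomized algorithm which runs in time $2^{|E|-f(|E|)}\cdot\mathrm{poly}(|B|)$ on every instance $(E,\mathcal F,B,\mathsf{oracle})\in\mathcal P$. In other words, it runs in time $2^{|E|-\Omega(|E|^{1/(1+\alpha)})}\cdot\mathrm{poly}(|B|)$.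 -/

import Mathlib

open Filter

/-! ### Oracle Turing machines with coin flips

The machine model is Mathlib's multi-stack Turing machine `Turing.TM2` (the model on which Mathlib
bases polynomial-time computability; a tape is a pair of stacks), extended by two instructions:
flipping a fair coin and querying the oracle. All the data of a machine are finite. -/

/-- The alphabet: the two bits and two separators. -/
inductive TapeSymbol : Type
  | bit (b : Bool)
  | comma
  | hash
  deriving DecidableEq

/-- What a machine does in one step at a given label: execute a `TM2` statement, flip a fair coin
and branch on the result, or query the oracle and branch on its answer. -/
inductive Instr (K Λ σ : Type) : Type
  | exec (s : Turing.TM2.Stmt (fun _ : K => TapeSymbol) Λ σ)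
  | flip (next : Bool → Λ)
  | query (next : Bool → Λ)

/-- A randomized oracle Turing machine, with finitely many stacks `K`, labels `Λ` and internal
states `σ`. The stacks `inp`, `out`, `qry` hold the input, the output and the oracle queries. -/
structure OracleTM : Type 1 where
  K : Type
  [decK : DecidableEq K]
  [finK : Fintype K]
  Λ : Type
  [finΛ : Fintype Λ]
  σ : Type
  [finσ : Fintype σ]
  inp : K
  out : K
  qry : K
  start : Λ
  startState : σ
  prog : Λ → Instr K Λ σ

namespace OracleTM

attribute [instance] decK finK finΛ finσ

variable (M : OracleTM)

/-- Configurations: current label (`none` if the machine has halted), internal state, stacks. -/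
abbrev Cfg : Type := Turing.TM2.Cfg (fun _ : M.K => TapeSymbol) M.Λ M.σ

/-- The initial configuration on input `x` (the first letter of `x` is on top of the stack). -/
def initCfg (x : List TapeSymbol) : M.Cfg where
  l := some M.start
  var := M.startState
  stk := Function.update (fun _ => []) M.inp x

/-- One step, with oracle `O` and with `b` as the outcome of the coin flip, if one occurs in this
step. A halted machine stays where it is. -/
def step (O : List TapeSymbol → Bool) (c : M.Cfg) (b : Bool) : M.Cfg :=
  match c.l with
  | none => c
  | some l =>
    match M.prog l with
    | Instr.exec s => Turing.TM2.stepAux s c.var c.stk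
    | Instr.flip next => ⟨some (next b), c.var, c.stk⟩
    | Instr.query next => ⟨some (next (O (c.stk M.qry))), c.var, c.stk⟩

/-- The configuration after `T` steps on input `x`, where `r i` is the coin of step `i`. -/
def run (O : List TapeSymbol → Bool) (x : List TapeSymbol) {T : ℕ} (r : Fin T → Bool) : M.Cfg :=
  (List.ofFn r).foldl (M.step O) (M.initCfg x)

/-- On input `x` with oracle `O` the machine halts within `T` steps, whatever the coins are. -/
def HaltsWithin (O : List TapeSymbol → Bool) (x : List TapeSymbol) (T : ℕ) : Prop :=
  ∀ r : Fin T → Bool, (M.run O x r).l = none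

/-- The contents of the output stack (top first) after `T` steps with coins `r`. -/
def output (O : List TapeSymbol → Bool) (x : List TapeSymbol) {T : ℕ} (r : Fin T → Bool) : List TapeSymbol :=
  (M.run O x r).stk M.out

/-- The probability, over `T` independent fair coins, that the output after `T` steps satisfies
`A`. -/
noncomputable def prob (O : List TapeSymbol → Bool) (x : List TapeSymbol) (T : ℕ) (A : List TapeSymbol → Prop) : ℝ :=
  (Nat.card {r : Fin T → Bool // A (M.output O x r)} : ℝ) / 2 ^ T

/-- The machine never flips a coin. -/
def Deterministic : Prop :=
  ∀ (l : M.Λ) (next : Bool → M.Λ), M.prog l ≠ Instr.flip next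

end OracleTM

/-! ### Encodings -/

/-- The word of a bit string. -/
def encBits (w : List Bool) : List TapeSymbol := w.map TapeSymbol.bit

/-- The word of a list of bit strings: each string is followed by a comma. -/
def encList (l : List (List Bool)) : List TapeSymbol := l.flatMap fun e => encBits e ++ [TapeSymbol.comma]

/-- The answers "yes" and "no". -/
def encAnswer (b : Bool) : List TapeSymbol := [TapeSymbol.bit b]

/-- The symbol `⊥`, which is not the word of any list. -/
def encBot : List TapeSymbol := [TapeSymbol.hash]

/-- `l` lists the elements of the finite set `S`, in some order and without repetition. -/
def IsListing (l : List (List Bool)) (S : Finset (List Bool)) : Prop :=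
  l.Nodup ∧ l.toFinset = S

/-- The word of the pair `(B, X)`, where `X` is given by a list of its elements. -/
def encPair (B : List Bool) (X : List (List Bool)) : List TapeSymbol :=
  encBits B ++ TapeSymbol.hash :: encList X

/-- The word of the triple `(B, X, ℓ)`, where `ℓ` is written in binary. -/
def encTriple (B : List Bool) (X : List (List Bool)) (ℓ : ℕ) : List TapeSymbol :=
  encPair B X ++ TapeSymbol.hash :: encBits ℓ.bits

/-- The word of the oracle query `(S, j)`, where `j` is written in binary. -/
def encQuery (S : List (List Bool)) (j : ℕ) : List TapeSymbol :=
  encList S ++ TapeSymbol.hash :: encBits j.bits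

/-! ### Implicit set problems -/

/-- An instance `(E, 𝓕, B, oracle)` of an implicit set problem. The elements of the ground set are
(named by) bit strings, so that machines can read and write them. Only the values of `oracle` on
subsets of `E` matter. -/
structure SetInstance : Type where
  E : Finset (List Bool)
  F : Set (Finset (List Bool))
  F_subset : ∀ S ∈ F, S ⊆ E
  B : List Bool
  oracle : Finset (List Bool) → ℕ → Bool

namespace SetInstance

variable (I : SetInstance)

open Classical in
/-- The oracle as a machine sees it: a word for `(S, j)` with `S ⊆ E` is answered by
`oracle S j`, and any other word by `false`. -/
noncomputable def answer (w : List TapeSymbol) : Bool :=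
  decide (∃ (l : List (List Bool)) (S : Finset (List Bool)) (j : ℕ),
    w = encQuery l j ∧ IsListing l S ∧ S ⊆ I.E ∧ I.oracle S j = true)

/-- `S` is an `ℓ`-extension of `X`. -/
def IsExtension (X : Finset (List Bool)) (ℓ : ℕ) (S : Finset (List Bool)) : Prop :=
  S ⊆ I.E \ X ∧ X ∪ S ∈ I.F ∧ S.card = ℓ

end SetInstance

open Classical in
/-- `P` is polynomial time computable: from `B` and the oracle one can compute `E`, and decide
`S ∈ 𝓕` for a given `S ⊆ E`, deterministically and in time `poly(|B|)`. -/
def PolyTimeComputable (P : Set SetInstance) : Prop :=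
  (∃ (M : OracleTM) (p : Polynomial ℕ), M.Deterministic ∧ ∀ I ∈ P,
    M.HaltsWithin I.answer (encBits I.B) (p.eval I.B.length) ∧
    ∀ r : Fin (p.eval I.B.length) → Bool,
      ∃ l, IsListing l I.E ∧ M.output I.answer (encBits I.B) r = encList l) ∧
  (∃ (M : OracleTM) (p : Polynomial ℕ), M.Deterministic ∧ ∀ I ∈ P, ∀ S ⊆ I.E, ∀ l, IsListing l S →
    M.HaltsWithin I.answer (encPair I.B l) (p.eval I.B.length) ∧
    ∀ r : Fin (p.eval I.B.length) → Bool,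
      M.output I.answer (encPair I.B l) r = encAnswer (decide (S ∈ I.F)))

/-- `P` has a random extension algorithm of time `g`. On input `(B, X, ℓ)`, with `X ⊆ E`, it runs
in time `g(ℓ) · poly(|B|)`, it always returns `⊥` or an `ℓ`-extension of `X`, and if `X` has an
`ℓ`-extension, it returns one with probability at least `1/2`. -/
def HasExtensionAlgorithm (P : Set SetInstance) (g : ℕ → ℕ) : Prop :=
  ∃ (M : OracleTM) (p : Polynomial ℕ), ∀ I ∈ P, ∀ X ⊆ I.E, ∀ l, IsListing l X → ∀ ℓ : ℕ,
    M.HaltsWithin I.answer (encTriple I.B l ℓ) (g ℓ * p.eval I.B.length) ∧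
    (∀ r : Fin (g ℓ * p.eval I.B.length) → Bool,
      M.output I.answer (encTriple I.B l ℓ) r = encBot ∨
      ∃ S s, I.IsExtension X ℓ S ∧ IsListing s S ∧
        M.output I.answer (encTriple I.B l ℓ) r = encList s) ∧
    ((∃ S, I.IsExtension X ℓ S) →
      1 / 2 ≤ M.prob I.answer (encTriple I.B l ℓ) (g ℓ * p.eval I.B.length)
        fun w => ∃ S s, I.IsExtension X ℓ S ∧ IsListing s S ∧ w = encList s)

/-- `P` has a randomized algorithm which runs in time `τ(|E|) · poly(|B|)`. It answers "yes" or
"no"; if `𝓕 ≠ ∅` the answer is "yes" with probability at least `1/2`, and if `𝓕 = ∅` it is "no"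
with probability `1`. -/
def HasRandomizedAlgorithm (P : Set SetInstance) (τ : ℕ → ℝ) : Prop :=
  ∃ (M : OracleTM) (p : Polynomial ℕ), ∀ I ∈ P, ∃ T : ℕ,
    (T : ℝ) ≤ τ I.E.card * (p.eval I.B.length : ℕ) ∧
    M.HaltsWithin I.answer (encBits I.B) T ∧
    (∀ r : Fin T → Bool, ∃ b, M.output I.answer (encBits I.B) r = encAnswer b) ∧
    (I.F.Nonempty → 1 / 2 ≤ M.prob I.answer (encBits I.B) T fun w => w = encAnswer true) ∧
    (¬ I.F.Nonempty → M.prob I.answer (encBits I.B) T (fun w => w = encAnswer false) = 1)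

/-! ### The functions in the running times -/

/-- `f = Ω(h)` (for functions `h ≥ 0`). -/
def IsOmega (f h : ℕ → ℝ) : Prop :=
  ∃ c : ℝ, 0 < c ∧ ∀ᶠ n in atTop, c * h n ≤ f n

/-- `g_α(ℓ) = ⌊2 ^ (α ℓ log ℓ)⌋`, with the logarithm to base `2` and `0 log 0 = 0`. -/
noncomputable def gKLogK (α : ℝ) (ℓ : ℕ) : ℕ :=
  ⌊(2 : ℝ) ^ (α * ℓ * Real.logb 2 ℓ)⌋₊

/-- `Φ_g(n)`, the maximum of `ℓ log (n / (4ℓ)) - log g(ℓ)` over the natural numbers `ℓ ≤ n / 4`;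
the first term is `0` for `ℓ = 0`. -/
noncomputable def Phi (g : ℕ → ℕ) (n : ℕ) : ℝ :=
  (Finset.range (n / 4 + 1)).sup' ⟨0, by simp⟩ fun ℓ =>
    (ℓ : ℝ) * Real.logb 2 ((n : ℝ) / (4 * ℓ)) - Real.logb 2 (g ℓ)

/-! Let n = |E| and let a be the truncated difference ⌊log n⌋ - 2. For 0 ≤ i ≤ a put w = (a -
i)·2^i. One trial tosses a coin between two modes. In the first, X is a uniformly random subset of E
and the extension machine is asked for a 2^i-extension. In the second, every element is kept with
probability 1/4 and a 0-extension is asked for, which is a membership test for X.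

Suppose S ∈ 𝓕. If |S| ≥ 2^a, then at least (2^(a-i))^(2^i) = 2^w of the 2^n outcomes in the first
mode are subsets of S missing exactly 2^i elements. If |S| < 2^a, then |S| ≤ n/4, and the second
mode hits S itself with probability 3^(n-|S|)/4^n ≥ 2^(w-n), because 3^6 ≥ 2^9 and 8w ≤ n. The
choice of the mode and the error of the extension machine cost a factor 1/4, so a trial succeeds
with probability at least 2^(-L), where L = n + 2 - w (`Frag.trialFail_add_le`). Repeating it about
2^L times costs 2^(n-w)·g(2^i) up to polynomial factors. With i near a/(1+α) the saving 2^i·(a - i -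
αi) is of order n^(1/(1+α)) (`exists_saving_le`). The same size ℓ = 2^i bounds `Phi` from below.

As α is an arbitrary real, the machine is not given g_α or the best i; it is built from the two
given machines alone. It works in rounds u = 0, 1, 2, ...: round u uses i = u mod (a + 1), gives the
extension machine 2^(u+1) steps in all, and makes at most 2^L·(u + 2) trials. It says "yes" after a
success, "no" once all trials of a round have failed, and passes to the next round when the clock
runs out. A wrong "no" in round u has probability at most 2^(-(u+2)), which sums to 1/2. A round
with the good i whose clock covers all its trials is the last one (`Frag.wp_search`), and it comes
early enough (`exists_last_round`, `time_bound`).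

Machines are assembled from fragments with several exits. A fragment is described by the expected
value of a function of exit, remaining fuel and stacks; exhausted fuel has the value ⊤. One finite
upper bound therefore controls the running time for all coins and the error probability at once.
`Frag.toTM_spec` turns it into a statement about a machine. -/

open scoped ENNReal
open Function (update)

/-! ### Machine fragments -/

/-- The contents of the stacks. -/
abbrev Stk (K : Type) := K → List TapeSymbol

/-- `TM2` statements over the tape alphabet. -/
abbrev TStmt (K Λ σ : Type) := Turing.TM2.Stmt (fun _ : K => TapeSymbol) Λ σ

/-- Configurations over the tape alphabet. -/
abbrev TCfg (K Λ σ : Type) := Turing.TM2.Cfg (fun _ : K => TapeSymbol) Λ σ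

instance : Finite TapeSymbol :=
  Finite.of_surjective
    (fun x : Option (Option Bool) => match x with
      | none => TapeSymbol.comma
      | some none => TapeSymbol.hash
      | some (some b) => TapeSymbol.bit b)
    (by
      rintro (b | _ | _)
      exacts [⟨some (some b), rfl⟩, ⟨none, rfl⟩, ⟨some none, rfl⟩])

/-- Relabelling of a statement. -/
def TStmt.map {K Λ Λ' σ : Type} (g : Λ → Λ') : TStmt K Λ σ → TStmt K Λ' σ
  | .push k f s => .push k f (TStmt.map g s)
  | .peek k f s => .peek k f (TStmt.map g s)
  | .pop k f s => .pop k f (TStmt.map g s)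
  | .load f s => .load f (TStmt.map g s)
  | .branch p s t => .branch p (TStmt.map g s) (TStmt.map g t)
  | .goto f => .goto fun v => g (f v)
  | .halt => .halt

theorem TStmt.stepAux_map {K Λ Λ' σ : Type} [DecidableEq K] (g : Λ → Λ') (s : TStmt K Λ σ) (v : σ)
    (S : Stk K) :
    Turing.TM2.stepAux (TStmt.map g s) v S =
      ⟨(Turing.TM2.stepAux s v S).l.map g, (Turing.TM2.stepAux s v S).var,
        (Turing.TM2.stepAux s v S).stk⟩ := by
  induction s generalizing v S with
  | branch p s t hs ht =>
    simp only [TStmt.map, Turing.TM2.stepAux]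
    cases p v <;> simp [hs, ht]
  | _ => simp_all [TStmt.map]

/-- Relabelling of an instruction. -/
def Instr.map {K Λ Λ' σ : Type} (g : Λ → Λ') : Instr K Λ σ → Instr K Λ' σ
  | .exec s => .exec (TStmt.map g s)
  | .flip next => .flip fun b => g (next b)
  | .query next => .query fun b => g (next b)

/-- The value of `f` at a configuration; a halted configuration gets the value `⊤`. -/
def TCfg.eval {K Λ σ : Type} (f : Λ → σ → Stk K → ℝ≥0∞) (c : TCfg K Λ σ) : ℝ≥0∞ :=
  match c.l with
  | none => ⊤
  | some l => f l c.var c.stk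

/-- The expected value of `f` after an instruction. -/
noncomputable def Instr.wp {K Λ σ : Type} [DecidableEq K] (q : K) (O : List TapeSymbol → Bool)
    (i : Instr K Λ σ) (f : Λ → σ → Stk K → ℝ≥0∞) (v : σ) (S : Stk K) : ℝ≥0∞ :=
  match i with
  | .exec s => TCfg.eval f (Turing.TM2.stepAux s v S)
  | .flip next => (f (next true) v S + f (next false) v S) / 2
  | .query next => f (next (O (S q))) v S

theorem TCfg.eval_mono {K Λ σ : Type} {f g : Λ → σ → Stk K → ℝ≥0∞}
    (h : ∀ l v S, f l v S ≤ g l v S) (c : TCfg K Λ σ) : c.eval f ≤ c.eval g := by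
  unfold TCfg.eval
  split
  exacts [le_rfl, h _ _ _]

/-! ### Expected values of programs with fuel -/

section

variable {K Λ Λ' σ X : Type} [DecidableEq K] (q : K) (O : List TapeSymbol → Bool)

theorem Instr.wp_map (g : Λ → Λ') (i : Instr K Λ σ) (f : Λ' → σ → Stk K → ℝ≥0∞) (v : σ)
    (S : Stk K) : (i.map g).wp q O f v S = i.wp q O (fun l => f (g l)) v S := by
  cases i with
  | exec s =>
    simp only [Instr.map, Instr.wp, TStmt.stepAux_map, TCfg.eval]
    cases (Turing.TM2.stepAux s v S).l <;> rfl
  | flip next => rfl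
  | query next => rfl

theorem Instr.wp_mono (i : Instr K Λ σ) {f g : Λ → σ → Stk K → ℝ≥0∞}
    (h : ∀ l v S, f l v S ≤ g l v S) (v : σ) (S : Stk K) : i.wp q O f v S ≤ i.wp q O g v S := by
  cases i with
  | exec s => exact TCfg.eval_mono h _
  | flip next => exact ENNReal.div_le_div_right (add_le_add (h _ _ _) (h _ _ _)) _
  | query next => exact h _ _ _

/-- The expected value of `φ` (a function of the exit, the remaining fuel, the internal state and
the stacks) when a fragment is run with the given amount of fuel; one step costs one unit of fuel,
and running out of fuel has the value `⊤`. -/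
noncomputable def flow (P : Λ → Instr K (Λ ⊕ X) σ) (φ : X → ℕ → σ → Stk K → ℝ≥0∞) :
    ℕ → Λ ⊕ X → σ → Stk K → ℝ≥0∞
  | n, .inr x, v, S => φ x n v S
  | 0, .inl _, _, _ => ⊤
  | n + 1, .inl l, v, S => (P l).wp q O (flow P φ n) v S

theorem flow_inr (P : Λ → Instr K (Λ ⊕ X) σ) (φ : X → ℕ → σ → Stk K → ℝ≥0∞) (n : ℕ) (x : X)
    (v : σ) (S : Stk K) : flow q O P φ n (.inr x) v S = φ x n v S := by
  cases n <;> rfl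

theorem flow_succ (P : Λ → Instr K (Λ ⊕ X) σ) (φ : X → ℕ → σ → Stk K → ℝ≥0∞) (n : ℕ) (l : Λ)
    (v : σ) (S : Stk K) :
    flow q O P φ (n + 1) (.inl l) v S = (P l).wp q O (flow q O P φ n) v S := rfl

theorem flow_mono (P : Λ → Instr K (Λ ⊕ X) σ) {φ ψ : X → ℕ → σ → Stk K → ℝ≥0∞} (n : ℕ)
    (h : ∀ x, ∀ m ≤ n, ∀ v S, φ x m v S ≤ ψ x m v S) (z : Λ ⊕ X) (v : σ) (S : Stk K) :
    flow q O P φ n z v S ≤ flow q O P ψ n z v S := by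
  induction n generalizing z v S with
  | zero =>
    rcases z with l | x
    · exact le_rfl
    · exact h _ _ le_rfl _ _
  | succ n ih =>
    rcases z with l | x
    · exact Instr.wp_mono q O _ (ih fun x m hm => h x m (by omega)) v S
    · exact h _ _ le_rfl _ _

/-- Lack of fuel is worth ⊤, so additional fuel can only lower the value. This is what allows time
bounds to be rounded up. -/
theorem flow_antitone (P : Λ → Instr K (Λ ⊕ X) σ) {φ : X → ℕ → σ → Stk K → ℝ≥0∞}
    (h : ∀ x v S, Antitone fun n => φ x n v S) (z : Λ ⊕ X) (v : σ) (S : Stk K) :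
    Antitone fun n => flow q O P φ n z v S := by
  refine antitone_nat_of_succ_le fun n => ?_
  induction n generalizing z v S with
  | zero =>
    rcases z with l | x
    · exact le_top
    · exact h _ _ _ (Nat.le_succ 0)
  | succ n ih =>
    rcases z with l | x
    · exact Instr.wp_mono q O _ ih v S
    · exact h _ _ _ (Nat.le_succ _)

/-- A program copied into a larger one behaves as before until it reaches an exit, which `g` may
send to an inner label of the larger program. Sequential composition and loops are both instances.
-/
theorem flow_map {Y : Type} (P : Λ → Instr K (Λ ⊕ X) σ) (P' : Λ' → Instr K (Λ' ⊕ Y) σ)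
    (g : Λ ⊕ X → Λ' ⊕ Y) (h : ∀ l, ∃ l', g (.inl l) = .inl l' ∧ P' l' = (P l).map g)
    (φ : Y → ℕ → σ → Stk K → ℝ≥0∞) (n : ℕ) (z : Λ ⊕ X) (v : σ) (S : Stk K) :
    flow q O P' φ n (g z) v S =
      flow q O P (fun x n v S => flow q O P' φ n (g (.inr x)) v S) n z v S := by
  induction n generalizing z v S with
  | zero =>
    rcases z with l | x
    · obtain ⟨l', hl, -⟩ := h l
      rw [hl]; rfl
    · rfl
  | succ n ih =>
    rcases z with l | x
    · obtain ⟨l', hl, hP⟩ := h l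
      rw [hl, flow_succ, hP, Instr.wp_map, flow_succ]
      congr 1
      funext z v S
      exact ih z v S
    · rfl

end

/-- A part of a machine with stacks `K`, internal states `σ` and exits `X`. -/
structure Frag (K σ X : Type) : Type 1 where
  Λ : Type
  [fin : Finite Λ]
  entry : Λ ⊕ X
  prog : Λ → Instr K (Λ ⊕ X) σ

namespace Frag

attribute [instance] fin

variable {K σ X Y A : Type}

/-- The fragment that exits at once. -/
def pure (x : X) : Frag K σ X where
  Λ := Empty
  entry := .inr x
  prog := Empty.elim

/-- Entering the continuation. -/
def bindLabel (F : Frag K σ X) (G : X → Frag K σ Y) (x : X) :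
    (G x).Λ ⊕ Y → (F.Λ ⊕ Σ x, (G x).Λ) ⊕ Y
  | .inl l => .inl (.inr ⟨x, l⟩)
  | .inr y => .inr y

/-- Relabelling of the first part of a sequential composition. -/
def bindFst (F : Frag K σ X) (G : X → Frag K σ Y) : F.Λ ⊕ X → (F.Λ ⊕ Σ x, (G x).Λ) ⊕ Y
  | .inl l => .inl (.inl l)
  | .inr x => bindLabel F G x (G x).entry

/-- Sequential composition. -/
def bind [Finite X] (F : Frag K σ X) (G : X → Frag K σ Y) : Frag K σ Y where
  Λ := F.Λ ⊕ Σ x, (G x).Λ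
  entry := bindFst F G F.entry
  prog
    | .inl l => (F.prog l).map (bindFst F G)
    | .inr ⟨x, l⟩ => ((G x).prog l).map (bindLabel F G x)

/-- Relabelling of the body of a loop. -/
def loopLabel (body : A → Frag K σ (A ⊕ X)) (a : A) :
    (body a).Λ ⊕ (A ⊕ X) → (A ⊕ Σ a, (body a).Λ) ⊕ X
  | .inl l => .inl (.inr ⟨a, l⟩)
  | .inr (.inl a') => .inl (.inl a')
  | .inr (.inr x) => .inr x

/-- A loop with loop variable in `A`. -/
def loop [Finite A] (body : A → Frag K σ (A ⊕ X)) (a : A) : Frag K σ X where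
  Λ := A ⊕ Σ a, (body a).Λ
  entry := .inl (.inl a)
  prog
    | .inl a => .exec (.goto fun _ => loopLabel body a (body a).entry)
    | .inr ⟨a, l⟩ => ((body a).prog l).map (loopLabel body a)

/-- Flipping a coin. -/
def flip : Frag K σ Bool where
  Λ := Unit
  entry := .inl ()
  prog _ := .flip .inr

/-- Popping a symbol; the internal state has a register for it. -/
def pop {τ : Type} (k : K) : Frag K (Option TapeSymbol × τ) (Option TapeSymbol) where
  Λ := Unit
  entry := .inl ()
  prog _ := .exec (.pop k (fun v x => (x, v.2)) (.goto fun v => .inr v.1))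

/-- The statement which pops `p` symbols. -/
def popStmt {Λ : Type} (k : K) (s : TStmt K Λ σ) : ℕ → TStmt K Λ σ
  | 0 => s
  | p + 1 => .pop k (fun v _ => v) (popStmt k s p)

/-- The statement which pushes the symbols of a word, so that the first one is on top. -/
def pushStmt {Λ : Type} (k : K) : TStmt K Λ σ → List TapeSymbol → TStmt K Λ σ
  | s, [] => s
  | s, a :: w => pushStmt k (.push k (fun _ => a) s) w

/-- Replacing the first `p` symbols of a stack by a word. -/
def edit (k : K) (p : ℕ) (w : List TapeSymbol) : Frag K σ Unit where
  Λ := Unit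
  entry := .inl ()
  prog _ := .exec (popStmt k (pushStmt k (.goto fun _ => .inr ()) w) p)

variable [DecidableEq K]

theorem stepAux_popStmt {Λ : Type} (k : K) (s : TStmt K Λ σ) (p : ℕ) (v : σ) (S : Stk K) :
    Turing.TM2.stepAux (popStmt k s p) v S =
      Turing.TM2.stepAux s v (update S k ((S k).drop p)) := by
  induction p generalizing S with
  | zero => simp [popStmt]
  | succ p ih => simp [popStmt, ih]

theorem stepAux_pushStmt {Λ : Type} (k : K) (s : TStmt K Λ σ) (w : List TapeSymbol) (v : σ)
    (S : Stk K) :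
    Turing.TM2.stepAux (pushStmt k s w) v S =
      Turing.TM2.stepAux s v (update S k (w ++ S k)) := by
  induction w generalizing s with
  | nil => simp [pushStmt]
  | cons a w ih => simp [pushStmt, ih]

variable (q : K) (O : List TapeSymbol → Bool)

/-- The expected value of `φ` (a function of the exit, the remaining fuel and the stacks) when the
fragment is run from the worst internal state. -/
noncomputable def wp (F : Frag K σ X) (φ : X → ℕ → Stk K → ℝ≥0∞) (n : ℕ) (S : Stk K) : ℝ≥0∞ :=
  ⨆ v, flow q O F.prog (fun x n _ S => φ x n S) n F.entry v S

variable {q O}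

theorem wp_antitone (F : Frag K σ X) {φ : X → ℕ → Stk K → ℝ≥0∞}
    (h : ∀ x S, Antitone fun n => φ x n S) (S : Stk K) : Antitone fun n => F.wp q O φ n S :=
  fun _ _ hmn => iSup_mono fun v => flow_antitone q O F.prog (fun x _ S => h x S) F.entry v S hmn

theorem wp_pure (x : X) (φ : X → ℕ → Stk K → ℝ≥0∞) (n : ℕ) (S : Stk K) :
    (pure x : Frag K σ X).wp q O φ n S ≤ φ x n S :=
  iSup_le fun v => (flow_inr q O _ _ n x v S).le

/-- Only an inequality, because the supremum over internal states is taken afresh on entering `G`: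
stages communicate through exits and stacks only. -/
theorem wp_bind [Finite X] (F : Frag K σ X) (G : X → Frag K σ Y) (φ : Y → ℕ → Stk K → ℝ≥0∞)
    (n : ℕ) (S : Stk K) :
    (F.bind G).wp q O φ n S ≤ F.wp q O (fun x n S => (G x).wp q O φ n S) n S := by
  refine iSup_mono fun v => ?_
  refine (flow_map q O F.prog (F.bind G).prog (bindFst F G) (fun l => ⟨_, rfl, rfl⟩) _ n F.entry v
    S).trans_le ?_
  refine flow_mono q O _ _ (fun x m _ v S => ?_) _ _ _
  refine (flow_map q O (G x).prog (F.bind G).prog (bindLabel F G x) (fun l => ⟨_, rfl, rfl⟩) _ m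
    (G x).entry v S).trans_le ?_
  refine (flow_mono q O _ _ (fun y k _ v S => (flow_inr q O _ _ k y v S).le) _ _ _).trans ?_
  exact le_iSup (fun v => flow q O (G x).prog (fun x n _ S => φ x n S) m (G x).entry v S) v

/-- The extra unit of fuel pays for the jump at the head of the loop. -/
theorem wp_loop [Finite A] (body : A → Frag K σ (A ⊕ X)) (a : A) (φ : X → ℕ → Stk K → ℝ≥0∞)
    (n : ℕ) (S : Stk K) :
    (loop body a).wp q O φ (n + 1) S ≤
      (body a).wp q O (fun r n S => r.elim (fun a' => (loop body a').wp q O φ n S)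
        fun x => φ x n S) n S := by
  refine iSup_mono fun v => ?_
  refine (flow_map q O (body a).prog (loop body a).prog (loopLabel body a)
    (fun l => ⟨_, rfl, rfl⟩) _ n (body a).entry v S).trans_le ?_
  refine flow_mono q O _ _ (fun r m _ v S => ?_) _ _ _
  rcases r with a' | x
  · exact le_iSup (fun v => flow q O (loop body a').prog (fun x n _ S => φ x n S) m
      (loop body a').entry v S) v
  · exact (flow_inr q O _ _ _ _ _ _).le

theorem wp_flip (φ : Bool → ℕ → Stk K → ℝ≥0∞) (n : ℕ) (S : Stk K) :
    (flip : Frag K σ Bool).wp q O φ (n + 1) S ≤ (φ true n S + φ false n S) / 2 := by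
  refine iSup_le fun v => ?_
  refine (flow_succ q O _ _ n () v S).trans_le ?_
  simp only [flip, Instr.wp, flow_inr]
  exact le_rfl

variable (q O) in
/-- From the stacks `S` the fragment always takes the exit `x` with the stacks `S'`, in time `t`. -/
def Runs (F : Frag K σ X) (S : Stk K) (t : ℕ) (x : X) (S' : Stk K) : Prop :=
  ∀ φ : X → ℕ → Stk K → ℝ≥0∞, (∀ x S, Antitone fun n => φ x n S) →
    ∀ n, F.wp q O φ (n + t) S ≤ φ x n S'

theorem Runs.mono {F : Frag K σ X} {S S' : Stk K} {t t' : ℕ} {x : X} (h : Runs q O F S t x S')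
    (ht : t ≤ t') : Runs q O F S t' x S' := fun φ hφ n =>
  (wp_antitone F hφ S (by omega : n + t ≤ n + t')).trans (h φ hφ n)

theorem Runs.pure (x : X) (S : Stk K) : Runs q O (Frag.pure x : Frag K σ X) S 0 x S :=
  fun φ _ n => wp_pure x φ n S

theorem Runs.wp_bind_le [Finite X] {F : Frag K σ X} {G : X → Frag K σ Y} {S S' : Stk K} {t : ℕ}
    {x : X} (h : Runs q O F S t x S') {φ : Y → ℕ → Stk K → ℝ≥0∞}
    (hφ : ∀ x S, Antitone fun n => φ x n S) (n : ℕ) :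
    (F.bind G).wp q O φ (n + t) S ≤ (G x).wp q O φ n S' :=
  (wp_bind F G φ _ S).trans (h _ (fun x S => wp_antitone (G x) hφ S) n)

theorem Runs.of_eq {F : Frag K σ X} {S S₁ S' S₁' : Stk K} {t t' : ℕ} {x : X}
    (h : Runs q O F S₁ t x S₁') (hS : S = S₁) (hS' : S' = S₁') (ht : t ≤ t') :
    Runs q O F S t' x S' := by
  subst hS hS'
  exact h.mono ht

theorem Runs.bind [Finite X] {F : Frag K σ X} {G : X → Frag K σ Y} {S S' S'' : Stk K}
    {t t' T : ℕ} {x : X} {y : Y} (h : Runs q O F S t x S') (h' : Runs q O (G x) S' t' y S'')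
    (hT : t + t' ≤ T) : Runs q O (F.bind G) S T y S'' := by
  refine Runs.mono (t := t + t') (fun φ hφ n => ?_) hT
  rw [show n + (t + t') = n + t' + t by omega]
  exact (h.wp_bind_le hφ _).trans (h' φ hφ n)

theorem loop_antitone [Finite A] {body : A → Frag K σ (A ⊕ X)} {φ : X → ℕ → Stk K → ℝ≥0∞}
    (hφ : ∀ x S, Antitone fun n => φ x n S) (r : A ⊕ X) (S : Stk K) :
    Antitone fun n => r.elim (fun a' => (loop body a').wp q O φ n S) fun x => φ x n S := by
  rcases r with a' | x
  exacts [wp_antitone _ hφ S, hφ x S]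

theorem Runs.loop_continue [Finite A] {body : A → Frag K σ (A ⊕ X)} {a a' : A} {S S' S'' : Stk K}
    {t t' T : ℕ} {x : X} (h : Runs q O (body a) S t (.inl a') S')
    (h' : Runs q O (loop body a') S' t' x S'') (hT : t + t' + 1 ≤ T) :
    Runs q O (loop body a) S T x S'' := by
  refine Runs.mono (t := t + t' + 1) (fun φ hφ n => ?_) hT
  rw [show n + (t + t' + 1) = n + t' + t + 1 by omega]
  exact (wp_loop body a φ _ S).trans ((h _ (loop_antitone hφ) _).trans (h' φ hφ n))

theorem Runs.loop_exit [Finite A] {body : A → Frag K σ (A ⊕ X)} {a : A} {S S' : Stk K}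
    {t T : ℕ} {x : X} (h : Runs q O (body a) S t (.inr x) S') (hT : t + 1 ≤ T) :
    Runs q O (loop body a) S T x S' :=
  Runs.mono (t := t + 1) (fun φ hφ _ =>
    (wp_loop body a φ _ S).trans (h _ (loop_antitone hφ) _)) hT

theorem Runs.pop {τ : Type} (k : K) (S : Stk K) :
    Runs q O (Frag.pop k : Frag K (Option TapeSymbol × τ) _) S 1 (S k).head?
      (update S k (S k).tail) := fun φ _ n => by
  refine iSup_le fun v => ?_
  refine (flow_succ q O _ _ n () v S).trans_le ?_
  simp only [Frag.pop, Instr.wp, Turing.TM2.stepAux, TCfg.eval, flow_inr]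
  exact le_rfl

theorem Runs.edit (k : K) (p : ℕ) (w : List TapeSymbol) (S : Stk K) :
    Runs q O (Frag.edit k p w : Frag K σ _) S 1 () (update S k (w ++ (S k).drop p)) :=
  fun φ _ n => by
  refine iSup_le fun v => ?_
  refine (flow_succ q O _ _ n () v S).trans_le ?_
  simp only [Frag.edit, Instr.wp, stepAux_popStmt, stepAux_pushStmt, Turing.TM2.stepAux, TCfg.eval,
    flow_inr]
  simp

end Frag

/-! ### Basic stack routines -/

namespace Frag

variable {K τ : Type} [DecidableEq K] {q : K} {O : List TapeSymbol → Bool}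

theorem Runs.pop_nil {k : K} {S : Stk K} (h : S k = []) :
    Runs q O (Frag.pop k : Frag K (Option TapeSymbol × τ) _) S 1 none S := by
  have := Runs.pop (q := q) (O := O) (τ := τ) k S
  rwa [h, List.head?_nil, List.tail_nil, ← h, Function.update_eq_self] at this

theorem Runs.pop_cons {k : K} {S : Stk K} {a : TapeSymbol} {w : List TapeSymbol}
    (h : S k = a :: w) :
    Runs q O (Frag.pop k : Frag K (Option TapeSymbol × τ) _) S 1 (some a) (update S k w) := by
  have := Runs.pop (q := q) (O := O) (τ := τ) k S
  rwa [h, List.head?_cons, List.tail_cons] at this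

/-- Popping all symbols of `src`, with an action for each of them. -/
def forEach (src : K) (body : TapeSymbol → Frag K (Option TapeSymbol × τ) Unit) :
    Frag K (Option TapeSymbol × τ) Unit :=
  loop (fun _ : Unit => (pop src).bind fun x =>
    x.elim (pure (.inr ())) fun a => (body a).bind fun _ => pure (.inl ())) ()

/-- The loop invariant is the family `st w b`, the stacks when `w` is still unread and `b` has been
accumulated. Each symbol costs `t` for the body, one step for the loop head and one for the pop; the
final 2 pays for finding the stack empty. -/
theorem Runs.forEach {src : K} {body : TapeSymbol → Frag K (Option TapeSymbol × τ) Unit} {t : ℕ}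
    {B : Type} (st : List TapeSymbol → B → Stk K) (g : B → TapeSymbol → B)
    (hsrc : ∀ w b, st w b src = w)
    (hstep : ∀ a w b, Runs q O (body a) (update (st (a :: w) b) src w) t () (st w (g b a)))
    (w : List TapeSymbol) (b : B) :
    Runs q O (Frag.forEach src body) (st w b) ((t + 2) * w.length + 2) ()
      (st [] (w.foldl g b)) := by
  induction w generalizing b with
  | nil =>
    exact Runs.loop_exit (Runs.bind (Runs.pop_nil (hsrc [] b)) (Runs.pure _ _) le_rfl) (by simp)
  | cons a w ih =>
    refine Runs.loop_continue (Runs.bind (Runs.pop_cons (hsrc (a :: w) b))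
      (Runs.bind (hstep a w b) (Runs.pure _ _) le_rfl) le_rfl) (ih (g b a)) ?_
    rw [List.length_cons]
    linarith

/-- Emptying a stack. -/
def clear (k : K) : Frag K (Option TapeSymbol × τ) Unit := forEach k fun _ => pure ()

theorem Runs.clear (k : K) (S : Stk K) :
    Runs q O (Frag.clear k : Frag K (Option TapeSymbol × τ) _) S (2 * (S k).length + 2) ()
      (update S k []) :=
  Runs.of_eq (Runs.forEach (t := 0) (B := Unit) (fun w _ => update S k w) (fun _ _ => ())
    (by simp) (fun a w _ => Runs.of_eq (Runs.pure () _) rfl (by simp) le_rfl) (S k) ())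
    (by simp) rfl (by simp)

/-- Emptying a stack and writing on another one. -/
def move (src dst : K) (f : TapeSymbol → List TapeSymbol) : Frag K (Option TapeSymbol × τ) Unit :=
  forEach src fun a => edit dst 0 (f a)

theorem Runs.move {src dst : K} (hne : src ≠ dst) (f : TapeSymbol → List TapeSymbol) (S : Stk K) :
    Runs q O (Frag.move src dst f : Frag K (Option TapeSymbol × τ) _) S (3 * (S src).length + 2) ()
      (update (update S src []) dst ((S src).foldl (fun acc a => f a ++ acc) (S dst))) :=
  Runs.of_eq (Runs.forEach (t := 1) (B := List TapeSymbol) (fun w b => update (update S src w) dst b)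
    (fun b a => f a ++ b) (by simp [hne])
    (fun a w b => Runs.of_eq (Runs.edit dst 0 (f a) _) rfl (by
      funext k
      simp only [Function.update_apply]
      split_ifs <;> simp_all) le_rfl) (S src) (S dst)) (by simp) rfl (by simp)

theorem foldl_singleton_append (w v : List TapeSymbol) :
    w.foldl (fun acc a => [a] ++ acc) v = w.reverse ++ v := by
  induction w generalizing v with
  | nil => rfl
  | cons a w ih => simp

theorem Runs.moveBack {src dst : K} (hne : src ≠ dst) (S : Stk K) :
    Runs q O (Frag.move src dst (fun a => [a]) : Frag K (Option TapeSymbol × τ) _) S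
      (3 * (S src).length + 2) ()
      (update (update S src []) dst ((S src).reverse ++ S dst)) := by
  have := Runs.move (q := q) (O := O) (τ := τ) hne (fun a => [a]) S
  rwa [foldl_singleton_append] at this

/-- Reading a stack and editing another one for each symbol, with a stack `tmp` for restoring the
first one. -/
def scan (src dst tmp : K) (p : ℕ) (f : TapeSymbol → List TapeSymbol) :
    Frag K (Option TapeSymbol × τ) Unit :=
  (forEach src fun a => (edit tmp 0 [a]).bind fun _ => edit dst p (f a)).bind fun _ =>
    move tmp src fun a => [a]

theorem foldl_cons_prod {B : Type} (g : B → TapeSymbol → B) (w u : List TapeSymbol) (v : B) :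
    w.foldl (fun (b : List TapeSymbol × B) a => (a :: b.1, g b.2 a)) (u, v)
      = (w.reverse ++ u, w.foldl g v) := by
  induction w generalizing u v with
  | nil => simp
  | cons a w ih => simp [ih]

theorem Runs.scan {src dst tmp : K} (h₁ : src ≠ dst) (h₂ : src ≠ tmp) (h₃ : dst ≠ tmp) (p : ℕ)
    (f : TapeSymbol → List TapeSymbol) (S : Stk K) (htmp : S tmp = []) :
    Runs q O (Frag.scan src dst tmp p f : Frag K (Option TapeSymbol × τ) _) S
      (7 * (S src).length + 4) ()
      (update S dst ((S src).foldl (fun acc a => f a ++ acc.drop p) (S dst))) := by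
  refine Runs.bind (Runs.of_eq (Runs.forEach (t := 2) (B := List TapeSymbol × List TapeSymbol)
    (fun w b => update (update (update S src w) tmp b.1) dst b.2)
    (fun b a => (a :: b.1, f a ++ b.2.drop p)) (by simp [h₁, h₂])
    (fun a w b => Runs.bind (Runs.edit tmp 0 [a] _) (Runs.of_eq (Runs.edit dst p (f a) _) rfl (by
      funext k
      simp only [Function.update_apply]
      split_ifs <;> simp_all) le_rfl) le_rfl) (S src) (S tmp, S dst)) (by simp) rfl le_rfl)
    (Runs.of_eq (Runs.moveBack h₂.symm _) rfl ?_ le_rfl) ?_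
  · rw [foldl_cons_prod (fun acc a => f a ++ acc.drop p)]
    funext k
    simp only [Function.update_apply]
    split_ifs <;> simp_all
  · rw [foldl_cons_prod (fun acc a => f a ++ acc.drop p)]
    simp [Function.update_of_ne h₃.symm, htmp]
    omega

theorem foldl_append_flatMap (f : TapeSymbol → List TapeSymbol) (w v : List TapeSymbol) :
    w.foldl (fun acc a => f a ++ acc.drop 0) v = w.reverse.flatMap f ++ v := by
  induction w generalizing v with
  | nil => rfl
  | cons a w ih =>
    rw [List.foldl_cons, ih]
    simp

/-- Copying the image of a stack, in reverse order. -/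
theorem Runs.copy {src dst tmp : K} (h₁ : src ≠ dst) (h₂ : src ≠ tmp) (h₃ : dst ≠ tmp)
    (f : TapeSymbol → List TapeSymbol) (S : Stk K) (htmp : S tmp = []) :
    Runs q O (Frag.scan src dst tmp 0 f : Frag K (Option TapeSymbol × τ) _) S
      (7 * (S src).length + 4) ()
      (update S dst ((S src).reverse.flatMap f ++ S dst)) := by
  have := Runs.scan (q := q) (O := O) (τ := τ) h₁ h₂ h₃ 0 f S htmp
  rwa [foldl_append_flatMap] at this

theorem foldl_drop (m : ℕ) (w v : List TapeSymbol) :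
    w.foldl (fun acc _ => acc.drop m) v = v.drop (w.length * m) := by
  induction w generalizing v with
  | nil => simp
  | cons a w ih =>
    rw [List.foldl_cons, ih, List.drop_drop, List.length_cons]
    congr 1
    ring

/-- Popping as many symbols from `dst` as there are in `src`. -/
theorem Runs.unpush {src dst tmp : K} (h₁ : src ≠ dst) (h₂ : src ≠ tmp) (h₃ : dst ≠ tmp)
    (S : Stk K) (htmp : S tmp = []) :
    Runs q O (Frag.scan src dst tmp 1 (fun _ => []) : Frag K (Option TapeSymbol × τ) _) S
      (7 * (S src).length + 4) ()
      (update S dst ((S dst).drop (S src).length)) := by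
  have := Runs.scan (q := q) (O := O) (τ := τ) h₁ h₂ h₃ 1 (fun _ => []) S htmp
  simp only [List.nil_append] at this
  rwa [foldl_drop, mul_one] at this

/-- Doubling the height of a stack. -/
def double (k tmp : K) : Frag K (Option TapeSymbol × τ) Unit :=
  (move k tmp fun a => [a, a]).bind fun _ => move tmp k fun a => [a]

theorem length_foldl_double (w v : List TapeSymbol) :
    (w.foldl (fun acc a => [a, a] ++ acc) v).length = 2 * w.length + v.length := by
  induction w generalizing v with
  | nil => simp
  | cons a w ih =>
    rw [List.foldl_cons, ih]
    simp
    omega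

theorem Runs.double {k tmp : K} (h : k ≠ tmp) (S : Stk K) (htmp : S tmp = []) :
    ∃ w, w.length = 2 * (S k).length ∧
      Runs q O (Frag.double k tmp : Frag K (Option TapeSymbol × τ) _) S (9 * (S k).length + 4) ()
        (update S k w) := by
  refine ⟨((S k).foldl (fun acc a => [a, a] ++ acc) []).reverse, ?_, ?_⟩
  · rw [List.length_reverse, length_foldl_double, List.length_nil, add_zero]
  · refine Runs.bind (Runs.move h (fun a => [a, a]) S) (Runs.of_eq (Runs.moveBack h.symm _) rfl ?_
      le_rfl) ?_
    · funext k
      simp only [Function.update_apply]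
      split_ifs <;> simp_all
    · rw [Function.update_self, length_foldl_double, htmp, List.length_nil]
      omega

/-- For each symbol of `src`, popping as many symbols from `dst` as there are in `src'`. -/
def unpushMul (src src' dst tmp tmp' : K) : Frag K (Option TapeSymbol × τ) Unit :=
  (forEach src fun a => (edit tmp' 0 [a]).bind fun _ => scan src' dst tmp 1 fun _ => []).bind
    fun _ => move tmp' src fun a => [a]

/-- Heights of stacks serve as unary numbers, and this is truncated subtraction of a product; it
computes the exponent of the number of trials. -/
theorem Runs.unpushMul {src src' dst tmp tmp' : K}
    (hd : [src, src', dst, tmp, tmp'].Nodup) (S : Stk K) (htmp : S tmp = []) (htmp' : S tmp' = []) :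
    Runs q O (Frag.unpushMul src src' dst tmp tmp' : Frag K (Option TapeSymbol × τ) _) S
      ((7 * (S src').length + 10) * (S src).length + 4) ()
      (update S dst ((S dst).drop ((S src).length * (S src').length))) := by
  simp only [List.nodup_cons, List.mem_cons, List.not_mem_nil, not_or, or_false] at hd
  obtain ⟨⟨h₁, h₂, h₃, h₄⟩, ⟨h₅, h₆, h₇⟩, ⟨h₈, h₉⟩, h₁₀, -⟩ := hd
  refine Runs.bind (Runs.of_eq (Runs.forEach (t := 7 * (S src').length + 5)
    (B := List TapeSymbol × List TapeSymbol)
    (fun w b => update (update (update S src w) tmp' b.1) dst b.2)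
    (fun b a => (a :: b.1, b.2.drop (S src').length)) (by simp [h₂, h₄])
    (fun a w b => Runs.bind (Runs.edit tmp' 0 [a] _)
      (Runs.of_eq (Runs.unpush h₅ h₆ h₈ _ ?_) rfl ?_ le_rfl) ?_) (S src) (S tmp', S dst))
      (by simp) rfl le_rfl)
    (Runs.of_eq (Runs.moveBack (Ne.symm h₄) _) rfl ?_ le_rfl) ?_
  · simp [Ne.symm h₃, Ne.symm h₈, h₁₀, htmp]
  · funext k
    simp only [Function.update_apply]
    split_ifs <;> simp_all
  · simp [Ne.symm h₁, h₅, h₇]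
    omega
  · rw [foldl_cons_prod (fun (acc : List TapeSymbol) _ => acc.drop (S src').length), foldl_drop]
    funext k
    simp only [Function.update_apply]
    split_ifs <;> simp_all
  · rw [foldl_cons_prod (fun (acc : List TapeSymbol) _ => acc.drop (S src').length), foldl_drop,
      Function.update_of_ne (Ne.symm h₉), Function.update_self, htmp', List.append_nil,
      List.length_reverse]
    ring_nf
    omega

/-- One step of halving the height of a stack. -/
def halveStep (k tmp : K) : Frag K (Option TapeSymbol × τ) (Unit ⊕ Unit) :=
  (pop k).bind fun x => x.elim (pure (.inr ())) fun a =>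
    (pop k).bind fun y => y.elim (pure (.inr ())) fun _ =>
      (edit tmp 0 [a]).bind fun _ => pure (.inl ())

/-- Halving the height of a stack. -/
def halve (k tmp : K) : Frag K (Option TapeSymbol × τ) Unit :=
  (loop (fun _ : Unit => halveStep k tmp) ()).bind fun _ => move tmp k fun a => [a]

/-- Two symbols are removed for each one written. A single leftover symbol is dropped, which rounds
the half down. -/
theorem Runs.halve_loop {k tmp : K} (h : k ≠ tmp) (S : Stk K) (n : ℕ) :
    ∀ w : List TapeSymbol, w.length = n → ∀ u, ∃ v : List TapeSymbol,
      v.length = w.length / 2 + u.length ∧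
      Runs q O (loop (fun _ : Unit => halveStep k tmp) () : Frag K (Option TapeSymbol × τ) _)
        (update (update S k w) tmp u) (4 * w.length + 4) () (update (update S k []) tmp v) := by
  induction n using Nat.strong_induction_on with
  | _ n ih =>
    rintro (_ | ⟨a, _ | ⟨b, w⟩⟩) hw u
    · refine ⟨u, by simp, Runs.loop_exit (Runs.bind (Runs.pop_nil ?_) (Runs.pure _ _) le_rfl) ?_⟩
      · simp [h]
      · simp
    · refine ⟨u, by simp, Runs.loop_exit (Runs.bind (Runs.pop_cons (a := a) (w := []) ?_)
        (Runs.bind (Runs.pop_nil ?_) (Runs.of_eq (Runs.pure _ _) rfl ?_ le_rfl) le_rfl) le_rfl) ?_⟩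
      · simp [h]
      · simp
      · funext k
        simp only [Function.update_apply]
        split_ifs <;> simp_all
      · simp
    · obtain ⟨v, hv, hr⟩ := ih w.length (by simp at hw; omega) w rfl (a :: u)
      refine ⟨v, by simp at hv ⊢; omega, ?_⟩
      refine Runs.loop_continue (Runs.bind (Runs.pop_cons (a := a) (w := b :: w) ?_)
        (Runs.bind (Runs.pop_cons (a := b) (w := w) ?_)
          (Runs.bind (Runs.edit tmp 0 [a] _) (Runs.pure _ _) le_rfl) le_rfl) le_rfl)
          (Runs.of_eq hr ?_ rfl le_rfl) ?_
      · simp [h]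
      · simp
      · funext k
        simp only [Function.update_apply]
        split_ifs <;> simp_all
      · simp
        omega

theorem Runs.halve {k tmp : K} (h : k ≠ tmp) (S : Stk K) (htmp : S tmp = []) :
    ∃ w, w.length = (S k).length / 2 ∧
      Runs q O (Frag.halve k tmp : Frag K (Option TapeSymbol × τ) _) S (8 * (S k).length + 8) ()
        (update S k w) := by
  obtain ⟨v, hv, hr⟩ := Runs.halve_loop (q := q) (O := O) (τ := τ) h S _ (S k) rfl []
  rw [List.length_nil, add_zero] at hv
  refine ⟨v.reverse, by simp [hv], Runs.bind (Runs.of_eq hr (by simp [← htmp]) rfl le_rfl)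
    (Runs.of_eq (Runs.moveBack h.symm _) rfl ?_ le_rfl) ?_⟩
  · funext k
    simp only [Function.update_apply]
    split_ifs <;> simp_all
  · simp [hv]
    omega

/-- Writing the bit length of the height of `k` in unary on `dst`, and emptying `k`. -/
def bitLength (k dst tmp : K) : Frag K (Option TapeSymbol × τ) Unit :=
  loop (fun _ : Unit => (pop k).bind fun x => x.elim (pure (.inr ())) fun a =>
    (edit k 0 [a]).bind fun _ => (halve k tmp).bind fun _ =>
      (edit dst 0 [TapeSymbol.hash]).bind fun _ => pure (.inl ())) ()

/-- The bit length is the number of halvings needed to reach 0. Height 0 is separated because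
`Nat.log 2 0 + 1` is 1. -/
theorem Runs.bitLength {k dst tmp : K} (h₁ : k ≠ dst) (h₂ : k ≠ tmp) (h₃ : dst ≠ tmp) (S : Stk K)
    (htmp : S tmp = []) :
    ∃ w, w.length = (S dst).length + (if (S k).length = 0 then 0 else Nat.log 2 (S k).length + 1) ∧
      Runs q O (Frag.bitLength k dst tmp : Frag K (Option TapeSymbol × τ) _) S
        ((8 * (S k).length + 12) * ((S k).length + 1)) () (update (update S k []) dst w) := by
  generalize hn : (S k).length = n
  induction n using Nat.strong_induction_on generalizing S with
  | _ n ih =>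
    rcases hk : S k with _ | ⟨a, w⟩
    · rw [hk, List.length_nil] at hn
      subst hn
      refine ⟨S dst, by simp, Runs.loop_exit (Runs.bind (Runs.pop_nil hk)
        (Runs.of_eq (Runs.pure _ _) rfl ?_ le_rfl) le_rfl) (by simp)⟩
      rw [← hk]
      simp
    · have hn' : n = w.length + 1 := by rw [← hn, hk]; simp
      obtain ⟨u, hu, hr⟩ := Runs.halve (q := q) (O := O) (τ := τ) h₂ S htmp
      rw [hn] at hu hr
      obtain ⟨v, hv, hr'⟩ := ih (n / 2) (by omega)
        (update (update S k u) dst (TapeSymbol.hash :: S dst)) (by simp [Ne.symm h₂, Ne.symm h₃, htmp])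
        (by simp [h₁, hu])
      refine ⟨v, ?_, ?_⟩
      · rw [hv, if_neg (by omega : n ≠ 0)]
        simp only [Function.update_self, List.length_cons]
        split_ifs with h0
        · have : n = 1 := by omega
          subst this
          simp
        · have : Nat.log 2 n = Nat.log 2 (n / 2) + 1 := Nat.log_of_one_lt_of_le (by omega) (by omega)
          omega
      · refine Runs.loop_continue (Runs.bind (Runs.pop_cons hk) (Runs.bind (Runs.edit k 0 [a] _)
          (Runs.bind (Runs.of_eq hr ?_ rfl le_rfl) (Runs.bind (Runs.edit dst 0 [TapeSymbol.hash] _)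
            (Runs.pure _ _) le_rfl) le_rfl) le_rfl) le_rfl) (Runs.of_eq hr' ?_ ?_ le_rfl) ?_
        · funext k
          simp only [Function.update_apply]
          split_ifs <;> simp_all
        · funext k
          simp only [Function.update_apply]
          split_ifs <;> simp_all
        · funext k
          simp only [Function.update_apply]
          split_ifs <;> simp_all
        · have : n / 2 + 1 ≤ n := by omega
          nlinarith [Nat.mul_le_mul (show 8 * (n / 2) + 12 ≤ 8 * n + 12 by omega) this]

/-! ### A binary counter -/

/-- Incrementing a binary counter (least significant bit first), with the overflow bit. -/
def increment : List Bool → Bool × List Bool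
  | [] => (true, [])
  | false :: c => (false, true :: c)
  | true :: c => ((increment c).1, false :: (increment c).2)

/-- The number of increments until the counter overflows. -/
def ticksLeft : List Bool → ℕ
  | [] => 1
  | false :: c => 2 * ticksLeft c
  | true :: c => 2 * ticksLeft c - 1

theorem ticksLeft_pos (c : List Bool) : 0 < ticksLeft c := by
  induction c with
  | nil => simp [ticksLeft]
  | cons b c ih => cases b <;> simp only [ticksLeft] <;> omega

theorem ticksLeft_replicate (n : ℕ) : ticksLeft (List.replicate n false) = 2 ^ n := by
  induction n with
  | zero => rfl
  | succ n ih => rw [List.replicate_succ, ticksLeft, ih, pow_succ']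

theorem length_increment (c : List Bool) : (increment c).2.length = c.length := by
  induction c with
  | nil => rfl
  | cons b c ih => cases b <;> simp [increment, ih]

/-- On overflow the counter is all zeros again, so it can be reused for another full period of
2^length ticks. -/
theorem increment_overflow {c : List Bool} (h : (increment c).1 = true) :
    ticksLeft c = 1 ∧ (increment c).2 = List.replicate c.length false := by
  induction c with
  | nil => simp [increment, ticksLeft]
  | cons b c ih =>
    cases b
    · simp [increment] at h
    · have := ih h
      simp [increment, ticksLeft, this, List.replicate_succ]

theorem ticksLeft_increment {c : List Bool} (h : (increment c).1 = false) :
    ticksLeft (increment c).2 + 1 = ticksLeft c := by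
  induction c with
  | nil => simp [increment] at h
  | cons b c ih =>
    cases b
    · have := ticksLeft_pos c
      simp only [increment, ticksLeft]
      omega
    · have := ih h
      have := ticksLeft_pos (increment c).2
      simp only [increment, ticksLeft]
      omega

/-- Passing a carry to the next bit. -/
def carryStep (k tmp : K) : Frag K (Option TapeSymbol × τ) (Unit ⊕ Bool) :=
  (pop k).bind fun x => match x with
    | none => pure (.inr true)
    | some (.bit true) => (edit tmp 0 [.bit false]).bind fun _ => pure (.inl ())
    | some _ => (edit k 0 [.bit true]).bind fun _ => pure (.inr false)

/-- Incrementing the counter on the stack `k`. -/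
def tick (k tmp : K) : Frag K (Option TapeSymbol × τ) Bool :=
  (loop (fun _ : Unit => carryStep k tmp) ()).bind
    fun r => (move tmp k fun a => [a]).bind fun _ => pure r

/-- The low bits already passed lie reversed on `tmp`, and `w.reverse ++ v` is the counter cut at
the position of the carry. -/
theorem Runs.carry {k tmp : K} (h : k ≠ tmp) (S : Stk K) (c : List Bool) :
    ∀ u : List TapeSymbol, ∃ v w : List TapeSymbol,
      w.reverse ++ v = u.reverse ++ encBits (increment c).2 ∧ w.length ≤ u.length + c.length ∧
      Runs q O (loop (fun _ : Unit => carryStep k tmp) () : Frag K (Option TapeSymbol × τ) _)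
        (update (update S k (encBits c)) tmp u) (3 * c.length + 3) (increment c).1
        (update (update S k v) tmp w) := by
  induction c with
  | nil =>
    intro u
    refine ⟨[], u, by simp [increment, encBits], by simp, ?_⟩
    refine Runs.loop_exit (Runs.bind (Runs.pop_nil ?_) (Runs.pure _ _) le_rfl) (by simp)
    simp [h, encBits]
  | cons b c ih =>
    intro u
    cases b
    · refine ⟨.bit true :: encBits c, u, by simp [increment, encBits], by simp, ?_⟩
      refine Runs.loop_exit (Runs.bind (Runs.pop_cons (a := .bit false) (w := encBits c) ?_)
        (Runs.bind (Runs.edit k 0 [.bit true] _) (Runs.of_eq (Runs.pure _ _) rfl ?_ le_rfl) le_rfl)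
          le_rfl) (by simp)
      · simp [h, encBits]
      · funext k
        simp only [Function.update_apply]
        split_ifs <;> simp_all
    · obtain ⟨v, w, hv, hw, hr⟩ := ih (.bit false :: u)
      refine ⟨v, w, by rw [hv]; simp [increment, encBits], by simp at hw ⊢; omega, ?_⟩
      refine Runs.loop_continue (Runs.bind (Runs.pop_cons (a := .bit true) (w := encBits c) ?_)
        (Runs.bind (Runs.edit tmp 0 [.bit false] _) (Runs.pure _ _) le_rfl) le_rfl)
          (Runs.of_eq hr ?_ rfl le_rfl) ?_
      · simp [h, encBits]
      · funext k
        simp only [Function.update_apply]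
        split_ifs <;> simp_all
      · simp
        omega

theorem Runs.tick {k tmp : K} (h : k ≠ tmp) (S : Stk K) (htmp : S tmp = []) (c : List Bool)
    (hc : S k = encBits c) :
    Runs q O (Frag.tick k tmp : Frag K (Option TapeSymbol × τ) _) S (6 * c.length + 5)
      (increment c).1 (update S k (encBits (increment c).2)) := by
  obtain ⟨v, w, hv, hw, hr⟩ := Runs.carry (q := q) (O := O) (τ := τ) h S c []
  rw [List.length_nil, zero_add] at hw
  rw [List.reverse_nil, List.nil_append] at hv
  refine Runs.bind (Runs.of_eq hr (by simp [← hc, ← htmp]) rfl le_rfl)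
    (Runs.bind (Runs.moveBack h.symm _) (Runs.of_eq (Runs.pure _ _) rfl ?_ le_rfl) le_rfl) ?_
  · funext k
    simp only [Function.update_apply]
    split_ifs <;> simp_all
  · simp
    omega

/-- Emptying several stacks. -/
def clearAll : List K → Frag K (Option TapeSymbol × τ) Unit
  | [] => pure ()
  | k :: ks => (clear k).bind fun _ => clearAll ks

theorem Runs.clearAll (ks : List K) (S : Stk K) :
    Runs q O (Frag.clearAll ks : Frag K (Option TapeSymbol × τ) _) S
      (2 * (ks.map fun k => (S k).length).sum + 2 * ks.length) ()
      (fun k => if k ∈ ks then [] else S k) := by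
  induction ks generalizing S with
  | nil => exact Runs.of_eq (Runs.pure () S) rfl (by simp) (by simp)
  | cons k ks ih =>
    refine Runs.bind (Runs.clear k S) (Runs.of_eq (ih _) rfl ?_ le_rfl) ?_
    · funext j
      simp only [Function.update_apply]
      by_cases h₁ : j = k <;> simp [h₁]
    · have : (ks.map fun j => (update S k [] j).length).sum ≤ (ks.map fun j => (S j).length).sum := by
        refine List.sum_le_sum fun j _ => ?_
        simp only [Function.update_apply]
        split_ifs <;> simp
      simp only [List.map_cons, List.sum_cons, List.length_cons]
      omega

end Frag

/-! ### Expectations over the coins of a machine -/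

theorem ENNReal.half_add_half (a : ℝ≥0∞) : (a + a) / 2 = a := by
  rw [ENNReal.add_div, ENNReal.add_halves]

theorem ENNReal.le_avg {a b c : ℝ≥0∞} (hb : a ≤ b) (hc : a ≤ c) : a ≤ (b + c) / 2 := by
  rw [← ENNReal.half_add_half a]
  exact ENNReal.div_le_div_right (add_le_add hb hc) _

theorem ENNReal.avg_le {a b c : ℝ≥0∞} (hb : b ≤ a) (hc : c ≤ a) : (b + c) / 2 ≤ a := by
  rw [← ENNReal.half_add_half a]
  exact ENNReal.div_le_div_right (add_le_add hb hc) _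

theorem ENNReal.add_avg (a b c : ℝ≥0∞) : (a + b + (a + c)) / 2 = a + (b + c) / 2 := by
  rw [show a + b + (a + c) = a + a + (b + c) by ring, ENNReal.add_div, ENNReal.half_add_half]

namespace OracleTM

variable (M : OracleTM) (O : List TapeSymbol → Bool)

theorem step_none {c : M.Cfg} (h : c.l = none) (b : Bool) : M.step O c b = c := by
  simp [step, h]

/-- The expected value of `ψ` after some steps. -/
noncomputable def avg (ψ : M.Cfg → ℝ≥0∞) : ℕ → M.Cfg → ℝ≥0∞
  | 0, c => ψ c
  | n + 1, c => (avg ψ n (M.step O c true) + avg ψ n (M.step O c false)) / 2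

/-- Splitting off the first coin identifies the recursive average with the uniform one over coin
sequences, the form used by `prob`. -/
theorem avg_eq (ψ : M.Cfg → ℝ≥0∞) (n : ℕ) (c : M.Cfg) :
    M.avg O ψ n c = (∑ r : Fin n → Bool, ψ ((List.ofFn r).foldl (M.step O) c)) / 2 ^ n := by
  induction n generalizing c with
  | zero => simp [avg]
  | succ n ih =>
    rw [avg, ih, ih, ← (Fin.consEquiv fun _ => Bool).sum_comp, Fintype.sum_prod_type,
      Fintype.sum_bool]
    have hcons : ∀ (b : Bool) (r : Fin n → Bool),
        List.ofFn (Fin.consEquiv (fun _ => Bool) (b, r)) = b :: List.ofFn r :=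
      fun b r => List.ofFn_cons b r
    simp only [hcons, List.foldl_cons]
    rw [← ENNReal.add_div, div_eq_mul_inv, div_eq_mul_inv, div_eq_mul_inv, mul_assoc, pow_succ,
      ENNReal.mul_inv (by simp) (by simp)]

theorem avg_none (ψ : M.Cfg → ℝ≥0∞) (n : ℕ) {c : M.Cfg} (h : c.l = none) :
    M.avg O ψ n c = ψ c := by
  induction n with
  | zero => rfl
  | succ n ih => rw [avg, M.step_none O h, M.step_none O h, ih, ENNReal.half_add_half]

/-- The number of push instructions of a statement. -/
def pushCount {K Λ σ : Type} : TStmt K Λ σ → ℕ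
  | .push _ _ s => pushCount s + 1
  | .peek _ _ s => pushCount s
  | .pop _ _ s => pushCount s
  | .load _ s => pushCount s
  | .branch _ s t => pushCount s + pushCount t
  | .goto _ => 0
  | .halt => 0

/-- The total height of the stacks. -/
def stkSize {K : Type} [Fintype K] (S : Stk K) : ℕ := ∑ k, (S k).length

theorem stkSize_update {K : Type} [Fintype K] [DecidableEq K] (S : Stk K) (k : K)
    (w : List TapeSymbol) : stkSize (update S k w) + (S k).length = stkSize S + w.length := by
  unfold stkSize
  rw [← Finset.add_sum_erase _ _ (Finset.mem_univ k), ← Finset.add_sum_erase _ (fun k => (S k).length)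
    (Finset.mem_univ k), Function.update_self,
    Finset.sum_congr rfl fun j hj => by rw [Function.update_of_ne (Finset.ne_of_mem_erase hj)]]
  omega

theorem stkSize_stepAux {K Λ σ : Type} [Fintype K] [DecidableEq K] (s : TStmt K Λ σ) (v : σ)
    (S : Stk K) : stkSize (Turing.TM2.stepAux s v S).stk ≤ stkSize S + pushCount s := by
  induction s generalizing v S with
  | push k f s ih =>
    have := ih v (update S k (f v :: S k))
    have h := stkSize_update S k (f v :: S k)
    simp only [List.length_cons] at h
    simp only [Turing.TM2.stepAux, pushCount]
    omega
  | pop k f s ih =>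
    have := ih (f v (S k).head?) (update S k (S k).tail)
    have h := stkSize_update S k (S k).tail
    simp only [List.length_tail] at h
    simp only [Turing.TM2.stepAux, pushCount]
    omega
  | branch p s t hs ht =>
    have := hs v S
    have := ht v S
    simp only [Turing.TM2.stepAux, pushCount]
    cases p v <;> simp only [cond_true, cond_false] <;> omega
  | peek k f s ih => exact ih _ _
  | load f s ih => exact ih _ _
  | goto f => simp [Turing.TM2.stepAux]
  | halt => simp [Turing.TM2.stepAux]

/-- A bound on the growth of the stacks in one step. -/
def growth : ℕ := ∑ l, match M.prog l with
  | .exec s => pushCount s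
  | _ => 0

/-- Linear growth of the stacks bounds the length of an output and the cost of emptying the stacks
after a simulated run. -/
theorem stkSize_step (c : M.Cfg) (b : Bool) :
    stkSize (M.step O c b).stk ≤ stkSize c.stk + M.growth := by
  unfold step
  split
  · omega
  · rename_i l _
    have hle := Finset.single_le_sum (f := fun l => match M.prog l with
      | .exec s => pushCount s
      | _ => 0) (fun _ _ => Nat.zero_le _) (Finset.mem_univ l)
    split
    · rename_i s hs
      simp only [hs] at hle
      exact (stkSize_stepAux s _ _).trans (Nat.add_le_add_left hle _)
    · exact Nat.le_add_right _ _
    · exact Nat.le_add_right _ _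

/-- The expected value of `φ` (a function of the remaining time and the stacks) when the machine
halts; running out of time has the value `⊤`. -/
noncomputable def haltWp (φ : ℕ → Stk M.K → ℝ≥0∞) : ℕ → M.Cfg → ℝ≥0∞
  | 0, c => if c.l = none then φ 0 c.stk else ⊤
  | n + 1, c => if c.l = none then φ (n + 1) c.stk else
      (haltWp φ n (M.step O c true) + haltWp φ n (M.step O c false)) / 2

theorem haltWp_none (φ : ℕ → Stk M.K → ℝ≥0∞) (n : ℕ) {c : M.Cfg} (h : c.l = none) :
    M.haltWp O φ n c = φ n c.stk := by
  cases n <;> simp [haltWp, h]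

theorem haltWp_zero (φ : ℕ → Stk M.K → ℝ≥0∞) {c : M.Cfg} (h : c.l ≠ none) :
    M.haltWp O φ 0 c = ⊤ := by
  simp [haltWp, h]

theorem haltWp_succ (φ : ℕ → Stk M.K → ℝ≥0∞) (n : ℕ) {c : M.Cfg} (h : c.l ≠ none) :
    M.haltWp O φ (n + 1) c =
      (M.haltWp O φ n (M.step O c true) + M.haltWp O φ n (M.step O c false)) / 2 := by
  simp [haltWp, h]

/-- A halted machine stays where it is, so evaluating at the halting time or at the deadline makes
no difference. The quantity size + growth · remaining time never increases, hence `φ` has to be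
controlled only on stacks satisfying the corresponding bound. -/
theorem haltWp_le_avg (φ : ℕ → Stk M.K → ℝ≥0∞) (h : Stk M.K → ℝ≥0∞) (n : ℕ) (c : M.Cfg)
    (hn : ∀ r : Fin n → Bool, ((List.ofFn r).foldl (M.step O) c).l = none)
    (hφ : ∀ m ≤ n, ∀ S, stkSize S + M.growth * m ≤ stkSize c.stk + M.growth * n → φ m S ≤ h S) :
    M.haltWp O φ n c ≤ M.avg O (fun c => h c.stk) n c := by
  induction n generalizing c with
  | zero =>
    have := hn Fin.elim0
    rw [List.ofFn_zero, List.foldl_nil] at this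
    rw [M.haltWp_none O φ 0 this]
    exact hφ 0 le_rfl _ le_rfl
  | succ n ih =>
    by_cases hc : c.l = none
    · rw [M.haltWp_none O φ _ hc, M.avg_none O _ _ hc]
      exact hφ _ le_rfl _ le_rfl
    · have key : ∀ b, M.haltWp O φ n (M.step O c b) ≤
          M.avg O (fun c => h c.stk) n (M.step O c b) := by
        intro b
        refine ih _ (fun r => ?_) fun m hm S hS => hφ m (by omega) S (hS.trans ?_)
        · have := hn (Fin.cons b r)
          rwa [List.ofFn_cons, List.foldl_cons] at this
        · have := M.stkSize_step O c b
          rw [Nat.mul_succ]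
          omega
      rw [M.haltWp_succ O φ n hc, avg]
      exact ENNReal.div_le_div_right (add_le_add (key true) (key false)) _

theorem stkSize_initCfg (x : List TapeSymbol) : stkSize (M.initCfg x).stk = x.length := by
  have := stkSize_update (fun _ : M.K => ([] : List TapeSymbol)) M.inp x
  simpa [stkSize, initCfg] using this

/-- A bound for a machine with a sure output property: the output satisfies `A ∨ B`. -/
theorem haltWp_le_of_prob {x : List TapeSymbol} {T : ℕ} (hT : M.HaltsWithin O x T)
    {A B : List TapeSymbol → Prop}
    (hAB : ∀ r : Fin T → Bool, B (M.output O x r) ∨ A (M.output O x r))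
    {p : ℝ} (hp : p ≤ M.prob O x T A) (φ : ℕ → Stk M.K → ℝ≥0∞) (a b : ℝ≥0∞)
    (hφA : ∀ m ≤ T, ∀ S, stkSize S + M.growth * m ≤ x.length + M.growth * T → A (S M.out) → φ m S ≤ a)
    (hφB : ∀ m ≤ T, ∀ S, stkSize S + M.growth * m ≤ x.length + M.growth * T → B (S M.out) →
      φ m S ≤ a + b) :
    M.haltWp O φ T (M.initCfg x) ≤ a + b * ENNReal.ofReal (1 - p) := by
  classical
  refine (M.haltWp_le_avg O φ (fun S => if A (S M.out) then a else if B (S M.out) then a + b else ⊤)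
    T _ hT fun m hm S hS => ?_).trans ?_
  · rw [M.stkSize_initCfg] at hS
    split_ifs with h₁ h₂
    exacts [hφA m hm S hS h₁, hφB m hm S hS h₂, le_top]
  rw [avg_eq]
  have hpow : (2 : ℝ≥0∞) ^ T ≠ 0 := by simp
  have hpow' : (2 : ℝ≥0∞) ^ T ≠ ⊤ := by simp
  rw [ENNReal.div_le_iff hpow hpow']
  have hsum : ∀ r : Fin T → Bool,
      (fun c : M.Cfg => if A (c.stk M.out) then a else if B (c.stk M.out) then a + b else ⊤)
        ((List.ofFn r).foldl (M.step O) (M.initCfg x)) ≤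
      a + b * (if A (M.output O x r) then 0 else 1) := by
    intro r
    change (if A (M.output O x r) then a else if B (M.output O x r) then a + b else ⊤) ≤ _
    by_cases h : A (M.output O x r)
    · simp [h]
    · simp [h, (hAB r).resolve_right h]
  refine (Finset.sum_le_sum fun r _ => hsum r).trans ?_
  rw [Finset.sum_add_distrib, ← Finset.mul_sum, add_mul, mul_assoc]
  refine add_le_add (by simp [mul_comm]) (mul_le_mul_right ?_ b)
  have hcard : (Finset.univ.filter fun r : Fin T → Bool => A (M.output O x r)).card +
      (Finset.univ.filter fun r : Fin T → Bool => ¬ A (M.output O x r)).card = 2 ^ T := by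
    rw [Finset.card_filter_add_card_filter_not]
    simp
  rw [prob, Nat.card_eq_fintype_card, Fintype.card_subtype, le_div_iff₀ (by positivity)] at hp
  have hcardR : ((Finset.univ.filter fun r : Fin T → Bool => A (M.output O x r)).card : ℝ) +
      ((Finset.univ.filter fun r : Fin T → Bool => ¬ A (M.output O x r)).card : ℝ) = 2 ^ T := by
    exact_mod_cast hcard
  have h1 : (∑ r : Fin T → Bool, if A (M.output O x r) then (0 : ℝ≥0∞) else 1) =
      ENNReal.ofReal ((Finset.univ.filter fun r : Fin T → Bool => ¬ A (M.output O x r)).card : ℝ) := by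
    rw [ENNReal.ofReal_natCast, Finset.card_filter, Nat.cast_sum]
    refine Finset.sum_congr rfl fun r _ => ?_
    by_cases h : A (M.output O x r) <;> simp [h]
  have h2 : (2 : ℝ≥0∞) ^ T = ENNReal.ofReal (2 ^ T) := by
    rw [ENNReal.ofReal_pow (by norm_num)]
    simp
  rw [h1, h2, ← ENNReal.ofReal_mul' (by positivity)]
  refine ENNReal.ofReal_le_ofReal ?_
  linarith

end OracleTM

namespace Frag

/-! ### Running a machine as a fragment -/

/-- Translation of a statement along an embedding of the stacks and a projection of the states. -/
def embedStmt {K₀ Λ ρ K Λ' τ : Type} (e : K₀ → K) (get : τ → ρ) (set : ρ → τ → τ) (g : Λ → Λ')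
    (h : Λ') : TStmt K₀ Λ ρ → TStmt K Λ' (Option TapeSymbol × τ)
  | .push k f s => .push (e k) (fun v => f (get v.2)) (embedStmt e get set g h s)
  | .peek k f s => .peek (e k) (fun v x => (v.1, set (f (get v.2) x) v.2)) (embedStmt e get set g h s)
  | .pop k f s => .pop (e k) (fun v x => (v.1, set (f (get v.2) x) v.2)) (embedStmt e get set g h s)
  | .load f s => .load (fun v => (v.1, set (f (get v.2)) v.2)) (embedStmt e get set g h s)
  | .branch p s t =>
    .branch (fun v => p (get v.2)) (embedStmt e get set g h s) (embedStmt e get set g h t)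
  | .goto f => .goto fun v => g (f (get v.2))
  | .halt => .goto fun _ => h

theorem update_extend {K₀ K : Type} [DecidableEq K₀] [DecidableEq K] {e : K₀ → K}
    (he : Function.Injective e) (st : Stk K₀) (S : Stk K) (k : K₀) (w : List TapeSymbol) :
    update (Function.extend e st S) (e k) w = Function.extend e (update st k w) S := by
  funext j
  by_cases hj : ∃ i, e i = j
  · obtain ⟨i, rfl⟩ := hj
    simp only [Function.update_apply, he.extend_apply, he.eq_iff]
  · rw [Function.extend_apply' _ _ _ hj, Function.update_of_ne (fun h => hj ⟨k, h.symm⟩),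
      Function.extend_apply' _ _ _ hj]

/-- Halting becomes a jump to `h`, so that the host program regains control; the stacks outside the
range of `e` are untouched. -/
theorem stepAux_embedStmt {K₀ Λ ρ K Λ' τ : Type} [DecidableEq K₀] [DecidableEq K] {e : K₀ → K}
    (he : Function.Injective e) {get : τ → ρ} {set : ρ → τ → τ} (hgs : ∀ x v, get (set x v) = x)
    (g : Λ → Λ') (h : Λ') (s : TStmt K₀ Λ ρ) (v : Option TapeSymbol × τ) (st : Stk K₀) (S : Stk K) :
    ∃ v', get v'.2 = (Turing.TM2.stepAux s (get v.2) st).var ∧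
      Turing.TM2.stepAux (embedStmt e get set g h s) v (Function.extend e st S) =
        ⟨some ((Turing.TM2.stepAux s (get v.2) st).l.elim h g), v',
          Function.extend e (Turing.TM2.stepAux s (get v.2) st).stk S⟩ := by
  induction s generalizing v st with
  | push k f s ih =>
    simpa [embedStmt, he.extend_apply, update_extend he] using ih v (update st k (f (get v.2) :: st k))
  | peek k f s ih =>
    simpa [embedStmt, he.extend_apply, hgs] using
      ih (v.1, set (f (get v.2) (st k).head?) v.2) st
  | pop k f s ih =>
    simpa [embedStmt, he.extend_apply, update_extend he, hgs] using
      ih (v.1, set (f (get v.2) (st k).head?) v.2) (update st k (st k).tail)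
  | load f s ih =>
    simpa [embedStmt, hgs] using ih (v.1, set (f (get v.2)) v.2) st
  | branch p s t hs ht =>
    simp only [embedStmt, Turing.TM2.stepAux]
    cases p (get v.2)
    · exact ht v st
    · exact hs v st
  | goto f => exact ⟨v, rfl, rfl⟩
  | halt => exact ⟨v, rfl, rfl⟩

variable {K τ : Type} (M : OracleTM) (e : M.K → K) (get : τ → M.σ) (set : M.σ → τ → τ)

/-- Where to go after a step of the machine. -/
def callLabel : Option M.Λ → (Unit ⊕ M.Λ × Bool) ⊕ Bool
  | none => .inr true
  | some l => .inl (.inr (l, false))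

/-- The program of `call`. -/
def callProg (clk : Option K) :
    Unit ⊕ M.Λ × Bool → Instr K ((Unit ⊕ M.Λ × Bool) ⊕ Bool) (Option TapeSymbol × τ)
  | .inl () => .exec (.load (fun v => (v.1, set M.startState v.2))
      (.goto fun _ => callLabel M (some M.start)))
  | .inr (l, false) => match clk with
    | none => .exec (.goto fun _ => .inl (.inr (l, true)))
    | some k => .exec (.pop k (fun v x => (x, v.2))
        (.goto fun v => if v.1 = none then .inr false else .inl (.inr (l, true))))
  | .inr (l, true) => match M.prog l with
    | .exec s => .exec (embedStmt e get set (fun l => callLabel M (some l)) (callLabel M none) s)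
    | .flip next => .flip fun b => callLabel M (some (next b))
    | .query next => .query fun b => callLabel M (some (next b))

/-- Running the machine `M`. If there is a clock, a symbol is popped from it for each step of `M`;
the exit is `false` if the clock is empty before `M` halts. -/
def call (clk : Option K) : Frag K (Option TapeSymbol × τ) Bool where
  Λ := Unit ⊕ M.Λ × Bool
  entry := .inl (.inl ())
  prog := callProg M e get set clk

variable [DecidableEq K] (O : List TapeSymbol → Bool) {M e get set}

/-- The machine model supplies a coin to every step, a fragment tosses one only at a flip. At the
other instructions both coins lead to the same configuration, so nothing is lost by averaging over
them. -/
theorem flow_call_step (he : Function.Injective e) (hgs : ∀ x v, get (set x v) = x) (clk : Option K)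
    (φ : Bool → ℕ → (Option TapeSymbol × τ) → Stk K → ℝ≥0∞) (n : ℕ) {c : M.Cfg} {l : M.Λ}
    (hl : c.l = some l) {v : Option TapeSymbol × τ} (hv : get v.2 = c.var) (S : Stk K)
    (R : Bool → ℝ≥0∞)
    (hR : ∀ b v', get v'.2 = (M.step O c b).var →
      flow (e M.qry) O (callProg M e get set clk) φ n (callLabel M (M.step O c b).l) v'
        (Function.extend e (M.step O c b).stk S) ≤ R b) :
    flow (e M.qry) O (callProg M e get set clk) φ (n + 1) (.inl (.inr (l, true))) v
      (Function.extend e c.stk S) ≤ (R true + R false) / 2 := by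
  rw [flow_succ]
  rcases hp : M.prog l with s | next | next
  · have hstep : ∀ b, M.step O c b = Turing.TM2.stepAux s c.var c.stk := fun b => by
      simp only [OracleTM.step, hl, hp]
    obtain ⟨v', hv', hs⟩ := stepAux_embedStmt he hgs (fun l => callLabel M (some l))
      (callLabel M none) s v c.stk S
    rw [hv] at hv' hs
    simp only [callProg, hp, Instr.wp, hs, TCfg.eval]
    have hlab : ∀ o : Option M.Λ, o.elim (callLabel M none) (fun l => callLabel M (some l)) =
        callLabel M o := by rintro (_ | _) <;> rfl
    rw [hlab]
    refine ENNReal.le_avg ?_ ?_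
    · have := hR true v' (by rw [hstep]; exact hv')
      rwa [hstep] at this
    · have := hR false v' (by rw [hstep]; exact hv')
      rwa [hstep] at this
  · have hstep : ∀ b, M.step O c b = ⟨some (next b), c.var, c.stk⟩ := fun b => by
      simp only [OracleTM.step, hl, hp]
    simp only [callProg, hp, Instr.wp]
    simp only [hstep] at hR
    exact ENNReal.div_le_div_right (add_le_add (hR true v hv) (hR false v hv)) _
  · have hstep : ∀ b, M.step O c b = ⟨some (next (O (c.stk M.qry))), c.var, c.stk⟩ := fun b => by
      simp only [OracleTM.step, hl, hp]
    simp only [callProg, hp, Instr.wp, he.extend_apply]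
    simp only [hstep] at hR
    exact ENNReal.le_avg (hR true v hv) (hR false v hv)

/-- Each simulated step passes through the labels `(l, false)` and `(l, true)`, hence two units of
fuel per step. -/
theorem flow_call_none (he : Function.Injective e) (hgs : ∀ x v, get (set x v) = x)
    (φ : Bool → ℕ → Stk K → ℝ≥0∞) (m n : ℕ) (S : Stk K) {c : M.Cfg} {l : M.Λ}
    (hl : c.l = some l) {v : Option TapeSymbol × τ} (hv : get v.2 = c.var) :
    flow (e M.qry) O (callProg M e get set none) (fun x n _ S => φ x n S) (m + 2 * n)
      (callLabel M c.l) v (Function.extend e c.stk S) ≤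
      M.haltWp O (fun k st => φ true (m + 2 * k) (Function.extend e st S)) n c := by
  induction n generalizing c l v with
  | zero =>
    rw [M.haltWp_zero O _ (by rw [hl]; exact Option.some_ne_none l)]
    exact le_top
  | succ n ih =>
    rw [M.haltWp_succ O _ _ (by rw [hl]; exact Option.some_ne_none l), hl,
      show m + 2 * (n + 1) = m + 2 * n + 1 + 1 by ring, callLabel, flow_succ]
    refine flow_call_step O he hgs none _ (m + 2 * n) hl hv S
      (fun b => M.haltWp O _ n (M.step O c b)) fun b v' hv' => ?_
    rcases hc : (M.step O c b).l with _ | l'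
    · rw [M.haltWp_none O _ _ hc]
      exact (flow_inr _ _ _ _ _ _ _ _).le
    · rw [← hc]
      exact ih hc hv'

/-- Every simulated step removes one symbol from the clock, which is the equation `w'.length + n =
w.length + j` for the remaining allowance. The exit `false` requires a clock shorter than the
allowance `n`. The last unit of fuel pays for the test that finds the clock empty. -/
theorem flow_call_some (he : Function.Injective e) (hgs : ∀ x v, get (set x v) = x) {k : K}
    (hk : ∀ i, e i ≠ k) (φ : Bool → ℕ → Stk K → ℝ≥0∞) (m n : ℕ) (S : Stk K)
    (w : List TapeSymbol) (a : ℝ≥0∞) (χ : ℕ → Stk M.K → ℝ≥0∞) {c : M.Cfg} {l : M.Λ}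
    (hl : c.l = some l) {v : Option TapeSymbol × τ} (hv : get v.2 = c.var)
    (htime : w.length < n → ∀ st, OracleTM.stkSize st ≤ OracleTM.stkSize c.stk + M.growth * w.length →
      φ false m (Function.extend e st (update S k [])) ≤ a)
    (hfin : ∀ w' j st, w'.length < w.length → w'.length + n = w.length + j →
      φ true (m + 2 * w'.length + 1) (Function.extend e st (update S k w')) ≤ a + χ j st) :
    flow (e M.qry) O (callProg M e get set (some k)) (fun x n _ S => φ x n S)
      (m + 2 * w.length + 1) (callLabel M c.l) v (Function.extend e c.stk (update S k w)) ≤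
      a + M.haltWp O χ n c := by
  have hkap : ∀ (st : Stk M.K) (u : List TapeSymbol),
      Function.extend e st (update S k u) k = u := fun st u => by
    rw [Function.extend_apply' _ _ _ (fun ⟨i, hi⟩ => hk i hi), Function.update_self]
  have hkup : ∀ (st : Stk M.K) (u u' : List TapeSymbol),
      update (Function.extend e st (update S k u)) k u' = Function.extend e st (update S k u') := by
    intro st u u'
    funext j
    by_cases hj : ∃ i, e i = j
    · obtain ⟨i, rfl⟩ := hj
      rw [Function.update_of_ne (hk i), he.extend_apply, he.extend_apply]
    · rw [Function.extend_apply' _ _ _ hj]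
      simp only [Function.update_apply]
      split_ifs with h
      · rfl
      · rw [Function.extend_apply' _ _ _ hj, Function.update_of_ne h]
  induction w generalizing n c l v with
  | nil =>
    rcases n with _ | n
    · rw [M.haltWp_zero O _ (by rw [hl]; exact Option.some_ne_none l), add_top]
      exact le_top
    · rw [hl, callLabel, List.length_nil, flow_succ]
      simp only [callProg, Instr.wp, Turing.TM2.stepAux, TCfg.eval, hkap, hkup, List.head?_nil,
        List.tail_nil, if_true]
      rw [flow_inr]
      refine (htime (by simp) c.stk (by simp)).trans le_self_add
  | cons b w ih =>
    rcases n with _ | n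
    · rw [M.haltWp_zero O _ (by rw [hl]; exact Option.some_ne_none l), add_top]
      exact le_top
    · rw [M.haltWp_succ O _ _ (by rw [hl]; exact Option.some_ne_none l), hl, ← ENNReal.add_avg,
        show m + 2 * (b :: w).length + 1 = m + 2 * w.length + 1 + 1 + 1 by
          rw [List.length_cons]; ring, callLabel, flow_succ]
      have hpop : ∀ f, (callProg M e get set (some k) (.inr (l, false))).wp (e M.qry) O f v
          (Function.extend e c.stk (update S k (b :: w))) =
          f (.inl (.inr (l, true))) (some b, v.2) (Function.extend e c.stk (update S k w)) := by
        intro f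
        simp only [callProg, Instr.wp, Turing.TM2.stepAux, TCfg.eval, hkap, hkup, List.head?_cons,
          List.tail_cons]
        rfl
      rw [hpop]
      refine flow_call_step O he hgs (some k) _ _ hl (v := (some b, v.2)) hv (update S k w)
        (fun b => a + M.haltWp O χ n (M.step O c b)) fun b' v' hv' => ?_
      rcases hc : (M.step O c b').l with _ | l'
      · rw [M.haltWp_none O _ _ hc, callLabel, flow_inr]
        refine hfin w n _ (by simp) (by simp; omega)
      · rw [← hc]
        refine ih _ hc hv' (fun hw st hst => htime (by simp; omega) st (hst.trans ?_))
          fun w' j st hw' hj => hfin w' j st (by simp; omega) (by simp; omega)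
        have := M.stkSize_step O c b'
        rw [List.length_cons, Nat.mul_succ]
        omega

theorem wp_call_none (he : Function.Injective e) (hgs : ∀ x v, get (set x v) = x)
    (φ : Bool → ℕ → Stk K → ℝ≥0∞) (m n : ℕ) (S : Stk K) (x : List TapeSymbol) :
    (call M e get set none).wp (e M.qry) O φ (m + 2 * n + 1)
      (Function.extend e (M.initCfg x).stk S) ≤
      M.haltWp O (fun k st => φ true (m + 2 * k) (Function.extend e st S)) n (M.initCfg x) := by
  refine iSup_le fun v => (flow_succ _ O (callProg M e get set none) _ _ (.inl ()) v _).trans_le ?_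
  exact flow_call_none O he hgs φ m n S (c := M.initCfg x) rfl (v := (v.1, set M.startState v.2))
    (hgs _ _)

theorem wp_call_some (he : Function.Injective e) (hgs : ∀ x v, get (set x v) = x) {k : K}
    (hk : ∀ i, e i ≠ k) (φ : Bool → ℕ → Stk K → ℝ≥0∞) (m n : ℕ) (S : Stk K)
    (a : ℝ≥0∞) (χ : ℕ → Stk M.K → ℝ≥0∞) (x : List TapeSymbol)
    (htime : (S k).length < n → ∀ st, OracleTM.stkSize st ≤ x.length + M.growth * (S k).length →
      φ false m (Function.extend e st (update S k [])) ≤ a)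
    (hfin : ∀ w' j st, w'.length < (S k).length → w'.length + n = (S k).length + j →
      φ true (m + 2 * w'.length + 1) (Function.extend e st (update S k w')) ≤ a + χ j st) :
    (call M e get set (some k)).wp (e M.qry) O φ (m + 2 * (S k).length + 2)
      (Function.extend e (M.initCfg x).stk S) ≤ a + M.haltWp O χ n (M.initCfg x) := by
  refine iSup_le fun v => (flow_succ _ O (callProg M e get set (some k)) _ _ (.inl ()) v _).trans_le ?_
  have := flow_call_some O he hgs hk φ m n S (S k) a χ (c := M.initCfg x) rfl
    (v := (v.1, set M.startState v.2)) (hgs _ _) (by rwa [M.stkSize_initCfg]) hfin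
  rwa [Function.update_eq_self] at this

/-! ### From fragments to machines -/

/-- The machine of a fragment. -/
noncomputable def toTM {K σ X : Type} [DecidableEq K] [Fintype K] [Fintype σ] [Finite X]
    (F : Frag K σ X) (inp out qry : K) (v₀ : σ) : OracleTM where
  K := K
  Λ := F.Λ ⊕ X
  finΛ := Fintype.ofFinite _
  σ := σ
  inp := inp
  out := out
  qry := qry
  start := F.entry
  startState := v₀
  prog
    | .inl l => F.prog l
    | .inr _ => .exec .halt

/-- At an exit the machine needs one more step to halt, which explains `n + 1`. Runs that are out of
fuel need no argument, since they are worth ⊤ on the right. -/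
theorem avg_toTM {K σ X : Type} [DecidableEq K] [Fintype K] [Fintype σ] [Finite X]
    (F : Frag K σ X) (inp out qry : K) (v₀ : σ)
    (ψ : (F.toTM inp out qry v₀).Cfg → ℝ≥0∞) (φ : X → ℕ → σ → Stk K → ℝ≥0∞)
    (h : ∀ x n v S, ψ ⟨none, v, S⟩ ≤ φ x n v S) (n : ℕ) (z : F.Λ ⊕ X) (v : σ) (S : Stk K) :
    (F.toTM inp out qry v₀).avg O ψ (n + 1) ⟨some z, v, S⟩ ≤ flow qry O F.prog φ n z v S := by
  have hx : ∀ n x v S, (F.toTM inp out qry v₀).avg O ψ (n + 1) ⟨some (.inr x), v, S⟩ ≤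
      φ x n v S := by
    intro n x v S
    have hs : ∀ b, (F.toTM inp out qry v₀).step O ⟨some (.inr x), v, S⟩ b = ⟨none, v, S⟩ :=
      fun b => rfl
    rw [OracleTM.avg, hs, hs, ENNReal.half_add_half, OracleTM.avg_none _ _ _ _ rfl]
    exact h x n v S
  induction n generalizing z v S with
  | zero =>
    rcases z with l | x
    · exact le_top
    · exact hx _ _ _ _
  | succ n ih =>
    rcases z with l | x
    · rw [flow_succ, OracleTM.avg]
      rcases hp : F.prog l with s | next | next
      · have hs : ∀ b, (F.toTM inp out qry v₀).step O ⟨some (.inl l), v, S⟩ b =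
            Turing.TM2.stepAux s v S := fun b => by
          simp only [OracleTM.step, toTM, hp]
          rfl
        rw [hs, hs, ENNReal.half_add_half]
        simp only [Instr.wp, TCfg.eval]
        rcases hc : (Turing.TM2.stepAux s v S).l with _ | z'
        · exact le_top
        · have heq : Turing.TM2.stepAux s v S =
              ⟨some z', (Turing.TM2.stepAux s v S).var, (Turing.TM2.stepAux s v S).stk⟩ := by
            rw [← hc]
          exact (congrArg ((F.toTM inp out qry v₀).avg O ψ (n + 1)) heq).trans_le (ih _ _ _)
      · have hs : ∀ b, (F.toTM inp out qry v₀).step O ⟨some (.inl l), v, S⟩ b =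
            ⟨some (next b), v, S⟩ := fun b => by
          simp only [OracleTM.step, toTM, hp]
        rw [hs, hs]
        exact ENNReal.div_le_div_right (add_le_add (ih _ _ _) (ih _ _ _)) _
      · have hs : ∀ b, (F.toTM inp out qry v₀).step O ⟨some (.inl l), v, S⟩ b =
            ⟨some (next (O (S qry))), v, S⟩ := fun b => by
          simp only [OracleTM.step, toTM, hp]
        rw [hs, hs, ENNReal.half_add_half]
        exact ih _ _ _
    · rw [flow_inr]
      exact hx _ _ _ _

end Frag

/-! ### Sampling a subset -/

/-- The word of a list of bit strings, read backwards; the list is given backwards. -/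
def encListRev (r : List (List Bool)) : List TapeSymbol :=
  r.flatMap fun e => TapeSymbol.comma :: (encBits e).reverse

theorem encListRev_reverse (l : List (List Bool)) : encListRev l.reverse = (encList l).reverse := by
  induction l with
  | nil => rfl
  | cons e l ih =>
    have h1 : encListRev (l.reverse ++ [e]) = encListRev l.reverse ++ encListRev [e] := by
      simp [encListRev]
    rw [List.reverse_cons, h1, ih]
    simp [encListRev, encList]

/-- The expected value of `ψ` at a random sublist: the elements of the first list (which is given
backwards) are kept independently, with probability `1 / 2` if `m` is true, and `1 / 4`
otherwise. -/
noncomputable def sampleAvg (m : Bool) (ψ : List (List Bool) → ℝ≥0∞) :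
    List (List Bool) → List (List Bool) → ℝ≥0∞
  | [], acc => ψ acc
  | e :: r, acc =>
    (sampleAvg m ψ r acc +
      if m then sampleAvg m ψ r (e :: acc)
      else (sampleAvg m ψ r acc + sampleAvg m ψ r (e :: acc)) / 2) / 2

theorem sampleAvg_mono (m : Bool) {ψ χ : List (List Bool) → ℝ≥0∞} (r acc : List (List Bool))
    (h : ∀ X, X.Sublist r.reverse → ψ (X ++ acc) ≤ χ (X ++ acc)) :
    sampleAvg m ψ r acc ≤ sampleAvg m χ r acc := by
  induction r generalizing acc with
  | nil => exact h [] (by simp)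
  | cons e r ih =>
    have h0 := ih acc fun X hX => h X (by
      rw [List.reverse_cons]
      exact hX.trans (List.sublist_append_left _ _))
    have h1 := ih (e :: acc) fun X hX => by
      have := h (X ++ [e]) (by
        rw [List.reverse_cons]
        exact hX.append (List.Sublist.refl _))
      simpa using this
    unfold sampleAvg
    cases m
    · exact ENNReal.div_le_div_right (add_le_add h0 (ENNReal.div_le_div_right (add_le_add h0 h1) _)) _
    · exact ENNReal.div_le_div_right (add_le_add h0 h1) _

theorem sampleAvg_add (m : Bool) (ψ χ : List (List Bool) → ℝ≥0∞) (r acc : List (List Bool)) :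
    sampleAvg m (fun X => ψ X + χ X) r acc = sampleAvg m ψ r acc + sampleAvg m χ r acc := by
  induction r generalizing acc with
  | nil => rfl
  | cons e r ih =>
    unfold sampleAvg
    cases m
    · simp only [ih, Bool.false_eq_true, if_false, ENNReal.add_div]
      ring
    · simp only [ih, if_true, ENNReal.add_div]
      ring

theorem sampleAvg_mul (m : Bool) (b : ℝ≥0∞) (ψ : List (List Bool) → ℝ≥0∞)
    (r acc : List (List Bool)) :
    sampleAvg m (fun X => b * ψ X) r acc = b * sampleAvg m ψ r acc := by
  induction r generalizing acc with
  | nil => rfl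
  | cons e r ih =>
    unfold sampleAvg
    cases m
    · simp only [ih, Bool.false_eq_true, if_false, div_eq_mul_inv]
      ring
    · simp only [ih, if_true, div_eq_mul_inv]
      ring

theorem sampleAvg_const (m : Bool) (b : ℝ≥0∞) (r acc : List (List Bool)) :
    sampleAvg m (fun _ => b) r acc = b := by
  induction r generalizing acc with
  | nil => rfl
  | cons e r ih =>
    unfold sampleAvg
    cases m <;> simp [ih, ENNReal.half_add_half]

theorem sampleAvg_sum {ι : Type} (m : Bool) (s : Finset ι) (ψ : ι → List (List Bool) → ℝ≥0∞)
    (r acc : List (List Bool)) :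
    sampleAvg m (fun X => ∑ i ∈ s, ψ i X) r acc = ∑ i ∈ s, sampleAvg m (ψ i) r acc := by
  classical
  induction s using Finset.induction_on with
  | empty => simpa using sampleAvg_const m 0 r acc
  | insert i s hi ih => simp only [Finset.sum_insert hi, sampleAvg_add, ih]

/-- The probability of keeping or dropping an element. -/
noncomputable def keepProb (m keep : Bool) : ℝ≥0∞ :=
  if m then 1 / 2 else if keep then 1 / 4 else 3 / 4

theorem ENNReal.three_quarters : (1 / 2 : ℝ≥0∞) + 1 / 4 = 3 / 4 := by
  rw [← ENNReal.toReal_eq_toReal_iff' (by finiteness) (by finiteness), ENNReal.toReal_add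
    (by finiteness) (by finiteness)]
  norm_num

theorem ENNReal.half_mul (x : ℝ≥0∞) : 1 / 2 * x = x / 2 := by
  rw [one_div, ENNReal.div_eq_inv_mul]

theorem ENNReal.quarter_mul (x : ℝ≥0∞) : 1 / 4 * x = x / 2 / 2 := by
  rw [one_div, ENNReal.div_eq_inv_mul, ENNReal.div_eq_inv_mul, ← mul_assoc,
    ← ENNReal.mul_inv (by simp) (by simp)]
  norm_num

/-- The probability of a given sublist. -/
theorem prod_keepProb_le (m : Bool) (P : List Bool → Bool) (r acc : List (List Bool)) :
    (r.map fun e => keepProb m (P e)).prod ≤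
      sampleAvg m (fun X => if X = r.reverse.filter P ++ acc then 1 else 0) r acc := by
  induction r generalizing acc with
  | nil => simp [sampleAvg]
  | cons e r ih =>
    rw [List.map_cons, List.prod_cons, sampleAvg]
    cases hP : P e
    · have := ih acc
      simp only [List.reverse_cons, List.filter_append, hP, List.filter_cons_of_neg,
        List.filter_nil, List.append_nil, Bool.false_eq_true, not_false_eq_true]
      cases m
      · simp only [keepProb, Bool.false_eq_true, if_false, ENNReal.add_div] at this ⊢
        refine le_trans (mul_le_mul_right this _) ?_
        rw [← ENNReal.three_quarters, add_mul, ENNReal.half_mul, ENNReal.quarter_mul]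
        exact add_le_add_right le_self_add _
      · simp only [keepProb, if_true] at this ⊢
        refine le_trans (mul_le_mul_right this _) ?_
        rw [ENNReal.add_div, ENNReal.half_mul]
        exact le_self_add
    · have := ih (e :: acc)
      simp only [List.reverse_cons, List.filter_append, hP, List.filter_cons_of_pos,
        List.filter_nil, List.append_assoc, List.cons_append, List.nil_append]
      cases m
      · simp only [keepProb, Bool.false_eq_true, if_false, if_true, ENNReal.add_div] at this ⊢
        refine le_trans (mul_le_mul_right this _) ?_
        rw [ENNReal.quarter_mul]
        exact le_add_self.trans le_add_self
      · simp only [keepProb, if_true] at this ⊢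
        refine le_trans (mul_le_mul_right this _) ?_
        rw [ENNReal.add_div, ENNReal.half_mul]
        exact le_add_self

/-! ### Implementing the random subset on stacks -/

namespace Frag

variable {K τ : Type} [DecidableEq K] {q : K} {O : List TapeSymbol → Bool}

/-- Deciding whether to keep an element. -/
def coin (m : Bool) : Frag K (Option TapeSymbol × τ) Bool :=
  flip.bind fun c => if m then pure c else flip.bind fun c' => pure (c && c')

/-- Processing a symbol of the ground set; `keep` tells whether the current element is kept. -/
def sampleStep (src dst tmp : K) (m keep : Bool) : Frag K (Option TapeSymbol × τ) (Bool ⊕ Unit) :=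
  (pop src).bind fun x => x.elim (pure (.inr ())) fun a => (edit tmp 0 [a]).bind fun _ =>
    if a = .comma then (coin m).bind fun c => (edit dst 0 (if c then [a] else [])).bind fun _ =>
      pure (.inl c)
    else (edit dst 0 (if keep then [a] else [])).bind fun _ => pure (.inl keep)

/-- Writing a random subset of the ground set. -/
def sample (src dst tmp : K) (m : Bool) : Frag K (Option TapeSymbol × τ) Unit :=
  (loop (sampleStep src dst tmp m) false).bind fun _ => move tmp src fun a => [a]

theorem wp_bind_flip {σ Y : Type} (G : Bool → Frag K σ Y) (φ : Y → ℕ → Stk K → ℝ≥0∞) (n : ℕ)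
    (S : Stk K) :
    (flip.bind G).wp q O φ (n + 1) S ≤ ((G true).wp q O φ n S + (G false).wp q O φ n S) / 2 :=
  (wp_bind _ _ _ _ _).trans (wp_flip _ _ _)

theorem wp_coin (m : Bool) {φ : Bool → ℕ → Stk K → ℝ≥0∞} (hφ : ∀ x S, Antitone fun n => φ x n S)
    (n : ℕ) (S : Stk K) :
    (coin m : Frag K (Option TapeSymbol × τ) Bool).wp q O φ (n + 2) S ≤
      (φ false n S + if m then φ true n S else (φ false n S + φ true n S) / 2) / 2 := by
  refine (wp_bind_flip _ φ (n + 1) S).trans ?_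
  rw [add_comm (Frag.wp q O _ _ _ _)]
  cases m
  · simp only [Bool.false_eq_true, if_false]
    refine ENNReal.div_le_div_right (add_le_add ?_ ?_) _
    · exact (wp_bind_flip _ φ n S).trans (ENNReal.avg_le (wp_pure _ _ _ _) (wp_pure _ _ _ _))
    · refine (wp_bind_flip _ φ n S).trans ?_
      rw [add_comm (φ false n S)]
      exact ENNReal.div_le_div_right (add_le_add (wp_pure _ _ _ _) (wp_pure _ _ _ _)) _
  · simp only [if_true]
    refine ENNReal.div_le_div_right (add_le_add ?_ ?_) _
    · exact (wp_pure _ _ _ _).trans (hφ _ _ (Nat.le_succ n))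
    · exact (wp_pure _ _ _ _).trans (hφ _ _ (Nat.le_succ n))

/-- The stacks while a subset is sampled. -/
def sampleStk (src dst tmp : K) (S : Stk K) (u v w : List TapeSymbol) : Stk K :=
  update (update (update S src u) tmp v) dst w

variable {src dst tmp : K}

theorem wp_sampleStep_bit (h₁ : src ≠ dst) (h₂ : src ≠ tmp) (h₃ : dst ≠ tmp) (m keep : Bool)
    (S : Stk K) (u v w : List TapeSymbol) (b : Bool) :
    Runs q O (sampleStep src dst tmp m keep : Frag K (Option TapeSymbol × τ) _)
      (sampleStk src dst tmp S (.bit b :: u) v w) 3 (.inl keep)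
      (sampleStk src dst tmp S u (.bit b :: v) ((if keep then [.bit b] else []) ++ w)) := by
  refine Runs.bind (Runs.pop_cons (a := .bit b) (w := u) ?_) (Runs.bind (Runs.edit tmp 0 _ _)
    (Runs.bind (Runs.edit dst 0 _ _) (Runs.of_eq (Runs.pure _ _) rfl ?_ le_rfl) le_rfl) le_rfl) le_rfl
  · simp [sampleStk, h₁, h₂]
  · unfold sampleStk
    funext k
    simp only [Function.update_apply]
    split_ifs <;> simp_all

theorem wp_sample_bits (h₁ : src ≠ dst) (h₂ : src ≠ tmp) (h₃ : dst ≠ tmp) (m keep : Bool)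
    (S : Stk K) (e : List Bool) (u v w : List TapeSymbol)
    {φ : Unit → ℕ → Stk K → ℝ≥0∞} (hφ : ∀ x S, Antitone fun n => φ x n S) (n : ℕ) :
    (loop (sampleStep src dst tmp m) keep : Frag K (Option TapeSymbol × τ) _).wp q O φ
      (n + 4 * e.length) (sampleStk src dst tmp S (encBits e ++ u) v w) ≤
    (loop (sampleStep src dst tmp m) keep : Frag K (Option TapeSymbol × τ) _).wp q O φ n
      (sampleStk src dst tmp S u ((encBits e).reverse ++ v)
        ((if keep then (encBits e).reverse else []) ++ w)) := by
  induction e generalizing v w with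
  | nil => cases keep <;> simp [encBits]
  | cons b e ih =>
    rw [List.length_cons, show n + 4 * (e.length + 1) = n + 4 * e.length + 3 + 1 by ring]
    refine (wp_loop _ _ _ _ _).trans ?_
    refine (wp_sampleStep_bit h₁ h₂ h₃ m keep S (encBits e ++ u) v w b _ (loop_antitone hφ) _).trans ?_
    refine (ih _ _).trans (le_of_eq ?_)
    cases keep <;> simp [encBits]

/-- Reading the ground set backwards brings the comma of an element before its bits, so the decision
to keep it is taken before copying; pushing then restores the forward order. The coins of this loop
are exactly those averaged over by `sampleAvg`. -/
theorem wp_sample_loop (h₁ : src ≠ dst) (h₂ : src ≠ tmp) (h₃ : dst ≠ tmp) (m keep : Bool)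
    (S : Stk K) (r acc : List (List Bool)) (v w : List TapeSymbol)
    {φ : Unit → ℕ → Stk K → ℝ≥0∞} (hφ : ∀ x S, Antitone fun n => φ x n S) (n : ℕ) :
    (loop (sampleStep src dst tmp m) keep : Frag K (Option TapeSymbol × τ) _).wp q O φ
      (n + 6 * (encListRev r).length + 2)
      (sampleStk src dst tmp S (encListRev r) v (encList acc ++ w)) ≤
    sampleAvg m (fun X => φ () n
      (sampleStk src dst tmp S [] ((encListRev r).reverse ++ v) (encList X ++ w))) r acc := by
  induction r generalizing acc v keep with
  | nil =>
    have : Runs q O (loop (sampleStep src dst tmp m) keep : Frag K (Option TapeSymbol × τ) _)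
        (sampleStk src dst tmp S [] v (encList acc ++ w)) 2 ()
        (sampleStk src dst tmp S [] v (encList acc ++ w)) :=
      Runs.loop_exit (Runs.bind (Runs.pop_nil (by simp [sampleStk, h₁, h₂])) (Runs.pure _ _) le_rfl)
        le_rfl
    exact this φ hφ n
  | cons e r ih =>
    have henc : encListRev (e :: r) = .comma :: ((encBits e.reverse) ++ encListRev r) := by
      simp [encListRev, encBits]
    have hlen : (encListRev (e :: r)).length = 1 + e.length + (encListRev r).length := by
      rw [henc]
      simp [encBits]
      omega
    set N := n + 6 * (encListRev r).length + 2 with hN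
    have hnext : ∀ c, (loop (sampleStep src dst tmp m) c : Frag K (Option TapeSymbol × τ) _).wp q O
        φ (N + 4 * e.length) (sampleStk src dst tmp S (encBits e.reverse ++ encListRev r)
          (.comma :: v) ((if c then [.comma] else []) ++ (encList acc ++ w))) ≤
        sampleAvg m (fun X => φ () n (sampleStk src dst tmp S []
          ((encListRev (e :: r)).reverse ++ v) (encList X ++ w))) r
          (if c then e :: acc else acc) := by
      intro c
      have h := wp_sample_bits (q := q) (O := O) (τ := τ) h₁ h₂ h₃ m c S e.reverse (encListRev r)
        (.comma :: v) ((if c then [.comma] else []) ++ (encList acc ++ w)) hφ N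
      rw [List.length_reverse] at h
      refine h.trans (le_trans (le_of_eq ?_) ((ih c (if c then e :: acc else acc)
        ((encBits e.reverse).reverse ++ .comma :: v)).trans (le_of_eq ?_)))
      · congr 2
        cases c <;> simp [encBits, encList]
      · rw [henc]
        simp
    have hfuel : N + 4 * e.length + 6 ≤ n + 6 * (encListRev (e :: r)).length + 2 := by
      rw [hlen, hN]
      omega
    refine (wp_antitone _ hφ _ hfuel).trans ?_
    refine (wp_loop _ _ _ (N + 4 * e.length + 5) _).trans ?_
    set Φ : Bool ⊕ Unit → ℕ → Stk K → ℝ≥0∞ := fun r n S =>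
      r.elim (fun a' => (loop (sampleStep src dst tmp m) a' :
        Frag K (Option TapeSymbol × τ) _).wp q O φ n S) fun x => φ x n S with hΦdef
    have hΦ : ∀ x S, Antitone fun n => Φ x n S := loop_antitone hφ
    have hpop : Runs q O (Frag.pop src : Frag K (Option TapeSymbol × τ) _)
        (sampleStk src dst tmp S (encListRev (e :: r)) v (encList acc ++ w)) 1
        (some .comma) (sampleStk src dst tmp S (encBits e.reverse ++ encListRev r) v
          (encList acc ++ w)) :=
      Runs.of_eq (Runs.pop_cons (a := .comma) (w := encBits e.reverse ++ encListRev r)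
        (by simp [sampleStk, h₁, h₂, henc])) rfl (by
          unfold sampleStk
          funext k
          simp only [Function.update_apply]
          split_ifs <;> simp_all) le_rfl
    refine (hpop.wp_bind_le hΦ (N + 4 * e.length + 4)).trans ?_
    have hedit : Runs q O (Frag.edit tmp 0 [.comma] : Frag K (Option TapeSymbol × τ) _)
        (sampleStk src dst tmp S (encBits e.reverse ++ encListRev r) v (encList acc ++ w)) 1 ()
        (sampleStk src dst tmp S (encBits e.reverse ++ encListRev r) (.comma :: v)
          (encList acc ++ w)) :=
      Runs.of_eq (Runs.edit tmp 0 _ _) rfl (by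
        unfold sampleStk
        funext k
        simp only [Function.update_apply]
        split_ifs <;> simp_all) le_rfl
    refine (hedit.wp_bind_le hΦ (N + 4 * e.length + 3)).trans ?_
    rw [if_pos rfl]
    refine (wp_bind _ _ _ _ _).trans ?_
    refine (wp_coin m (fun x S => wp_antitone _ hΦ S) (N + 4 * e.length + 1) _).trans ?_
    have hc : ∀ c, ((Frag.edit dst 0 (if c then [.comma] else [])).bind fun _ => Frag.pure (.inl c) :
        Frag K (Option TapeSymbol × τ) (Bool ⊕ Unit)).wp q O Φ (N + 4 * e.length + 1)
        (sampleStk src dst tmp S (encBits e.reverse ++ encListRev r) (.comma :: v)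
          (encList acc ++ w)) ≤ sampleAvg m (fun X => φ () n (sampleStk src dst tmp S []
          ((encListRev (e :: r)).reverse ++ v) (encList X ++ w))) r
          (if c then e :: acc else acc) := by
      intro c
      refine le_trans ?_ (hnext c)
      have : Runs q O ((Frag.edit dst 0 (if c then [.comma] else [])).bind fun _ =>
          Frag.pure (.inl c) : Frag K (Option TapeSymbol × τ) (Bool ⊕ Unit))
          (sampleStk src dst tmp S (encBits e.reverse ++ encListRev r) (.comma :: v)
          (encList acc ++ w)) 1 (.inl c) (sampleStk src dst tmp S (encBits e.reverse ++ encListRev r)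
          (.comma :: v) ((if c then [.comma] else []) ++ (encList acc ++ w))) :=
        Runs.bind (Runs.edit dst 0 _ _) (Runs.of_eq (Runs.pure _ _) rfl (by
          unfold sampleStk
          funext k
          simp only [Function.update_apply]
          split_ifs <;> simp_all) le_rfl) le_rfl
      exact this Φ hΦ _
    rw [sampleAvg]
    have hf := hc false
    have ht := hc true
    simp only [Bool.false_eq_true, if_false, if_true] at hf ht ⊢
    cases m
    · simp only [Bool.false_eq_true, if_false]
      exact ENNReal.div_le_div_right (add_le_add hf
        (ENNReal.div_le_div_right (add_le_add hf ht) _)) _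
    · simp only [if_true]
      exact ENNReal.div_le_div_right (add_le_add hf ht) _

theorem wp_sample (h₁ : src ≠ dst) (h₂ : src ≠ tmp) (h₃ : dst ≠ tmp) (m : Bool) (S : Stk K)
    (l : List (List Bool)) (hsrc : S src = (encList l).reverse) (htmp : S tmp = [])
    {φ : Unit → ℕ → Stk K → ℝ≥0∞} (hφ : ∀ x S, Antitone fun n => φ x n S) (n : ℕ) :
    (sample src dst tmp m : Frag K (Option TapeSymbol × τ) _).wp q O φ
      (n + 9 * (S src).length + 4) S ≤
    sampleAvg m (fun X => φ () n (update S dst (encList X ++ S dst))) l.reverse [] := by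
  have hS : S = sampleStk src dst tmp S (encListRev l.reverse) [] (encList [] ++ S dst) := by
    rw [encListRev_reverse, ← hsrc, ← htmp]
    simp [sampleStk, encList]
  have hlen : (S src).length = (encListRev l.reverse).length := by rw [encListRev_reverse, hsrc]
  refine (wp_bind _ _ _ _ _).trans ?_
  rw [hlen, show n + 9 * (encListRev l.reverse).length + 4 =
    n + 3 * (encListRev l.reverse).length + 2 + 6 * (encListRev l.reverse).length + 2 by ring]
  conv_lhs => rw [hS]
  refine (wp_sample_loop h₁ h₂ h₃ m false S l.reverse [] [] (S dst)
    (fun x S => wp_antitone _ hφ S) _).trans ?_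
  refine sampleAvg_mono m _ _ fun X _ => ?_
  simp only [List.append_nil]
  clear hS
  have : Runs q O (Frag.move tmp src (fun a => [a]) : Frag K (Option TapeSymbol × τ) _)
      (sampleStk src dst tmp S [] (encListRev l.reverse).reverse (encList X ++ S dst))
      (3 * (encListRev l.reverse).length + 2) () (update S dst (encList X ++ S dst)) := by
    refine Runs.of_eq (Runs.moveBack h₂.symm _) rfl ?_ ?_
    · unfold sampleStk
      rw [encListRev_reverse]
      funext k
      simp only [Function.update_apply]
      split_ifs <;> simp_all
    · simp [sampleStk, Function.update_of_ne h₃.symm]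
  exact this φ hφ n

end Frag

/-! ### One trial: sampling a set and extending it -/

/-- The working stacks. -/
inductive Own : Type
  | inp | out | qry | tmp | tmp' | br | er | cnt | idx | jdx | len | ctr | clk | wclk | rep | wrep
  deriving DecidableEq

instance : Fintype Own where
  elems := {.inp, .out, .qry, .tmp, .tmp', .br, .er, .cnt, .idx, .jdx, .len, .ctr, .clk, .wclk,
    .rep, .wrep}
  complete x := by cases x <;> simp

section

variable (N M : OracleTM)

/-- The working stacks and the stacks of two machines. -/
abbrev AllStk : Type := Own ⊕ N.K ⊕ M.K

/-- The embedding of the stacks of the first machine; the query stacks are identified. -/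
def embFst (k : N.K) : AllStk N M := if k = N.qry then .inl .qry else .inr (.inl k)

/-- The embedding of the stacks of the second machine; the query stacks are identified. -/
def embSnd (k : M.K) : AllStk N M := if k = M.qry then .inl .qry else .inr (.inr k)

theorem embFst_injective : Function.Injective (embFst N M) := by
  intro j k h
  unfold embFst at h
  split_ifs at h <;> simp_all

theorem embSnd_injective : Function.Injective (embSnd N M) := by
  intro j k h
  unfold embSnd at h
  split_ifs at h <;> simp_all

theorem embFst_qry : embFst N M N.qry = .inl .qry := if_pos rfl

theorem embSnd_qry : embSnd N M M.qry = .inl .qry := if_pos rfl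

variable {N M}

theorem embFst_ne {o : Own} (ho : o ≠ .qry) (k : N.K) : embFst N M k ≠ .inl o := by
  unfold embFst
  split_ifs <;> simp [ho.symm]

theorem embSnd_ne {o : Own} (ho : o ≠ .qry) (k : M.K) : embSnd N M k ≠ .inl o := by
  unfold embSnd
  split_ifs <;> simp [ho.symm]

end

/-- A correct extension machine for an instance, with a time bound depending on `ℓ`. -/
def ExtendsWithin (M : OracleTM) (I : SetInstance) (τ : ℕ → ℕ) : Prop :=
  ∀ X ⊆ I.E, ∀ l, IsListing l X → ∀ ℓ : ℕ,
    M.HaltsWithin I.answer (encTriple I.B l ℓ) (τ ℓ) ∧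
    (∀ r : Fin (τ ℓ) → Bool,
      M.output I.answer (encTriple I.B l ℓ) r = encBot ∨
      ∃ S s, I.IsExtension X ℓ S ∧ IsListing s S ∧
        M.output I.answer (encTriple I.B l ℓ) r = encList s) ∧
    ((∃ S, I.IsExtension X ℓ S) →
      1 / 2 ≤ M.prob I.answer (encTriple I.B l ℓ) (τ ℓ)
        fun w => ∃ S s, I.IsExtension X ℓ S ∧ IsListing s S ∧ w = encList s)

/-- One symbol of the answer therefore suffices to tell `⊥` from an extension. -/
theorem head?_encList_ne (s : List (List Bool)) : (encList s).head? ≠ some TapeSymbol.hash := by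
  rcases s with _ | ⟨_ | ⟨b, e⟩, s⟩ <;> simp [encList, encBits]

theorem length_encTriple (B : List Bool) (l : List (List Bool)) (ℓ : ℕ) :
    (encTriple B l ℓ).length = B.length + (encList l).length + ℓ.bits.length + 2 := by
  simp [encTriple, encPair, encBits]
  omega

namespace Frag

variable (N M : OracleTM)

/-- The internal states: a register and the internal states of the two machines. -/
abbrev AllReg : Type := Option TapeSymbol × (N.σ × M.σ)

/-- Reading the answer of the extension machine and emptying its stacks. -/
noncomputable def readAnswer (fin : Bool) : Frag (AllStk N M) (AllReg N M) (Option Bool) :=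
  (pop (embSnd N M M.out)).bind fun y =>
    (clearAll ((Finset.univ : Finset M.K).toList.map (embSnd N M))).bind fun _ =>
      pure (if fin then some (decide (y ≠ some TapeSymbol.hash)) else none)

/-- Running the extension machine: `none` if the clock runs out. -/
noncomputable def callExt : Frag (AllStk N M) (AllReg N M) (Option Bool) :=
  (call M (embSnd N M) Prod.snd (fun x v => (v.1, x)) (some (.inl .wclk))).bind (readAnswer N M)

/-- Writing the size of the extension. -/
def writeSize (m : Bool) : Frag (AllStk N M) (AllReg N M) Unit :=
  if m then (edit (embSnd N M M.inp) 0 [.bit true]).bind fun _ =>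
    scan (.inl .idx) (embSnd N M M.inp) (.inl .tmp) 0 fun _ => [.bit false]
  else pure ()

/-- The part of a trial after the choice of the mode `m`. -/
noncomputable def trialMode (m : Bool) : Frag (AllStk N M) (AllReg N M) (Option Bool) :=
  (writeSize N M m).bind fun _ => (edit (embSnd N M M.inp) 0 [.hash]).bind fun _ =>
    (sample (.inl .er) (embSnd N M M.inp) (.inl .tmp) m).bind fun _ =>
      (edit (embSnd N M M.inp) 0 [.hash]).bind fun _ =>
        (scan (.inl .br) (embSnd N M M.inp) (.inl .tmp) 0 fun a => [a]).bind fun _ => callExt N M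

/-- A trial. -/
noncomputable def trial : Frag (AllStk N M) (AllReg N M) (Option Bool) :=
  flip.bind fun m => trialMode N M m

variable {N M} {O : List TapeSymbol → Bool}

/-- Emptying all stacks of the simulated machine, including the shared query stack, makes the next
call start from an initial configuration. The price is linear in the total height of these stacks.
-/
theorem Runs.readAnswer (fin : Bool) (st : Stk M.K) (S : Stk (AllStk N M))
    (hS : ∀ k, S (embSnd N M k) = []) (w : List TapeSymbol) :
    Runs (.inl .qry) O (readAnswer N M fin)
      (Function.extend (embSnd N M) st (update S (.inl .wclk) w))
      (2 * OracleTM.stkSize st + 2 * Fintype.card M.K + 1)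
      (if fin then some (decide ((st M.out).head? ≠ some TapeSymbol.hash)) else none)
      (update S (.inl .wclk) w) := by
  have hinj := embSnd_injective N M
  have hpop := Runs.pop (q := .inl .qry) (O := O) (τ := N.σ × M.σ) (embSnd N M M.out)
    (Function.extend (embSnd N M) st (update S (.inl .wclk) w))
  rw [hinj.extend_apply] at hpop
  refine Runs.bind hpop (Runs.bind (Runs.clearAll _ _) (Runs.of_eq (Runs.pure _ _) rfl ?_ le_rfl)
    le_rfl) ?_
  · funext k
    by_cases hk : ∃ i, embSnd N M i = k
    · obtain ⟨i, rfl⟩ := hk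
      rw [if_pos (by simp), Function.update_of_ne (embSnd_ne (by simp) i), hS]
    · rw [if_neg (by simpa using hk), Function.update_of_ne (fun h => hk ⟨_, h.symm⟩),
        Function.extend_apply' _ _ _ hk]
  · have h : (((Finset.univ : Finset M.K).toList.map (embSnd N M)).map fun k =>
        (update (Function.extend (embSnd N M) st (update S (.inl .wclk) w)) (embSnd N M M.out)
          (st M.out).tail k).length).sum = OracleTM.stkSize (update st M.out (st M.out).tail) := by
      rw [List.map_map, Finset.sum_map_toList, OracleTM.stkSize]
      refine Finset.sum_congr rfl fun i _ => ?_
      rw [Function.comp_apply, update_extend hinj, hinj.extend_apply]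
    have h' := OracleTM.stkSize_update st M.out (st M.out).tail
    rw [h]
    simp only [List.length_map, Finset.length_toList, Finset.card_univ, List.length_tail] at h' ⊢
    omega

theorem update_inp_eq_extend {M : OracleTM} {K : Type} [DecidableEq K] {e : M.K → K}
    (he : Function.Injective e) {S : Stk K} (hS : ∀ k, S (e k) = []) (x : List TapeSymbol) :
    update S (e M.inp) x = Function.extend e (M.initCfg x).stk S := by
  have h0 : S = Function.extend e (fun _ => []) S := by
    funext k
    by_cases hk : ∃ i, e i = k
    · obtain ⟨i, rfl⟩ := hk
      rw [he.extend_apply, hS]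
    · rw [Function.extend_apply' _ _ _ hk]
  conv_lhs => rw [h0]
  exact update_extend he _ _ _ _

-- Value `a` covers a timeout and a success, and `b` is the surcharge for a failure; a failure has
-- probability at most 1/2 when an extension exists. Fuel is budgeted at `C` per clock symbol, and
-- `ex` is the part of this budget already spent on writing the input. A success forces 𝓕 to be
-- nonempty because the machine never returns anything but a true extension or `⊥`.
open Classical in
theorem wp_callExt {I : SetInstance} {τ : ℕ → ℕ} (hM : ExtendsWithin M I τ)
    {X : List (List Bool)} (hX : X.Nodup) (hXE : X.toFinset ⊆ I.E) {ℓ T : ℕ} (hT : τ ℓ ≤ T)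
    {S : Stk (AllStk N M)} (hS : ∀ k, S (embSnd N M k) = [])
    {φ : Option Bool → ℕ → Stk (AllStk N M) → ℝ≥0∞} (hφ : ∀ x S, Antitone fun n => φ x n S)
    {a b : ℝ≥0∞} {C n n' ex : ℕ}
    (hC : 2 * (encTriple I.B X ℓ).length + 2 * M.growth + 2 * Fintype.card M.K + 4 + ex ≤ C)
    (hn : n + C * ((S (.inl .wclk)).length + 1) ≤ n' + ex)
    (htime : (S (.inl .wclk)).length < T → φ none n (update S (.inl .wclk) []) ≤ a)
    (hyes : I.F.Nonempty → ∀ w : List TapeSymbol, w.length < (S (.inl .wclk)).length →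
      φ (some true) (n + C * (w.length + 1)) (update S (.inl .wclk) w) ≤ a)
    (hno : ∀ w : List TapeSymbol, w.length < (S (.inl .wclk)).length →
      (S (.inl .wclk)).length ≤ w.length + T →
      φ (some false) (n + C * (w.length + 1)) (update S (.inl .wclk) w) ≤ a + b) :
    (callExt N M).wp (.inl .qry) I.answer φ n'
      (update S (embSnd N M M.inp) (encTriple I.B X ℓ)) ≤
      a + b * (if ∃ S, I.IsExtension X.toFinset ℓ S then 1 / 2 else 1) := by
  classical
  set c := (S (.inl .wclk)).length with hc
  set x := encTriple I.B X ℓ with hx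
  obtain ⟨m₀, rfl⟩ : ∃ m₀, n' = m₀ + 2 * c + 2 := by
    refine ⟨n' - (2 * c + 2), ?_⟩
    have : 2 * (c + 1) + ex ≤ C * (c + 1) := by nlinarith
    omega
  rw [update_inp_eq_extend (embSnd_injective N M) hS]
  refine (wp_bind _ _ _ _ _).trans ?_
  obtain ⟨hhalt, hval, hprob⟩ := hM X.toFinset hXE X ⟨hX, rfl⟩ ℓ
  set good : List TapeSymbol → Prop := fun w => ∃ S s, I.IsExtension X.toFinset ℓ S ∧
    IsListing s S ∧ w = encList s with hgood
  -- Worth ⊤ outside the stack bound and outside the permitted outputs: in the remaining cases both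
  -- facts are then available when the call finishes.
  set χ : ℕ → Stk M.K → ℝ≥0∞ := fun j st =>
    if j ≤ τ ℓ ∧ OracleTM.stkSize st + M.growth * j ≤ x.length + M.growth * τ ℓ then
      if good (st M.out) then 0 else if st M.out = encBot then b else ⊤
    else ⊤ with hχ
  -- After `c - c'` simulated steps the stacks have grown by at most `growth` times that number, so
  -- the budget of the consumed clock symbols also pays for emptying them.
  have hcost : ∀ s c', c' < c → s ≤ x.length + M.growth * (c - c') →
      n + C * (c' + 1) + (2 * s + 2 * Fintype.card M.K + 1) ≤ m₀ + 2 * c' + 1 := by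
    intro s c' hc' hs
    clear_value c
    obtain ⟨d, rfl⟩ : ∃ d, c = c' + d + 1 := ⟨c - c' - 1, by omega⟩
    rw [show c' + d + 1 - c' = d + 1 by omega] at hs
    have h1 : C * (c' + d + 1 + 1) = C * (c' + 1) + C * (d + 1) := by ring
    have h2 : (2 * x.length + 2 * M.growth + 2 * Fintype.card M.K + 4 + ex) * (d + 1) ≤
      C * (d + 1) := Nat.mul_le_mul_right _ hC
    have h3 : 2 * x.length + 2 * (M.growth * (d + 1)) + 2 * Fintype.card M.K + 4 * (d + 1) + ex ≤
      (2 * x.length + 2 * M.growth + 2 * Fintype.card M.K + 4 + ex) * (d + 1) := by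
      have : (2 * x.length + 2 * M.growth + 2 * Fintype.card M.K + 4 + ex) * (d + 1) =
        2 * x.length + 2 * (M.growth * (d + 1)) + 2 * Fintype.card M.K + 4 * (d + 1) + ex +
        d * (2 * x.length + 2 * Fintype.card M.K + ex) := by ring
      omega
    omega
  have hmain := wp_call_some (e := embSnd N M) (get := (Prod.snd : N.σ × M.σ → M.σ))
    (set := fun x v => (v.1, x)) I.answer (embSnd_injective N M) (fun _ _ => rfl)
    (k := .inl .wclk) (embSnd_ne (by simp)) (fun x n S => (readAnswer N M x).wp (.inl .qry)
      I.answer φ n S) m₀ (τ ℓ) S a χ x ?_ ?_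
  · rw [embSnd_qry] at hmain
    refine hmain.trans (add_le_add_right ?_ a)
    -- With no extension nothing is known about the probability of success, and `p = 0` is used.
    have := M.haltWp_le_of_prob I.answer hhalt (A := good) (B := fun w => w = encBot) hval
      (p := if ∃ S, I.IsExtension X.toFinset ℓ S then 1 / 2 else 0) ?_ χ 0 b ?_ ?_
    · refine this.trans (le_of_eq ?_)
      rw [zero_add]
      congr 1
      split_ifs
      · rw [show (1 : ℝ) - 1 / 2 = 1 / 2 by norm_num, ENNReal.ofReal_div_of_pos (by norm_num)]
        simp
      · simp
    · split_ifs with h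
      · exact hprob h
      · exact div_nonneg (Nat.cast_nonneg _) (by positivity)
    · intro m hm st hst hg
      simp only [χ]
      rw [if_pos ⟨hm, hst⟩, if_pos hg]
    · intro m hm st hst hb
      simp only [χ]
      rw [if_pos ⟨hm, hst⟩, zero_add]
      split_ifs
      exacts [zero_le, le_rfl]
  · intro hlt st hst
    rw [← hc] at hst
    have := Runs.readAnswer (O := I.answer) false st S hS [] φ hφ n
    refine (wp_antitone _ hφ _ ?_).trans (this.trans (htime (hlt.trans_le hT)))
    have h1 : (2 * x.length + 2 * M.growth + 2 * Fintype.card M.K + 4 + ex) * (c + 1) ≤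
      C * (c + 1) := Nat.mul_le_mul_right _ hC
    have h3 : 2 * x.length + 2 * (M.growth * c) + 2 * Fintype.card M.K + 4 * (c + 1) + ex ≤
      (2 * x.length + 2 * M.growth + 2 * Fintype.card M.K + 4 + ex) * (c + 1) := by
      have : (2 * x.length + 2 * M.growth + 2 * Fintype.card M.K + 4 + ex) * (c + 1) =
        2 * x.length + 2 * (M.growth * c) + 2 * Fintype.card M.K + 4 * (c + 1) + ex +
        (c * (2 * x.length + 2 * Fintype.card M.K + ex) + 2 * M.growth) := by ring
      omega
    omega
  · intro w j st hw hj
    simp only [χ]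
    split_ifs with h₁ h₂ h₃
    · have hext : I.F.Nonempty := by
        obtain ⟨S, s, hS, -⟩ := h₂
        exact ⟨_, hS.2.1⟩
      rw [add_zero]
      refine le_trans ?_ (hyes hext w hw)
      have := Runs.readAnswer (O := I.answer) true st S hS w φ hφ (n + C * (w.length + 1))
      have hhead : (st M.out).head? ≠ some TapeSymbol.hash := by
        obtain ⟨S, s, -, -, h⟩ := h₂
        rw [h]
        exact head?_encList_ne s
      rw [if_pos rfl, decide_eq_true hhead] at this
      refine (wp_antitone _ hφ _ (hcost _ w.length hw ?_)).trans this
      have h2 : M.growth * τ ℓ = M.growth * (c - w.length) + M.growth * j := by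
        rw [← Nat.mul_add]
        congr 1
        omega
      omega
    · refine le_trans ?_ (hno w hw (by omega))
      have := Runs.readAnswer (O := I.answer) true st S hS w φ hφ (n + C * (w.length + 1))
      rw [if_pos rfl, h₃, show decide ((encBot).head? ≠ some TapeSymbol.hash) = false from rfl]
        at this
      refine (wp_antitone _ hφ _ (hcost _ w.length hw ?_)).trans this
      have h2 : M.growth * τ ℓ = M.growth * (c - w.length) + M.growth * j := by
        rw [← Nat.mul_add]
        congr 1
        omega
      omega
    · exact le_top.trans (by simp)
    · exact le_top.trans (by simp)

/-- The size of the extension in mode `m`. -/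
def modeSize (i : ℕ) (m : Bool) : ℕ := if m then 2 ^ i else 0

theorem flatMap_const_singleton (c : TapeSymbol) (w : List TapeSymbol) :
    w.flatMap (fun _ => [c]) = List.replicate w.length c := by
  induction w with
  | nil => rfl
  | cons a w ih =>
    rw [List.flatMap_cons, ih]
    rfl

theorem bits_two_pow (i : ℕ) : (2 ^ i).bits = List.replicate i false ++ [true] := by
  induction i with
  | zero => simp
  | succ i ih =>
    rw [pow_succ', Nat.bit0_bits _ (by positivity), ih, List.replicate_succ, List.cons_append]

theorem length_bits_modeSize (i : ℕ) (m : Bool) : (modeSize i m).bits.length ≤ i + 1 := by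
  cases m <;> simp [modeSize, bits_two_pow]

open Classical in
/-- The probability that a trial fails, up to the choice of the mode. -/
noncomputable def failProb (I : SetInstance) (l : List (List Bool)) (i : ℕ) (m : Bool) : ℝ≥0∞ :=
  sampleAvg m (fun X => if ∃ S, I.IsExtension X.toFinset (modeSize i m) S then 1 / 2 else 1)
    l.reverse []

/-- Least significant bit first, 2^i is i zeros followed by a one; pushing writes the one first. The
size 0 has no bits at all. -/
theorem Runs.writeSize (m : Bool) {S : Stk (AllStk N M)} (hS : ∀ k, S (embSnd N M k) = [])
    (htmp : S (.inl .tmp) = []) :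
    Runs (.inl .qry) O (writeSize N M m) S (7 * (S (.inl .idx)).length + 5) ()
      (update S (embSnd N M M.inp) (encBits (modeSize (S (.inl .idx)).length m).bits)) := by
  cases m
  · refine Runs.of_eq (Runs.pure _ _) rfl ?_ (Nat.zero_le _)
    simp only [modeSize]
    simp [encBits, ← hS M.inp]
  · have h₁ : (.inl .idx : AllStk N M) ≠ embSnd N M M.inp := (embSnd_ne (by simp) _).symm
    have h₂ : (.inl .tmp : AllStk N M) ≠ embSnd N M M.inp := (embSnd_ne (by simp) _).symm
    refine Runs.bind (Runs.edit _ _ _ _) (Runs.of_eq (Runs.copy h₁ (by simp) h₂.symm _ _ ?_) rfl ?_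
      le_rfl) ?_
    · rw [Function.update_of_ne h₂, htmp]
    · rw [Function.update_of_ne h₁, Function.update_self, Function.update_idem, hS]
      congr 1
      simp only [modeSize, if_true, bits_two_pow, encBits, List.map_append, List.map_replicate,
        List.map_cons, List.map_nil]
      rw [flatMap_const_singleton, List.length_reverse]
      rfl
    · rw [Function.update_of_ne h₁]
      omega

/-- The input word is pushed from its end: the size, the random set, then the instance. Averaging
over the random set commutes with the bound for the call because that bound is affine in the failure
indicator. -/
theorem wp_trialMode {I : SetInstance} {τ : ℕ → ℕ} (hM : ExtendsWithin M I τ)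
    {l : List (List Bool)} (hl : IsListing l I.E) (m : Bool)
    {S : Stk (AllStk N M)} (hS : ∀ k, S (embSnd N M k) = [])
    (her : S (.inl .er) = (encList l).reverse) (hbr : S (.inl .br) = (encBits I.B).reverse)
    (htmp : S (.inl .tmp) = []) {T : ℕ} (hT : τ (modeSize (S (.inl .idx)).length m) ≤ T)
    {φ : Option Bool → ℕ → Stk (AllStk N M) → ℝ≥0∞} (hφ : ∀ x S, Antitone fun n => φ x n S)
    {a b : ℝ≥0∞} {C n : ℕ}
    (hC : 11 * ((S (.inl .er)).length + (S (.inl .br)).length + (S (.inl .idx)).length) +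
      2 * M.growth + 2 * Fintype.card M.K + 40 ≤ C)
    (htime : (S (.inl .wclk)).length < T → φ none n (update S (.inl .wclk) []) ≤ a)
    (hyes : I.F.Nonempty → ∀ w : List TapeSymbol, w.length < (S (.inl .wclk)).length →
      φ (some true) (n + C * (w.length + 1)) (update S (.inl .wclk) w) ≤ a)
    (hno : ∀ w : List TapeSymbol, w.length < (S (.inl .wclk)).length →
      (S (.inl .wclk)).length ≤ w.length + T →
      φ (some false) (n + C * (w.length + 1)) (update S (.inl .wclk) w) ≤ a + b) {n' : ℕ}
    (hn' : n + C * ((S (.inl .wclk)).length + 1) ≤ n' + 1) :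
    (trialMode N M m).wp (.inl .qry) I.answer φ n' S ≤
      a + b * failProb I l (S (.inl .idx)).length m := by
  classical
  have hne : ∀ o : Own, o ≠ .qry → (.inl o : AllStk N M) ≠ embSnd N M M.inp :=
    fun o ho => (embSnd_ne ho _).symm
  set i := (S (.inl .idx)).length with hi
  set ℓ := modeSize i m with hℓ
  set x := embSnd N M M.inp with hx
  set e := (S (.inl .er)).length with he
  set f := (S (.inl .br)).length with hf
  -- The summands are, from right to left, the costs of writing the size, a separator, the sample, a
  -- separator and the instance. A budget of one clock symbol exceeds their sum.
  obtain ⟨n₁, rfl⟩ : ∃ n₁, n' = n₁ + (7 * f + 4) + 1 + 9 * e + 4 + 1 + (7 * i + 5) := by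
    refine ⟨n' - ((7 * f + 4) + 1 + 9 * e + 4 + 1 + (7 * i + 5)), ?_⟩
    have : C ≤ C * ((S (.inl .wclk)).length + 1) := Nat.le_mul_of_pos_right _ (by omega)
    omega
  refine ((Runs.writeSize m hS htmp).wp_bind_le hφ _).trans ?_
  refine ((Runs.edit x 0 [.hash] _).wp_bind_le hφ _).trans ?_
  rw [Function.update_self, Function.update_idem]
  set S₁ := update S x ([.hash] ++ List.drop 0 (encBits ℓ.bits)) with hS₁
  refine (wp_bind _ _ _ _ _).trans ?_
  have he₁ : (S₁ (.inl .er)).length = e := by rw [hS₁, Function.update_of_ne (hne _ (by simp))]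
  have hsamp := wp_sample (q := .inl .qry) (O := I.answer) (τ := N.σ × M.σ) (src := .inl .er)
    (dst := x) (tmp := .inl .tmp) (hne _ (by simp)) (by simp) (hne _ (by simp)).symm m S₁ l
    (by rw [hS₁, Function.update_of_ne (hne _ (by simp)), her])
    (by rw [hS₁, Function.update_of_ne (hne _ (by simp)), htmp])
    (φ := fun _ n S => ((Frag.edit x 0 [.hash]).bind fun _ =>
        (Frag.scan (.inl .br) x (.inl .tmp) 0 fun a => [a]).bind fun _ => callExt N M).wp
          (.inl .qry) I.answer φ n S)
    (fun _ S => wp_antitone _ hφ S) (n₁ + (7 * f + 4) + 1)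
  rw [he₁] at hsamp
  refine hsamp.trans ?_
  have hlin : a + b * failProb I l i m = sampleAvg m (fun X => a + b *
      (if ∃ S, I.IsExtension X.toFinset ℓ S then 1 / 2 else 1)) l.reverse [] := by
    rw [sampleAvg_add, sampleAvg_const, sampleAvg_mul, failProb]
  rw [hlin]
  refine sampleAvg_mono m _ _ fun X hX => ?_
  rw [List.reverse_reverse] at hX
  simp only [List.append_nil]
  refine ((Runs.edit x 0 [.hash] _).wp_bind_le hφ _).trans ?_
  rw [hS₁, Function.update_self, Function.update_idem, Function.update_self, Function.update_idem]
  have hcopy := Runs.copy (q := .inl .qry) (O := I.answer) (τ := N.σ × M.σ)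
    (hne .br (by simp)) (tmp := .inl .tmp) (by simp)
    (hne .tmp (by simp)).symm (fun a => [a])
    (update S x ([.hash] ++ List.drop 0 (encList X ++ ([.hash] ++ List.drop 0 (encBits ℓ.bits)))))
    (by rw [Function.update_of_ne (hne _ (by simp)), htmp])
  rw [Function.update_of_ne (hne _ (by simp)), Function.update_self, Function.update_idem, ← hf]
    at hcopy
  refine (hcopy.wp_bind_le hφ n₁).trans ?_
  have hword : (S (.inl .br)).reverse.flatMap (fun a => [a]) ++ ([TapeSymbol.hash] ++
      List.drop 0 (encList X ++ ([.hash] ++ List.drop 0 (encBits ℓ.bits)))) =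
      encTriple I.B X ℓ := by
    rw [hbr, List.reverse_reverse]
    simp [encTriple, encPair]
  rw [hword]
  have hXE : X.toFinset ⊆ I.E := by
    rw [← hl.2]
    intro y hy
    rw [List.mem_toFinset] at hy ⊢
    exact hX.subset hy
  have hXl : (encList X).length ≤ e := by
    rw [he, her, List.length_reverse]
    exact (List.Sublist.flatMap hX _).length_le
  have hbits := length_bits_modeSize i m
  rw [← hℓ] at hbits
  refine wp_callExt hM (hX.nodup hl.1) hXE hT hS hφ
    (ex := (7 * f + 4) + 1 + 9 * e + 4 + 1 + (7 * i + 5) + 1) ?_ ?_ htime hyes hno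
  · rw [length_encTriple]
    have : f = I.B.length := by rw [hf, hbr]; simp [encBits]
    omega
  · omega

/-- The probability that a trial fails. -/
noncomputable def trialFail (I : SetInstance) (l : List (List Bool)) (i : ℕ) : ℝ≥0∞ :=
  (failProb I l i true + failProb I l i false) / 2

theorem wp_trial {I : SetInstance} {τ : ℕ → ℕ} (hM : ExtendsWithin M I τ)
    {l : List (List Bool)} (hl : IsListing l I.E)
    {S : Stk (AllStk N M)} (hS : ∀ k, S (embSnd N M k) = [])
    (her : S (.inl .er) = (encList l).reverse) (hbr : S (.inl .br) = (encBits I.B).reverse)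
    (htmp : S (.inl .tmp) = []) {T : ℕ} (hT : ∀ m, τ (modeSize (S (.inl .idx)).length m) ≤ T)
    {φ : Option Bool → ℕ → Stk (AllStk N M) → ℝ≥0∞} (hφ : ∀ x S, Antitone fun n => φ x n S)
    {a b : ℝ≥0∞} {C n : ℕ}
    (hC : 11 * ((S (.inl .er)).length + (S (.inl .br)).length + (S (.inl .idx)).length) +
      2 * M.growth + 2 * Fintype.card M.K + 40 ≤ C)
    (htime : (S (.inl .wclk)).length < T → φ none n (update S (.inl .wclk) []) ≤ a)
    (hyes : I.F.Nonempty → ∀ w : List TapeSymbol, w.length < (S (.inl .wclk)).length →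
      φ (some true) (n + C * (w.length + 1)) (update S (.inl .wclk) w) ≤ a)
    (hno : ∀ w : List TapeSymbol, w.length < (S (.inl .wclk)).length →
      (S (.inl .wclk)).length ≤ w.length + T →
      φ (some false) (n + C * (w.length + 1)) (update S (.inl .wclk) w) ≤ a + b) :
    (trial N M).wp (.inl .qry) I.answer φ (n + C * ((S (.inl .wclk)).length + 1)) S ≤
      a + b * trialFail I l (S (.inl .idx)).length := by
  obtain ⟨n', hn'⟩ : ∃ n', n + C * ((S (.inl .wclk)).length + 1) = n' + 1 := by
    have : C ≤ C * ((S (.inl .wclk)).length + 1) := Nat.le_mul_of_pos_right _ (by omega)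
    exact ⟨n + C * ((S (.inl .wclk)).length + 1) - 1, by omega⟩
  rw [hn']
  refine (wp_bind_flip _ φ n' S).trans ?_
  have h := fun m => wp_trialMode hM hl m hS her hbr htmp (hT m) hφ hC htime hyes hno hn'.le
  refine (ENNReal.div_le_div_right (add_le_add (h true) (h false)) _).trans (le_of_eq ?_)
  rw [ENNReal.add_avg, ← mul_add, mul_div_assoc, trialFail]

end Frag

/-! ### The search with a fixed size of the extensions -/

namespace Frag

variable (N M : OracleTM)

/-- Repeating trials: the exit is `none` if the clock runs out, `some true` after a success, and
`some false` when the counter and the stack `wrep` are exhausted. -/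
noncomputable def trialLoop : Frag (AllStk N M) (AllReg N M) (Option Bool) :=
  loop (fun _ : Unit => (trial N M).bind fun r => match r with
    | none => pure (.inr none)
    | some true => pure (.inr (some true))
    | some false => (tick (.inl .ctr) (.inl .tmp)).bind fun o =>
      if o then (pop (.inl .wrep)).bind fun y => y.elim (pure (.inr (some false)))
        fun _ => pure (.inl ())
      else pure (.inl ())) ()

variable {N M}

/-- The stacks during the trials. -/
def trialStk (S : Stk (AllStk N M)) (c : List Bool) (v w : List TapeSymbol) : Stk (AllStk N M) :=
  update (update (update S (.inl .ctr) (encBits c)) (.inl .wrep) v) (.inl .wclk) w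

theorem trialStk_apply (S : Stk (AllStk N M)) (c : List Bool) (v w : List TapeSymbol)
    (k : AllStk N M) (h₁ : k ≠ .inl .ctr) (h₂ : k ≠ .inl .wrep) (h₃ : k ≠ .inl .wclk) :
    trialStk S c v w k = S k := by
  simp [trialStk, h₁, h₂, h₃]

theorem trialStk_update_ctr (S : Stk (AllStk N M)) (c c' : List Bool) (v w : List TapeSymbol) :
    update (trialStk S c v w) (.inl .ctr) (encBits c') = trialStk S c' v w := by
  unfold trialStk
  funext k
  simp only [Function.update_apply]
  split_ifs <;> simp_all

theorem trialStk_update_wrep (S : Stk (AllStk N M)) (c : List Bool) (v v' w : List TapeSymbol) :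
    update (trialStk S c v w) (.inl .wrep) v' = trialStk S c v' w := by
  unfold trialStk
  funext k
  simp only [Function.update_apply]
  split_ifs <;> simp_all

/-- With R trials left the failure surcharge is multiplied by the R-th power of the failure
probability of a trial. Here R is the number of ticks until overflow plus one full period of the
counter for each symbol on `wrep`. Each trial uses at most `T` clock symbols, so a timeout needs a
clock shorter than R·T. A completed trial uses at least one symbol, hence the induction on the
height of the clock, and the tick after a failure is paid for by that symbol. -/
theorem wp_trialLoop {I : SetInstance} {τ : ℕ → ℕ} (hM : ExtendsWithin M I τ)
    {l : List (List Bool)} (hl : IsListing l I.E)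
    {S : Stk (AllStk N M)} (hS : ∀ k, S (embSnd N M k) = [])
    (her : S (.inl .er) = (encList l).reverse) (hbr : S (.inl .br) = (encBits I.B).reverse)
    (htmp : S (.inl .tmp) = []) {T : ℕ} (hT : ∀ m, τ (modeSize (S (.inl .idx)).length m) ≤ T)
    {φ : Option Bool → ℕ → Stk (AllStk N M) → ℝ≥0∞} (hφ : ∀ x S, Antitone fun n => φ x n S)
    {a b : ℝ≥0∞} {C n : ℕ}
    (hC : 11 * ((S (.inl .er)).length + (S (.inl .br)).length + (S (.inl .idx)).length) +
      2 * M.growth + 2 * Fintype.card M.K + 40 ≤ C)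
    (c : List Bool) (v w : List TapeSymbol)
    (htime : w.length < (ticksLeft c + v.length * 2 ^ c.length) * T →
      ∀ c' v' w', c'.length = c.length → v'.length ≤ v.length → w'.length ≤ w.length →
      φ none n (trialStk S c' v' w') ≤ a)
    (hyes : I.F.Nonempty → 
      ∀ c' v' w', c'.length = c.length → v'.length ≤ v.length → w'.length ≤ w.length →
      φ (some true) n (trialStk S c' v' w') ≤ a)
    (hno : 
      ∀ c' v' w', c'.length = c.length → v'.length ≤ v.length → w'.length ≤ w.length →
      φ (some false) n (trialStk S c' v' w') ≤ a + b) :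
    (trialLoop N M).wp (.inl .qry) I.answer φ (n + (C + 6 * c.length + 8) * (w.length + 1))
      (trialStk S c v w) ≤
      a + b * trialFail I l (S (.inl .idx)).length ^ (ticksLeft c + v.length * 2 ^ c.length) := by
  generalize hN : w.length = N'
  induction N' using Nat.strong_induction_on generalizing c v w with
  | _ N' ih =>
  subst hN
  set R := ticksLeft c + v.length * 2 ^ c.length with hR
  have hRpos : 0 < R := by
    have := ticksLeft_pos c
    omega
  obtain ⟨R', hR'⟩ : ∃ R', R = R' + 1 := ⟨R - 1, by omega⟩
  set i := (S (.inl .idx)).length with hi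
  set κ := trialFail I l i with hκ
  set n₁ := n + (6 * c.length + 8) * w.length + 6 * c.length + 7 with hn₁
  have hfuel : n + (C + 6 * c.length + 8) * (w.length + 1) = n₁ + C * (w.length + 1) + 1 := by
    rw [hn₁]
    ring
  rw [hfuel]
  refine (wp_loop _ _ _ _ _).trans ?_
  refine (wp_bind _ _ _ _ _).trans ?_
  have hap := trialStk_apply S c v w
  have hidx : (trialStk S c v w (.inl .idx)).length = i := by rw [hap _ (by simp) (by simp) (by simp)]
  have hclk : ∀ c' v' w', trialStk S c' v' w' (.inl .wclk) = w' := by simp [trialStk]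
  have hupd : ∀ w', update (trialStk S c v w) (.inl .wclk) w' = trialStk S c v w' := by
    intro w'
    simp [trialStk]
  have hanti : ∀ (r : Unit ⊕ Option Bool) (S : Stk (AllStk N M)),
      Antitone fun n => r.elim (fun _ => (trialLoop N M).wp (.inl .qry) I.answer φ n S)
        fun x => φ x n S := loop_antitone hφ
  -- The surcharge of a failed trial is the value of the remaining R - 1 trials.
  have := wp_trial hM hl (S := trialStk S c v w)
    (fun k => by rw [hap _ (embSnd_ne (by simp) _) (embSnd_ne (by simp) _) (embSnd_ne (by simp) _), hS])
    (by rw [hap _ (by simp) (by simp) (by simp), her])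
    (by rw [hap _ (by simp) (by simp) (by simp), hbr])
    (by rw [hap _ (by simp) (by simp) (by simp), htmp]) (T := T)
    (by rw [hidx]; exact hT)
    (φ := fun r n S' => Frag.wp (.inl .qry) I.answer (match r with
      | none => pure (.inr none)
      | some true => pure (.inr (some true))
      | some false => (tick (.inl .ctr) (.inl .tmp)).bind fun o =>
        if o then (pop (.inl .wrep)).bind fun y => y.elim (pure (.inr (some false)))
          fun _ => pure (.inl ())
        else pure (.inl ()) : Frag (AllStk N M) (AllReg N M) (Unit ⊕ Option Bool))
      (fun r n S => r.elim (fun _ => (trialLoop N M).wp (.inl .qry) I.answer φ n S)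
        fun x => φ x n S) n S') (fun x S => wp_antitone _ hanti S) (a := a) (b := b * κ ^ R')
    (C := C) (n := n₁)
    (by
      rw [hap _ (by simp) (by simp) (by simp), hap _ (by simp) (by simp) (by simp), hidx]
      exact hC) ?_ ?_ ?_
  · rw [hidx, hclk, mul_assoc, ← pow_succ, ← hR'] at this
    exact this
  · rw [hclk, hupd]
    intro hlt
    refine (wp_pure _ _ _ _).trans ((hφ _ _ (by omega)).trans
      (htime ?_ c v [] rfl le_rfl (by simp)))
    exact hlt.trans_le (Nat.le_mul_of_pos_left _ hRpos)
  · intro hF w' hw'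
    rw [hclk] at hw'
    rw [hupd]
    exact (wp_pure _ _ _ _).trans ((hφ _ _ (by omega)).trans (hyes hF c v w' rfl le_rfl hw'.le))
  · intro w' hw' hT'
    rw [hclk] at hw' hT'
    rw [hupd]
    have hfuel' : n + (C + 6 * c.length + 8) * (w'.length + 1) + 1 + (6 * c.length + 5) ≤
        n₁ + C * (w'.length + 1) := by
      have : (6 * c.length + 8) * (w'.length + 1) ≤ (6 * c.length + 8) * w.length :=
        Nat.mul_le_mul_left _ hw'
      have h2 : (C + 6 * c.length + 8) * (w'.length + 1) = C * (w'.length + 1) +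
        (6 * c.length + 8) * (w'.length + 1) := by ring
      omega
    refine (wp_antitone _ hanti _ hfuel').trans ?_
    have hctr : trialStk S c v w' (.inl .ctr) = encBits c := by simp [trialStk]
    have htick := Runs.tick (q := .inl .qry) (O := I.answer) (τ := N.σ × M.σ)
      (k := .inl .ctr) (tmp := .inl .tmp) (by simp) (trialStk S c v w')
      (by rw [trialStk_apply _ _ _ _ _ (by simp) (by simp) (by simp), htmp]) c hctr
    refine (htick.wp_bind_le hanti _).trans ?_
    rw [trialStk_update_ctr]
    have hlen := length_increment c
    rcases ho : (increment c).1 with _ | _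
    · have htl := ticksLeft_increment ho
      have hR'' : ticksLeft (increment c).2 + v.length * 2 ^ (increment c).2.length = R' := by
        rw [hlen]
        omega
      refine (wp_pure _ _ _ _).trans ?_
      have := ih w'.length hw' (increment c).2 v w' ?_ ?_ ?_ rfl
      · rw [hR'', hlen] at this
        exact (wp_antitone _ hφ _ (Nat.le_succ _)).trans this
      · rw [hR'', hlen]
        intro h c' v' w'' hc' hv' hw''
        refine htime ?_ c' v' w'' hc' hv' (by omega)
        rw [hR', Nat.add_mul]
        omega
      · rw [hlen]
        exact fun hF c' v' w'' hc' hv' hw'' => hyes hF c' v' w'' hc' hv' (by omega)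
      · rw [hlen]
        exact fun c' v' w'' hc' hv' hw'' => hno c' v' w'' hc' hv' (by omega)
    -- A period is over. Another one starts if a symbol can be taken from `wrep`; otherwise this was
    -- the last trial.
    · obtain ⟨htl, hc2⟩ := increment_overflow ho
      have hrep : trialStk S (increment c).2 v w' (.inl .wrep) = v := by simp [trialStk]
      rcases v with _ | ⟨y, v⟩
      · have hpop := Runs.pop_nil (q := .inl .qry) (O := I.answer) (τ := N.σ × M.σ) hrep
        refine (hpop.wp_bind_le hanti _).trans ((wp_pure _ _ _ _).trans ?_)
        have : R' = 0 := by
          simp only [List.length_nil, Nat.zero_mul] at hR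
          omega
        rw [this, pow_zero, mul_one]
        refine (hφ _ _ ?_).trans (hno (increment c).2 [] w' hlen le_rfl hw'.le)
        omega
      · have hpop := Runs.pop_cons (q := .inl .qry) (O := I.answer) (τ := N.σ × M.σ) hrep
        refine (hpop.wp_bind_le hanti _).trans ((wp_pure _ _ _ _).trans ?_)
        rw [trialStk_update_wrep]
        have hR'' : ticksLeft (increment c).2 + v.length * 2 ^ (increment c).2.length = R' := by
          rw [hlen, hc2, ticksLeft_replicate]
          have : (y :: v).length * 2 ^ c.length = 2 ^ c.length + v.length * 2 ^ c.length := by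
            rw [List.length_cons]
            ring
          omega
        have := ih w'.length hw' (increment c).2 v w' ?_ ?_ ?_ rfl
        · rw [hR'', hlen] at this
          exact this
        · rw [hR'', hlen]
          intro h c' v' w'' hc' hv' hw''
          refine htime ?_ c' v' w'' hc' (by simp; omega) (by omega)
          rw [hR', Nat.add_mul]
          omega
        · rw [hlen]
          exact fun hF c' v' w'' hc' hv' hw'' => hyes hF c' v' w'' hc' (by simp; omega) (by omega)
        · rw [hlen]
          exact fun c' v' w'' hc' hv' hw'' => hno c' v' w'' hc' (by simp; omega) (by omega)

variable (N M)

/-- The number of elements of the ground set, from its encoding. -/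
def commaBit (a : TapeSymbol) : List TapeSymbol := if a = .comma then [.bit false] else []

/-- The preparation of the clock and the counters. -/
def setup : Frag (AllStk N M) (AllReg N M) Unit :=
  (edit (.inl .rep) 0 [.hash]).bind fun _ => (double (.inl .clk) (.inl .tmp)).bind fun _ =>
    (scan (.inl .er) (.inl .ctr) (.inl .tmp) 0 commaBit).bind fun _ =>
    (edit (.inl .ctr) 0 [.bit false, .bit false]).bind fun _ =>
    (unpushMul (.inl .jdx) (.inl .len) (.inl .ctr) (.inl .tmp) (.inl .tmp')).bind fun _ =>
    (scan (.inl .rep) (.inl .wrep) (.inl .tmp) 0 fun a => [a]).bind fun _ =>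
    scan (.inl .clk) (.inl .wclk) (.inl .tmp) 0 fun a => [a]

/-- Going to the next size of the extensions. -/
def nextSize : Frag (AllStk N M) (AllReg N M) Unit :=
  (clear (.inl .ctr)).bind fun _ => (clear (.inl .wrep)).bind fun _ =>
    (clear (.inl .wclk)).bind fun _ => (pop (.inl .jdx)).bind fun y => y.elim
      ((move (.inl .idx) (.inl .jdx) fun a => [a]).bind fun _ => (clear (.inl .len)).bind fun _ =>
        edit (.inl .len) 0 [.hash])
      fun a => (edit (.inl .idx) 0 [a]).bind fun _ => double (.inl .len) (.inl .tmp)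

/-- The search over all sizes. -/
noncomputable def search : Frag (AllStk N M) (AllReg N M) Unit :=
  loop (fun _ : Unit => (setup N M).bind fun _ => (trialLoop N M).bind fun r =>
    r.elim ((nextSize N M).bind fun _ => pure (.inl ()))
      fun b => (edit (.inl .out) 0 [.bit b]).bind fun _ => pure (.inr ())) ()

variable {N M}

/-- The state of the search before round `u`. -/
structure SearchInv (S : Stk (AllStk N M)) (l : List (List Bool)) (B : List Bool) (a i u : ℕ) :
    Prop where
  ext : ∀ k, S (embSnd N M k) = []
  er : S (.inl .er) = (encList l).reverse
  br : S (.inl .br) = (encBits B).reverse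
  tmp : S (.inl .tmp) = []
  tmp' : S (.inl .tmp') = []
  out : S (.inl .out) = []
  ctr : S (.inl .ctr) = []
  wrep : S (.inl .wrep) = []
  wclk : S (.inl .wclk) = []
  le : i ≤ a
  idx : (S (.inl .idx)).length = i
  jdx : (S (.inl .jdx)).length = a - i
  len : (S (.inl .len)).length = 2 ^ i
  clk : (S (.inl .clk)).length = 2 ^ u
  rep : (S (.inl .rep)).length = u

theorem flatMap_commaBit (l : List (List Bool)) :
    (encList l).flatMap commaBit = List.replicate l.length (.bit false) := by
  have hb : ∀ e : List Bool, (encBits e).flatMap commaBit = [] := by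
    intro e
    induction e with
    | nil => rfl
    | cons b e ih => exact ih
  induction l with
  | nil => rfl
  | cons e l ih =>
    have : encList (e :: l) = encBits e ++ .comma :: encList l := by simp [encList]
    rw [this, List.flatMap_append, List.flatMap_cons, hb, ih]
    rfl

theorem length_le_length_encList (l : List (List Bool)) : l.length ≤ (encList l).length := by
  induction l with
  | nil => simp
  | cons e l ih =>
    have : encList (e :: l) = encBits e ++ .comma :: encList l := by simp [encList]
    rw [this]
    simp
    omega

/-- The counter gets one zero per comma of the ground set and two more, less (a - i)·2^i. Together
with u + 1 symbols on `wrep` this allows 2^L·(u + 2) trials, where L is the length of the counter.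
-/
theorem SearchInv.setup {S : Stk (AllStk N M)} {l : List (List Bool)} {B : List Bool} {a i u : ℕ}
    (h : SearchInv S l B a i u) {O : List TapeSymbol → Bool} :
    ∃ x y z : List TapeSymbol, x.length = u + 1 ∧ y.length = 2 ^ (u + 1) ∧
      z.length = 2 ^ (u + 1) ∧
      Runs (.inl .qry) O (Frag.setup N M) S
        (7 * (encList l).length + (7 * 2 ^ i + 10) * (a - i) + 32 * 2 ^ u + 7 * u + 40) ()
        (trialStk (update (update S (.inl .rep) x) (.inl .clk) y)
          (List.replicate (l.length + 2 - (a - i) * 2 ^ i) false) x.reverse z) := by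
  set S₁ := update S (.inl .rep) (TapeSymbol.hash :: S (.inl .rep)) with hS₁
  obtain ⟨y, hy, hdouble⟩ := Runs.double (q := .inl .qry) (O := O) (τ := N.σ × M.σ)
    (k := .inl .clk) (tmp := .inl .tmp) (by simp) S₁ (by simp [hS₁, h.tmp])
  have hclk : (S₁ (.inl .clk)).length = 2 ^ u := by simp [hS₁, h.clk]
  rw [hclk] at hy hdouble
  refine ⟨.hash :: S (.inl .rep), y, y.reverse, by simp [h.rep], by rw [hy, pow_succ'],
    by rw [List.length_reverse, hy, pow_succ'], ?_⟩
  refine Runs.bind (Runs.of_eq (Runs.edit _ _ _ _) rfl rfl le_rfl) (Runs.bind hdouble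
    (Runs.bind (Runs.copy (by simp) (by simp) (by simp) _ _ ?_)
    (Runs.bind (Runs.edit _ _ _ _) (Runs.bind (Runs.unpushMul (by simp) _ ?_ ?_)
    (Runs.bind (Runs.copy (by simp) (by simp) (by simp) _ _ ?_)
    (Runs.of_eq (Runs.copy (by simp) (by simp) (by simp) _ _ ?_) rfl ?_ le_rfl) le_rfl) le_rfl)
    le_rfl) le_rfl) le_rfl) ?_
  · simp [hS₁, h.tmp]
  · simp [hS₁, h.tmp]
  · simp [hS₁, h.tmp']
  · simp [hS₁, h.tmp]
  · simp [hS₁, h.tmp]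
  · have hctr : ([TapeSymbol.bit false, .bit false] ++ ((encList l).flatMap commaBit ++ [])).drop
        ((a - i) * 2 ^ i) = encBits (List.replicate (l.length + 2 - (a - i) * 2 ^ i) false) := by
      rw [flatMap_commaBit, List.append_nil, encBits, List.map_replicate, ← List.drop_replicate,
        List.replicate_succ, List.replicate_succ]
      rfl
    unfold trialStk
    rw [← hctr, hS₁]
    clear hdouble hctr hclk
    simp only [Function.update_idem, ne_eq, Sum.inl.injEq, reduceCtorEq, not_false_eq_true,
      Function.update_of_ne, Function.update_self, h.er, h.ctr, h.jdx, h.len, h.wrep, h.wclk,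
      List.reverse_reverse, List.flatMap_singleton', List.append_nil, List.drop_zero]
  · simp only [hS₁, Function.update_idem, ne_eq, Sum.inl.injEq, reduceCtorEq, not_false_eq_true,
      Function.update_of_ne, Function.update_self, h.er, h.jdx, h.len, h.rep, hy,
      List.length_reverse, List.length_cons]
    omega

theorem search_stk_eq (S : Stk (AllStk N M)) (x y v w : List TapeSymbol) (c : List Bool) :
    update (update (update (trialStk (update (update S (.inl .rep) x) (.inl .clk) y) c v w)
      (.inl .ctr) []) (.inl .wrep) []) (.inl .wclk) [] =
    update (update (update (update (update S (.inl .rep) x) (.inl .clk) y)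
    (.inl .ctr) []) (.inl .wrep) []) (.inl .wclk) [] := by
  unfold trialStk
  funext k
  simp only [Function.update_apply]
  split_ifs <;> simp_all

/-- The heights of `idx` and `jdx` always add up to `a`; moving one symbol across increases i, and
an empty `jdx` restarts the cycle at i = 0. -/
theorem SearchInv.nextSize {S : Stk (AllStk N M)} {l : List (List Bool)} {B : List Bool}
    {a i u : ℕ} (h : SearchInv S l B a i u) {O : List TapeSymbol → Bool}
    (x y v w : List TapeSymbol) (c : List Bool) (hx : x.length = u + 1)
    (hy : y.length = 2 ^ (u + 1)) :
    ∃ S', SearchInv S' l B a (if i = a then 0 else i + 1) (u + 1) ∧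
      Runs (.inl .qry) O (Frag.nextSize N M)
        (trialStk (update (update S (.inl .rep) x) (.inl .clk) y) c v w)
        (2 * c.length + 2 * v.length + 2 * w.length + 3 * i + 9 * 2 ^ i + 20) () S' := by
  set S₁ := update (update (update (update (update S (.inl .rep) x) (.inl .clk) y)
    (.inl .ctr) []) (.inl .wrep) []) (.inl .wclk) [] with hS₁
  have hext : ∀ k, S₁ (embSnd N M k) = [] := fun k => by
    have h₁ := embSnd_ne (N := N) (M := M) (o := .rep) (by simp) k
    have h₂ := embSnd_ne (N := N) (M := M) (o := .clk) (by simp) k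
    have h₃ := embSnd_ne (N := N) (M := M) (o := .ctr) (by simp) k
    have h₄ := embSnd_ne (N := N) (M := M) (o := .wrep) (by simp) k
    have h₅ := embSnd_ne (N := N) (M := M) (o := .wclk) (by simp) k
    simp [hS₁, h₁, h₂, h₃, h₄, h₅, h.ext]
  have hclear : ∀ {F : Frag (AllStk N M) (AllReg N M) Unit} {S' t},
      Runs (.inl .qry) O F S₁ t () S' → Runs (.inl .qry) O
        ((clear (.inl .ctr)).bind fun _ => (clear (.inl .wrep)).bind fun _ =>
          (clear (.inl .wclk)).bind fun _ => F)
        (trialStk (update (update S (.inl .rep) x) (.inl .clk) y) c v w)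
        (2 * c.length + 2 * v.length + 2 * w.length + 6 + t) () S' := by
    intro F S' t hF
    refine Runs.bind (Runs.clear _ _) (Runs.bind (Runs.clear _ _) (Runs.bind (Runs.clear _ _)
      (Runs.of_eq hF ?_ rfl le_rfl) le_rfl) le_rfl) ?_
    · exact search_stk_eq S x y v w c
    · simp only [trialStk, ne_eq, Sum.inl.injEq, reduceCtorEq, not_false_eq_true,
        Function.update_of_ne, Function.update_self, encBits, List.length_map]
      omega
  rcases hj : S (.inl .jdx) with _ | ⟨b, j⟩
  · have hia : i = a := by
      have := h.jdx
      have := h.le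
      rw [hj, List.length_nil] at *
      omega
    rw [if_pos hia]
    refine ⟨update (update (update S₁ (.inl .idx) []) (.inl .jdx) (S (.inl .idx)).reverse)
      (.inl .len) [.hash], ⟨fun k => ?_, ?_, ?_, ?_, ?_, ?_, ?_, ?_, ?_, Nat.zero_le _, ?_, ?_, ?_, ?_,
      ?_⟩, ?_⟩
    · have h₁ := embSnd_ne (N := N) (M := M) (o := .idx) (by simp) k
      have h₂ := embSnd_ne (N := N) (M := M) (o := .jdx) (by simp) k
      have h₃ := embSnd_ne (N := N) (M := M) (o := .len) (by simp) k
      simp [h₁, h₂, h₃, hext]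
    · simp [hS₁, h.er]
    · simp [hS₁, h.br]
    · simp [hS₁, h.tmp]
    · simp [hS₁, h.tmp']
    · simp [hS₁, h.out]
    · simp [hS₁]
    · simp [hS₁]
    · simp [hS₁]
    · simp
    · simp [h.idx, hia]
    · simp
    · simp [hS₁, hy]
    · simp [hS₁, hx]
    · refine (hclear (Runs.bind (t := 1) (x := none) (S' := S₁) (Runs.pop_nil ?_) (Runs.bind (Runs.moveBack (by simp) _)
        (Runs.bind (Runs.clear _ _) (Runs.of_eq (Runs.edit _ _ _ _) rfl ?_ le_rfl) le_rfl) le_rfl)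
        le_rfl)).mono ?_
      · simp [hS₁, hj]
      · simp only [Function.update_idem, ne_eq, Sum.inl.injEq, reduceCtorEq, not_false_eq_true,
          Function.update_of_ne, Function.update_self, hS₁, hj, List.append_nil, List.drop_zero]
      · simp only [ne_eq, Sum.inl.injEq, reduceCtorEq, not_false_eq_true,
          Function.update_of_ne, hS₁, h.idx, h.len]
        omega
  · have hia : a - i = j.length + 1 := by rw [← h.jdx, hj, List.length_cons]
    rw [if_neg (by omega)]
    set S₂ := update (update S₁ (.inl .jdx) j) (.inl .idx) (b :: S (.inl .idx)) with hS₂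
    obtain ⟨z, hz, hdouble⟩ := Runs.double (q := .inl .qry) (O := O) (τ := N.σ × M.σ)
      (k := .inl .len) (tmp := .inl .tmp) (by simp) S₂ (by simp [hS₂, hS₁, h.tmp])
    have hlen : (S₂ (.inl .len)).length = 2 ^ i := by simp [hS₂, hS₁, h.len]
    rw [hlen] at hz hdouble
    refine ⟨update S₂ (.inl .len) z, ⟨fun k => ?_, ?_, ?_, ?_, ?_, ?_, ?_, ?_, ?_, by omega, ?_, ?_,
      ?_, ?_, ?_⟩, ?_⟩
    · have h₁ := embSnd_ne (N := N) (M := M) (o := .idx) (by simp) k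
      have h₂ := embSnd_ne (N := N) (M := M) (o := .jdx) (by simp) k
      have h₃ := embSnd_ne (N := N) (M := M) (o := .len) (by simp) k
      simp [hS₂, h₁, h₂, h₃, hext]
    · simp [hS₂, hS₁, h.er]
    · simp [hS₂, hS₁, h.br]
    · simp [hS₂, hS₁, h.tmp]
    · simp [hS₂, hS₁, h.tmp']
    · simp [hS₂, hS₁, h.out]
    · simp [hS₂, hS₁]
    · simp [hS₂, hS₁]
    · simp [hS₂, hS₁]
    · simp [hS₂, h.idx]
    · simp [hS₂]
      omega
    · simp [hz, pow_succ']
    · simp [hS₂, hS₁, hy]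
    · simp [hS₂, hS₁, hx]
    · refine (hclear (Runs.bind (t := 1) (x := some b) (S' := update S₁ (.inl .jdx) j)
        (Runs.pop_cons ?_) (Runs.bind (Runs.edit _ _ _ _)
        (Runs.of_eq hdouble ?_ rfl le_rfl) le_rfl) le_rfl)).mono ?_
      · simp [hS₁, hj]
      · simp only [ne_eq, Sum.inl.injEq, reduceCtorEq, not_false_eq_true,
          Function.update_of_ne, hS₂, hS₁, List.singleton_append, List.drop_zero]
      · omega

end Frag

/-! ### The search over all sizes of the extensions -/

/-- This is (1 - 1/m)^m ≤ 1/e ≤ 1/2 for m = 2^L. The hypothesis is written as a sum to avoid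
truncated subtraction. -/
theorem ENNReal.pow_mul_two_pow_le {x : ℝ≥0∞} {L : ℕ} (hx : x + (2 ^ L)⁻¹ ≤ 1) (r : ℕ) :
    x ^ (2 ^ L * r) ≤ (2 ^ r)⁻¹ := by
  rw [pow_mul, ENNReal.inv_pow]
  refine pow_le_pow_left' ?_ r
  have hx1 : x ≤ 1 := le_self_add.trans hx
  have hxt : x ≠ ⊤ := ne_top_of_le_ne_top ENNReal.one_ne_top hx1
  have hxr : x.toReal ≤ 1 - 1 / ((2 ^ L : ℕ) : ℝ) := by
    have := ENNReal.toReal_mono ENNReal.one_ne_top hx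
    rw [ENNReal.toReal_add hxt (by simp)] at this
    simp only [ENNReal.toReal_inv, ENNReal.toReal_pow, ENNReal.toReal_ofNat, ENNReal.toReal_one]
      at this
    push_cast
    rw [one_div]
    linarith
  have hpow : x.toReal ^ 2 ^ L ≤ 1 / 2 := by
    refine (pow_le_pow_left₀ ENNReal.toReal_nonneg hxr _).trans ?_
    refine (Real.one_sub_div_pow_le_exp_neg (by exact_mod_cast Nat.one_le_two_pow)).trans ?_
    rw [Real.exp_neg, one_div]
    exact inv_anti₀ (by norm_num) (by linarith [Real.exp_one_gt_d9])
  rw [← ENNReal.toReal_le_toReal (ENNReal.pow_ne_top hxt) (by simp), ENNReal.toReal_pow]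
  simpa using hpow

namespace Frag

variable {N M : OracleTM}

/-- A round answers "no" wrongly with probability at most 2^(-(u+2)), and after a timeout the later
rounds contribute at most as much again: the sum is 2^(-(u+1)). If 𝓕 is empty then δ = 0, and no
success probability is needed. The time of the round is proportional to its clock, with all
overheads absorbed in `K`. -/
theorem wp_search_round {I : SetInstance} {τ : ℕ → ℕ} (hM : ExtendsWithin M I τ)
    {l : List (List Bool)} (hl : IsListing l I.E) {a i : ℕ}
    (hfail : I.F.Nonempty →
      trialFail I l i + (2 ^ (l.length + 2 - (a - i) * 2 ^ i))⁻¹ ≤ 1)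
    {δ : ℝ≥0∞} (hδ : ¬ I.F.Nonempty → δ = 0)
    {φ : Unit → ℕ → Stk (AllStk N M) → ℝ≥0∞} (hφ : ∀ x S, Antitone fun n => φ x n S)
    (hyes : I.F.Nonempty → ∀ n S, S (.inl .out) = encAnswer true → φ () n S = 0)
    (hno : ∀ n S, S (.inl .out) = encAnswer false → φ () n S ≤ δ)
    {C K : ℕ}
    (hC : 11 * ((encList l).length + I.B.length + a) + 2 * M.growth + 2 * Fintype.card M.K + 40 ≤ C)
    (hK : 7 * (encList l).length + (7 * 2 ^ a + 10) * a + 3 * a + 9 * 2 ^ a +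
      2 * (C + 6 * (l.length + 2) + 8) + 2 * (l.length + 2) + 200 ≤ K)
    {T n u : ℕ} (hT : ∀ m, τ (modeSize i m) ≤ T)
    {S : Stk (AllStk N M)} (h : SearchInv S l I.B a i u)
    (htime : 2 ^ (u + 1) < 2 ^ (l.length + 2 - (a - i) * 2 ^ i) * (u + 2) * T →
      ∀ S', SearchInv S' l I.B a (if i = a then 0 else i + 1) (u + 1) →
        (search N M).wp (.inl .qry) I.answer φ n S' ≤ δ * (2 ^ (u + 2))⁻¹) :
    (search N M).wp (.inl .qry) I.answer φ (n + K * 2 ^ (u + 1)) S ≤ δ * (2 ^ (u + 1))⁻¹ := by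
  set L := l.length + 2 - (a - i) * 2 ^ i with hL
  set P := 2 ^ (u + 1) with hP
  set t₁ := 7 * (encList l).length + (7 * 2 ^ i + 10) * (a - i) + 32 * 2 ^ u + 7 * u + 40 with ht₁
  set t₂ := 2 * L + 2 * (u + 1) + 2 * P + 3 * i + 9 * 2 ^ i + 20 with ht₂
  have hcost : n + t₂ + (C + 6 * L + 8) * (P + 1) + t₁ + 1 ≤ n + K * P := by
    have hia : 2 ^ i ≤ 2 ^ a := Nat.pow_le_pow_right (by norm_num) h.le
    have hPu : P = 2 * 2 ^ u := by rw [hP, pow_succ']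
    have hup : u < 2 ^ u := Nat.lt_two_pow_self
    have h₁ : (7 * 2 ^ i + 10) * (a - i) ≤ (7 * 2 ^ a + 10) * a := Nat.mul_le_mul (by omega) (by omega)
    have h₂ : (C + 6 * L + 8) * (P + 1) ≤ 2 * (C + 6 * (l.length + 2) + 8) * P := by
      rw [mul_assoc, mul_left_comm]
      exact Nat.mul_le_mul (by omega) (by omega)
    have h₃ := Nat.mul_le_mul_right P hK
    have h₄ := h.le
    have h₅ : (7 * (encList l).length + (7 * 2 ^ a + 10) * a + 3 * a + 9 * 2 ^ a +
        2 * (l.length + 2) + 100) * 1 ≤ (7 * (encList l).length + (7 * 2 ^ a + 10) * a + 3 * a +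
        9 * 2 ^ a + 2 * (l.length + 2) + 100) * P := Nat.mul_le_mul_left _ (by omega)
    have h₆ : (7 * (encList l).length + (7 * 2 ^ a + 10) * a + 3 * a + 9 * 2 ^ a +
      2 * (C + 6 * (l.length + 2) + 8) + 2 * (l.length + 2) + 200) * P =
      (7 * (encList l).length + (7 * 2 ^ a + 10) * a + 3 * a +
        9 * 2 ^ a + 2 * (l.length + 2) + 100) * P + 2 * (C + 6 * (l.length + 2) + 8) * P + 100 * P := by
      ring
    omega
  refine (wp_antitone _ hφ S hcost).trans ((wp_loop _ _ _ _ _).trans ?_)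
  have hanti : ∀ (r : Unit ⊕ Unit) (S : Stk (AllStk N M)),
      Antitone fun n => r.elim (fun _ => (search N M).wp (.inl .qry) I.answer φ n S)
        fun x => φ x n S := loop_antitone hφ
  obtain ⟨x, y, z, hx, hy, hz, hsetup⟩ := h.setup (O := I.answer)
  refine (hsetup.wp_bind_le hanti _).trans ((wp_bind _ _ _ _ _).trans ?_)
  set S₁ := update (update S (.inl .rep) x) (.inl .clk) y with hS₁
  have hS : ∀ o : Own, o ≠ .rep → o ≠ .clk → S₁ (.inl o) = S (.inl o) := by
    intro o h₁ h₂
    simp [hS₁, h₁, h₂]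
  have hidx : (S₁ (.inl .idx)).length = i := by rw [hS _ (by simp) (by simp), h.idx]
  have hout : ∀ c v w, trialStk S₁ c v w (.inl .out) = [] := by
    intro c v w
    rw [trialStk_apply _ _ _ _ _ (by simp) (by simp) (by simp), hS _ (by simp) (by simp), h.out]
  have hR : ticksLeft (List.replicate L false) + x.reverse.length * 2 ^ (List.replicate L false).length =
      2 ^ L * (u + 2) := by
    rw [ticksLeft_replicate, List.length_reverse, List.length_replicate, hx]
    ring
  have hanswer : ∀ (b : Bool) c v w m,
      (Frag.bind (edit (.inl .out) 0 [.bit b]) fun _ => (pure (.inr ()) :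
        Frag (AllStk N M) (AllReg N M) (Unit ⊕ Unit))).wp (.inl .qry) I.answer
        (fun r n S => r.elim (fun _ => (search N M).wp (.inl .qry) I.answer φ n S)
        fun x => φ x n S) (m + 1) (trialStk S₁ c v w) ≤
      φ () m (update (trialStk S₁ c v w) (.inl .out) (encAnswer b)) := by
    intro b c v w m
    refine ((Runs.edit _ _ _ _).wp_bind_le hanti m).trans ((wp_pure _ _ _ _).trans ?_)
    rw [hout]
    exact le_rfl
  have := wp_trialLoop hM hl (S := S₁) (fun k => by
      rw [hS₁, Function.update_of_ne (embSnd_ne (by simp) _),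
        Function.update_of_ne (embSnd_ne (by simp) _), h.ext])
    (by rw [hS _ (by simp) (by simp), h.er]) (by rw [hS _ (by simp) (by simp), h.br])
    (by rw [hS _ (by simp) (by simp), h.tmp]) (T := T) (by rw [hidx]; exact hT)
    (φ := fun r n S' => Frag.wp (.inl .qry) I.answer (r.elim
      ((nextSize N M).bind fun _ => pure (.inl ()))
      fun b => (edit (.inl .out) 0 [.bit b]).bind fun _ => pure (.inr ()) :
        Frag (AllStk N M) (AllReg N M) (Unit ⊕ Unit))
      (fun r n S => r.elim (fun _ => (search N M).wp (.inl .qry) I.answer φ n S)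
        fun x => φ x n S) n S') (fun x S => wp_antitone _ hanti S)
    -- The continuation after a timeout plays the role of `a`, and a "no" in this round costs `δ`.
    (a := δ * (2 ^ (u + 2))⁻¹) (b := δ) (C := C) (n := n + t₂) (by
      have h₁ := hS .er (by simp) (by simp)
      have h₂ := hS .br (by simp) (by simp)
      rw [hidx, h₁, h₂, h.er, h.br]
      have := h.le
      simp only [List.length_reverse, encBits, List.length_map]
      omega) (List.replicate L false) x.reverse z ?_ ?_ ?_
  · rw [List.length_replicate] at hR this
    rw [hz, hR, hidx] at this
    refine this.trans ?_
    have hfin : δ * trialFail I l i ^ (2 ^ L * (u + 2)) ≤ δ * (2 ^ (u + 2))⁻¹ := by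
      by_cases hF : I.F.Nonempty
      · exact mul_le_mul_right (ENNReal.pow_mul_two_pow_le (hfail hF) _) _
      · rw [hδ hF, zero_mul, zero_mul]
    refine (add_le_add_right hfin _).trans (le_of_eq ?_)
    rw [← mul_add, pow_succ 2 (u + 1), ENNReal.mul_inv (by simp) (by simp), ← mul_add,
      ENNReal.inv_two_add_inv_two, mul_one]
  · rw [hz, hR]
    intro hlt c' v' w' hc' hv' hw'
    obtain ⟨S', hS', hnext⟩ := h.nextSize (O := I.answer) x y v' w' c' hx hy
    rw [List.length_replicate] at hc'
    rw [List.length_reverse, hx] at hv'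
    refine (wp_antitone _ hanti _ (Nat.add_le_add_left (show _ ≤ t₂ by rw [ht₂]; omega) n)).trans
      ((hnext.wp_bind_le hanti _).trans ((wp_pure _ _ _ _).trans (htime hlt S' hS')))
  · intro hF c' v' w' hc' hv' hw'
    refine (wp_antitone _ hanti _ (show _ + 1 ≤ n + t₂ by rw [ht₂]; omega)).trans
      ((hanswer true c' v' w' n).trans ?_)
    rw [hyes hF _ _ (by simp)]
    exact zero_le
  · intro c' v' w' hc' hv' hw'
    refine (wp_antitone _ hanti _ (show _ + 1 ≤ n + t₂ by rw [ht₂]; omega)).trans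
      ((hanswer false c' v' w' n).trans ?_)
    exact (hno _ _ (by simp)).trans le_add_self

/-- Backward induction from round `u'`, whose clock is long enough for all its trials and which
therefore never times out. The fuel is the geometric sum of `K * 2 ^ (u + 1)` over the remaining
rounds. -/
theorem wp_search {I : SetInstance} {τ : ℕ → ℕ} (hM : ExtendsWithin M I τ)
    {l : List (List Bool)} (hl : IsListing l I.E) {a : ℕ}
    (hfail : I.F.Nonempty → ∀ i ≤ a,
      trialFail I l i + (2 ^ (l.length + 2 - (a - i) * 2 ^ i))⁻¹ ≤ 1)
    {δ : ℝ≥0∞} (hδ : ¬ I.F.Nonempty → δ = 0)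
    {φ : Unit → ℕ → Stk (AllStk N M) → ℝ≥0∞} (hφ : ∀ x S, Antitone fun n => φ x n S)
    (hyes : I.F.Nonempty → ∀ n S, S (.inl .out) = encAnswer true → φ () n S = 0)
    (hno : ∀ n S, S (.inl .out) = encAnswer false → φ () n S ≤ δ)
    {C K : ℕ}
    (hC : 11 * ((encList l).length + I.B.length + a) + 2 * M.growth + 2 * Fintype.card M.K + 40 ≤ C)
    (hK : 7 * (encList l).length + (7 * 2 ^ a + 10) * a + 3 * a + 9 * 2 ^ a +
      2 * (C + 6 * (l.length + 2) + 8) + 2 * (l.length + 2) + 200 ≤ K)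
    {T u' : ℕ} (hT : ∀ m, τ (modeSize (u' % (a + 1)) m) ≤ T)
    (hu' : (u' + 2) * 2 ^ (l.length + 2 - (a - u' % (a + 1)) * 2 ^ (u' % (a + 1))) * T ≤
      2 ^ (u' + 1))
    (n u : ℕ) (hu : u ≤ u') {S : Stk (AllStk N M)} (h : SearchInv S l I.B a (u % (a + 1)) u) :
    (search N M).wp (.inl .qry) I.answer φ (n + K * (2 ^ (u' + 2) - 2 ^ (u + 1))) S ≤
      δ * (2 ^ (u + 1))⁻¹ := by
  obtain ⟨d, hd⟩ : ∃ d, u' = u + d := ⟨u' - u, by omega⟩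
  induction d generalizing n u S with
  | zero =>
    have : u' = u := hd
    subst this
    have hpow : 2 ^ (u' + 2) - 2 ^ (u' + 1) = 2 ^ (u' + 1) := by
      rw [pow_succ 2 (u' + 1)]
      omega
    rw [hpow]
    refine wp_search_round hM hl (fun hF => hfail hF _ h.le) hδ hφ hyes hno hC hK hT h
      fun hlt => absurd hu' ?_
    rw [mul_comm (u' + 2)]
    exact not_le.2 hlt
  | succ d ih =>
    have hpow : K * (2 ^ (u' + 2) - 2 ^ (u + 1)) =
        K * (2 ^ (u' + 2) - 2 ^ (u + 1 + 1)) + K * 2 ^ (u + 1) := by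
      rw [← Nat.mul_add]
      congr 1
      have h₁ : 2 ^ (u + 1 + 1) ≤ 2 ^ (u' + 2) := Nat.pow_le_pow_right (by norm_num) (by omega)
      rw [pow_succ 2 (u + 1)] at h₁ ⊢
      omega
    rw [hpow, ← add_assoc]
    refine wp_search_round hM hl (fun hF => hfail hF _ h.le) hδ hφ hyes hno hC hK
      -- In an earlier round any valid `T` will do, since a timeout is allowed.
      (T := max (τ (modeSize (u % (a + 1)) true)) (τ (modeSize (u % (a + 1)) false)))
      (fun m => by cases m <;> simp) h fun _ S' hS' => ih n (u + 1) (by omega) ?_ (by omega)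
    have hmod : (u + 1) % (a + 1) = if u % (a + 1) = a then 0 else u % (a + 1) + 1 := by
      rw [← Nat.mod_add_mod]
      have : u % (a + 1) < a + 1 := Nat.mod_lt u (Nat.succ_pos a)
      split_ifs with hua
      · rw [hua, Nat.mod_self]
      · exact Nat.mod_eq_of_lt (by omega)
    rw [hmod]
    exact hS'

end Frag

/-! ### The whole algorithm -/

namespace Frag

variable (N M : OracleTM)

/-- Storing the ground set, which is the output of the first machine, and preparing the search. -/
def readGround : Frag (AllStk N M) (AllReg N M) Unit :=
  (move (embFst N M N.out) (.inl .er) fun a => [a]).bind fun _ => (clear (.inl .qry)).bind fun _ =>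
    (scan (.inl .er) (.inl .cnt) (.inl .tmp) 0 commaBit).bind fun _ =>
    (bitLength (.inl .cnt) (.inl .jdx) (.inl .tmp)).bind fun _ => (edit (.inl .jdx) 3 []).bind fun _ =>
    (edit (.inl .len) 0 [.hash]).bind fun _ => edit (.inl .clk) 0 [.hash]

/-- The whole algorithm. -/
noncomputable def algorithm : Frag (AllStk N M) (AllReg N M) Unit :=
  (move (.inl .inp) (.inl .br) fun a => [a]).bind fun _ =>
    (scan (.inl .br) (embFst N M N.inp) (.inl .tmp) 0 fun a => [a]).bind fun _ =>
    (call N (embFst N M) Prod.fst (fun x v => (x, v.2)) none).bind fun _ =>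
    (readGround N M).bind fun _ => search N M

variable {N M}

theorem Runs.readGround {S : Stk (AllStk N M)} {l : List (List Bool)} {B : List Bool}
    (hext : ∀ k, S (.inr (.inr k)) = []) (hbr : S (.inl .br) = (encBits B).reverse)
    (hown : ∀ o : Own, o ≠ .qry → o ≠ .br → S (.inl o) = [])
    (hout : S (embFst N M N.out) = encList l) {s : ℕ} (hl : (encList l).length ≤ s)
    (hqry : (S (.inl .qry)).length ≤ s) {O : List TapeSymbol → Bool} :
    ∃ S', SearchInv S' l B (Nat.log 2 l.length - 2) 0 0 ∧
      Runs (.inl .qry) O (readGround N M) S (12 * s + (8 * s + 12) * (s + 1) + 11) () S' := by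
  have hx : ∀ o : Own, o ≠ .qry → (.inl o : AllStk N M) ≠ embFst N M N.out :=
    fun o ho => (embFst_ne ho _).symm
  unfold Frag.readGround
  generalize embFst N M N.out = x at hx hout ⊢
  set S₁ := update (update (update S x []) (.inl .er) (encList l).reverse) (.inl .qry) [] with hS₁
  have hown₁ : ∀ o : Own, o ≠ .br → o ≠ .er → S₁ (.inl o) = [] := by
    intro o h₁ h₂
    by_cases h₃ : o = .qry
    · simp [hS₁, h₃]
    · simp [hS₁, h₂, h₃, hx o h₃, hown o h₃ h₁]
  have her₁ : S₁ (.inl .er) = (encList l).reverse := by simp [hS₁]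
  have hbr₁ : S₁ (.inl .br) = (encBits B).reverse := by simp [hS₁, hx, hbr]
  have hext₁ : ∀ k, S₁ (.inr (.inr k)) = [] := by
    intro k
    by_cases h : .inr (.inr k) = x
    · rw [hS₁, ← h]
      simp
    · simp [hS₁, h, hext]
  have hfirst : ∀ {F : Frag (AllStk N M) (AllReg N M) Unit} {S' t}, Runs (.inl .qry) O F S₁ t () S' →
      Runs (.inl .qry) O ((Frag.move x (.inl .er) fun a => [a]).bind fun _ =>
        (Frag.clear (.inl .qry)).bind fun _ => F) S (3 * s + 2 + (2 * s + 2) + t) () S' := by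
    intro F S' t hF
    refine Runs.bind (Runs.moveBack (hx .er (by simp)).symm S) (Runs.bind (Runs.clear _ _)
      (Runs.of_eq hF ?_ rfl le_rfl) le_rfl) ?_
    · rw [hS₁, hout, hown .er (by simp) (by simp), List.append_nil]
    · have hq : ((update (update S x []) (.inl .er) ((S x).reverse ++ S (.inl .er)))
          (.inl .qry)).length ≤ s := by
        rw [Function.update_of_ne (by simp), Function.update_apply]
        split_ifs
        · simp
        · exact hqry
      rw [hout] at hq ⊢
      omega
  clear_value S₁
  clear hbr hown hext hS₁ hx hout
  set S₂ := update S₁ (.inl .cnt) (List.replicate l.length (.bit false)) with hS₂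
  obtain ⟨w, hw, hlog⟩ := Runs.bitLength (q := .inl .qry) (O := O) (τ := N.σ × M.σ)
    (k := .inl .cnt) (dst := .inl .jdx) (tmp := .inl .tmp) (by simp) (by simp) (by simp) S₂
    (by simp [hS₂, hown₁])
  have hcnt : (S₂ (.inl .cnt)).length = l.length := by simp [hS₂]
  have hjdx : (S₂ (.inl .jdx)).length = 0 := by simp [hS₂, hown₁]
  rw [hcnt] at hw hlog
  rw [hjdx] at hw
  refine ⟨update (update (update (update S₁ (.inl .cnt) []) (.inl .jdx) (w.drop 3))
    (.inl .len) [.hash]) (.inl .clk) [.hash], ⟨fun k => ?_, ?_, ?_, ?_, ?_, ?_, ?_, ?_, ?_,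
    Nat.zero_le _, ?_, ?_, ?_, ?_, ?_⟩, (hfirst (Runs.bind (Runs.copy (by simp) (by simp) (by simp) _
    _ ?_) (Runs.bind (Runs.of_eq hlog ?_ rfl le_rfl) (Runs.bind (Runs.edit _ _ _ _) (Runs.bind
    (Runs.edit _ _ _ _) (Runs.of_eq (Runs.edit _ _ _ _) rfl ?_ le_rfl) le_rfl) le_rfl) le_rfl)
    le_rfl)).mono ?_⟩
  · unfold embSnd
    split_ifs
    · simp [hown₁]
    · simp [hext₁]
  · simp [her₁]
  · simp [hbr₁]
  · simp [hown₁]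
  · simp [hown₁]
  · simp [hown₁]
  · simp [hown₁]
  · simp [hown₁]
  · simp [hown₁]
  · simp [hown₁]
  -- The bit length is one more than the logarithm, so removing three symbols leaves the logarithm
  -- minus 2; truncation also gives 0 for an empty ground set.
  · have : (w.drop 3).length = Nat.log 2 l.length - 2 - 0 := by
      rw [List.length_drop, hw]
      split_ifs with h
      · simp [h]
      · omega
    simpa using this
  · simp
  · simp
  · simp [hown₁]
  · exact hown₁ _ (by simp) (by simp)
  · rw [hS₂, her₁, List.reverse_reverse, flatMap_commaBit, hown₁ _ (by simp) (by simp),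
      List.append_nil]
  · simp only [hS₂, Function.update_idem, ne_eq, Sum.inl.injEq, reduceCtorEq, not_false_eq_true,
      Function.update_of_ne, Function.update_self, hown₁, List.append_nil, List.nil_append,
      List.drop_nil]
  · rw [her₁, List.length_reverse]
    have h₁ := length_le_length_encList l
    have h₂ : (8 * l.length + 12) * (l.length + 1) ≤ (8 * s + 12) * (s + 1) :=
      Nat.mul_le_mul (by omega) (by omega)
    omega

/-- The list of E is bounded by `s` because the stacks of the first machine grow linearly in its
running time. It may depend on the coins, so the search is required to meet the bound for every
listing. -/
theorem wp_algorithm {I : SetInstance} {t : ℕ} (hN : N.HaltsWithin I.answer (encBits I.B) t)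
    (hNout : ∀ r : Fin t → Bool,
      ∃ l, IsListing l I.E ∧ N.output I.answer (encBits I.B) r = encList l)
    {φ : Unit → ℕ → Stk (AllStk N M) → ℝ≥0∞} (hφ : ∀ x S, Antitone fun n => φ x n S)
    {b : ℝ≥0∞} {n s : ℕ} (hs : I.B.length + N.growth * t ≤ s)
    (hsearch : ∀ l, IsListing l I.E → (encList l).length ≤ s →
      ∀ S, SearchInv S l I.B (Nat.log 2 l.length - 2) 0 0 →
        (search N M).wp (.inl .qry) I.answer φ n S ≤ b) :
    (algorithm N M).wp (.inl .qry) I.answer φ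
      (n + 2 * t + 10 * I.B.length + 12 * s + (8 * s + 12) * (s + 1) + 18)
      (update (fun _ => []) (.inl .inp) (encBits I.B)) ≤ b := by
  set S₁ : Stk (AllStk N M) := update (fun _ => []) (.inl .br) (encBits I.B).reverse with hS₁
  have hx : ∀ o : Own, o ≠ .qry → (.inl o : AllStk N M) ≠ embFst N M N.inp :=
    fun o ho => (embFst_ne ho _).symm
  have hmove := Runs.moveBack (q := .inl .qry) (O := I.answer) (τ := N.σ × M.σ)
    (src := .inl .inp) (dst := .inl .br) (by simp)
    (update (fun _ => []) (.inl .inp) (encBits I.B) : Stk (AllStk N M))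
  have hscan := Runs.copy (q := .inl .qry) (O := I.answer) (τ := N.σ × M.σ)
    (src := .inl .br) (dst := embFst N M N.inp) (tmp := .inl .tmp) (hx _ (by simp)) (by simp)
    (hx _ (by simp)).symm (fun a => [a]) S₁ (by simp [hS₁])
  have hlen : (encBits I.B).length = I.B.length := by simp [encBits]
  have hbr : S₁ (.inl .br) = (encBits I.B).reverse := by simp [hS₁]
  have hinp : S₁ (embFst N M N.inp) = [] := by rw [hS₁, Function.update_of_ne (hx _ (by simp)).symm]
  have hcfg := update_inp_eq_extend (embFst_injective N M) (S := S₁) (fun k => by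
    rw [hS₁, Function.update_of_ne (embFst_ne (by simp) k)]) (encBits I.B)
  have hcall := wp_call_none (e := embFst N M) (get := (Prod.fst : N.σ × M.σ → N.σ))
    (set := fun x v => (x, v.2)) I.answer (embFst_injective N M) (fun _ _ => rfl)
    (fun _ n S => ((readGround N M).bind fun _ => search N M).wp (.inl .qry) I.answer φ n S)
    (n + (12 * s + (8 * s + 12) * (s + 1) + 11)) t S₁ (encBits I.B)
  rw [embFst_qry] at hcall
  rw [show n + 2 * t + 10 * I.B.length + 12 * s + (8 * s + 12) * (s + 1) + 18 =
    n + (12 * s + (8 * s + 12) * (s + 1) + 11) + 2 * t + 1 + (7 * I.B.length + 4) +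
      (3 * I.B.length + 2) by ring]
  rw [Function.update_self, hlen] at hmove
  rw [hbr, List.length_reverse, hlen] at hscan
  refine (hmove.wp_bind_le hφ _).trans ?_
  have hmid : update (update (update (fun _ => []) (.inl .inp) (encBits I.B)) (.inl .inp) [])
      (.inl .br) ((encBits I.B).reverse ++ (update (fun _ => []) (.inl .inp) (encBits I.B) :
        Stk (AllStk N M)) (.inl .br)) = S₁ := by
    rw [hS₁, Function.update_idem, Function.update_of_ne (by simp), List.append_nil]
    congr 1
    exact Function.update_eq_self _ _
  rw [hmid]
  refine (hscan.wp_bind_le hφ _).trans ?_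
  rw [hinp, List.append_nil, List.reverse_reverse, List.flatMap_singleton', hcfg]
  refine (wp_bind _ _ _ _ _).trans (hcall.trans ?_)
  -- The output is correct for all coins, so the second alternative is impossible and `p = 0`, `b =
  -- 0` suffice.
  have := N.haltWp_le_of_prob I.answer hN (A := fun w => ∃ l, IsListing l I.E ∧ w = encList l)
    (B := fun _ => False) (fun r => Or.inr (hNout r)) (p := 0)
    (div_nonneg (Nat.cast_nonneg _) (by positivity))
    (fun k st => ((readGround N M).bind fun _ => search N M).wp (.inl .qry) I.answer φ
      (n + (12 * s + (8 * s + 12) * (s + 1) + 11) + 2 * k) (Function.extend (embFst N M) st S₁))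
    b 0 ?_ (fun _ _ _ _ h => h.elim)
  · simpa using this
  · intro k hk st hst ⟨l, hl, hout⟩
    rw [hlen] at hst
    have hsize : ∀ i, (st i).length ≤ s := fun i => by
      have : (st i).length ≤ OracleTM.stkSize st :=
        Finset.single_le_sum (f := fun i => (st i).length) (fun _ _ => Nat.zero_le _)
          (Finset.mem_univ i)
      omega
    have hne : ∀ k : AllStk N M, (∀ i, embFst N M i ≠ k) →
        Function.extend (embFst N M) st S₁ k = S₁ k := fun k hk =>
      Function.extend_apply' _ _ _ fun ⟨i, hi⟩ => hk i hi
    have hle : (encList l).length ≤ s := hout ▸ hsize N.out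
    obtain ⟨S', hS', hrun⟩ := Runs.readGround (O := I.answer) (B := I.B)
      (S := Function.extend (embFst N M) st S₁) (l := l) (s := s) (fun k => by
        rw [hne _ fun i => ?_, hS₁, Function.update_of_ne (by simp)]
        unfold embFst
        split_ifs <;> simp)
      (by rw [hne _ (embFst_ne (by simp)), hbr])
      (fun o h₁ h₂ => by rw [hne _ (embFst_ne h₁), hS₁, Function.update_of_ne (by simp [h₂])])
      (by rw [(embFst_injective N M).extend_apply, hout]) hle
      (by rw [← embFst_qry N M, (embFst_injective N M).extend_apply]; exact hsize _)
    refine (wp_antitone _ hφ _ (Nat.le_add_right _ _)).trans ((hrun.wp_bind_le hφ n).trans ?_)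
    exact hsearch l hl hle S' hS'

/-- The function evaluated is ⊤ at every forbidden outcome, `δ` at "no" and 0 at a justified "yes".
A finite average excludes forbidden outcomes for all coins, including a "yes" when `p` fails. For δ
= 1 the bound δ/2 says that "no" has probability at most 1/2. -/
theorem toTM_spec {K σ : Type} [DecidableEq K] [Fintype K] [Fintype σ] (F : Frag K σ Unit)
    (inp out qry : K) (v₀ : σ) (O : List TapeSymbol → Bool) (x : List TapeSymbol) {n : ℕ} {p : Prop}
    [Decidable p] {δ : ℝ≥0∞} (hδ : δ ≠ ⊤)
    (h : F.wp qry O (fun _ _ S => if S out = encAnswer false then δ else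
      if S out = encAnswer true ∧ p then 0 else ⊤) n (update (fun _ => []) inp x) ≤ δ * 2⁻¹) :
    (F.toTM inp out qry v₀).HaltsWithin O x (n + 1) ∧
    (∀ r : Fin (n + 1) → Bool, (F.toTM inp out qry v₀).output O x r = encAnswer false ∨
      (F.toTM inp out qry v₀).output O x r = encAnswer true ∧ p) ∧
    (δ = 1 → 1 / 2 ≤ (F.toTM inp out qry v₀).prob O x (n + 1) fun w => w = encAnswer true) ∧
    (¬ p → (F.toTM inp out qry v₀).prob O x (n + 1) (fun w => w = encAnswer false) = 1) := by
  classical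
  set M := F.toTM inp out qry v₀ with hM
  set ψ : M.Cfg → ℝ≥0∞ := fun c => if c.l = none then (if c.stk M.out = encAnswer false then δ else
      if c.stk M.out = encAnswer true ∧ p then 0 else ⊤) else ⊤ with hψ
  have hle : (∑ r : Fin (n + 1) → Bool, ψ (M.run O x r)) / 2 ^ (n + 1) ≤ δ * 2⁻¹ := by
    refine le_trans ?_ h
    refine le_trans ?_ (le_iSup _ v₀)
    refine (M.avg_eq O ψ (n + 1) (M.initCfg x)).symm.trans_le ?_
    exact avg_toTM O F inp out qry v₀ ψ _ (fun _ _ v S => le_rfl) n F.entry v₀ _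
  rw [ENNReal.div_le_iff (by simp) (by simp)] at hle
  have htop : ∀ r : Fin (n + 1) → Bool, ψ (M.run O x r) ≠ ⊤ := fun r =>
    ne_top_of_le_ne_top (ENNReal.mul_ne_top (ENNReal.mul_ne_top hδ (by simp)) (by simp))
      ((Finset.single_le_sum (f := fun r : Fin (n + 1) → Bool => ψ (M.run O x r))
        (fun _ _ => zero_le) (Finset.mem_univ r)).trans hle)
  have hout : ∀ r : Fin (n + 1) → Bool, M.output O x r = encAnswer false ∨
      M.output O x r = encAnswer true ∧ p := by
    intro r
    have := htop r
    by_contra hr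
    rw [not_or, OracleTM.output] at hr
    simp only [hψ] at this
    rw [if_neg hr.1, if_neg hr.2] at this
    simp at this
  refine ⟨fun r => ?_, hout, fun hδ1 => ?_, fun hp => ?_⟩
  · by_contra hr
    exact htop r (if_neg hr)
  · have hsum : ((Finset.univ.filter fun r : Fin (n + 1) → Bool =>
        M.output O x r = encAnswer false).card : ℝ≥0∞) ≤ 2⁻¹ * 2 ^ (n + 1) := by
      rw [hδ1, one_mul] at hle
      refine le_trans ?_ hle
      rw [Finset.card_eq_sum_ones, Nat.cast_sum, Finset.sum_filter]
      refine Finset.sum_le_sum fun r _ => ?_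
      split_ifs with hr
      · simp only [hψ]
        split_ifs with h₁ h₂ h₃
        · simp [hδ1]
        · exact absurd hr h₂
        · simp
        · simp
      · exact zero_le
    have hreal : ((Finset.univ.filter fun r : Fin (n + 1) → Bool =>
        M.output O x r = encAnswer false).card : ℝ) ≤ 2⁻¹ * 2 ^ (n + 1) := by
      have := ENNReal.toReal_mono (ENNReal.mul_ne_top (by simp) (by simp)) hsum
      simpa using this
    have hcard := Finset.card_filter_add_card_filter_not (s := Finset.univ)
      (fun r : Fin (n + 1) → Bool => M.output O x r = encAnswer false)
    rw [Finset.card_univ, Fintype.card_fun, Fintype.card_bool, Fintype.card_fin] at hcard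
    have hsub : (Finset.univ.filter fun r : Fin (n + 1) → Bool =>
        ¬ M.output O x r = encAnswer false) ⊆ Finset.univ.filter fun r : Fin (n + 1) → Bool =>
        M.output O x r = encAnswer true := by
      intro r
      simp only [Finset.mem_filter, Finset.mem_univ, true_and]
      exact fun hr => ((hout r).resolve_left hr).1
    have hcard' := Finset.card_le_card hsub
    rw [OracleTM.prob, Nat.card_eq_fintype_card, Fintype.card_subtype, le_div_iff₀ (by positivity)]
    have h₁ : (2 : ℝ) ^ (n + 1) ≤ (Finset.univ.filter fun r : Fin (n + 1) → Bool =>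
        M.output O x r = encAnswer false).card + (Finset.univ.filter fun r : Fin (n + 1) → Bool =>
        M.output O x r = encAnswer true).card := by
      exact_mod_cast hcard.ge.trans (Nat.add_le_add_left hcard' _)
    linarith
  · rw [OracleTM.prob, Nat.card_eq_fintype_card, Fintype.card_subtype,
      Finset.filter_true_of_mem fun r _ => (hout r).resolve_right fun h => hp h.2]
    simp

end Frag

/-! ### The success probability of a trial -/

/-- Induction on `l` through (l + 1)·C(m + 1, l + 1) = (m + 1)·C(m, l): each step contributes a
factor (m + 1)/(l + 1) ≥ q. -/
theorem Nat.pow_le_choose_of_mul_le {q l m : ℕ} (h : q * l ≤ m) : q ^ l ≤ m.choose l := by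
  induction l generalizing m with
  | zero => simp
  | succ l ih =>
    rcases Nat.eq_zero_or_pos q with rfl | hq
    · simp
    obtain ⟨m, rfl⟩ : ∃ m', m = m' + 1 := ⟨m - 1, by
      have : 0 < q * (l + 1) := by positivity
      omega⟩
    have hm : q * l ≤ m := by
      rw [Nat.mul_succ] at h
      omega
    have h₁ := ih hm
    have h₂ := Nat.add_one_mul_choose_eq m l
    refine Nat.le_of_mul_le_mul_right ?_ (Nat.succ_pos l)
    calc q ^ (l + 1) * (l + 1) = q * (l + 1) * q ^ l := by ring
      _ ≤ (m + 1) * m.choose l := Nat.mul_le_mul h h₁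
      _ = _ := h₂

namespace Frag

/-- Here ψ is at most the indicator of the sets that can be extended, and on such a set the
extension machine fails with probability at most 1/2. -/
theorem failProb_add_le (I : SetInstance) (l : List (List Bool)) (i : ℕ) (m : Bool)
    {ψ : List (List Bool) → ℝ≥0∞} (hψ : ∀ X, ψ X ≤ 1)
    (h : ∀ X, ψ X ≠ 0 → ∃ S, I.IsExtension X.toFinset (modeSize i m) S) :
    failProb I l i m + sampleAvg m ψ l.reverse [] / 2 ≤ 1 := by
  classical
  rw [failProb, ← ENNReal.half_mul (sampleAvg _ _ _ _), ← sampleAvg_mul m (1 / 2) ψ, ← sampleAvg_add]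
  refine le_trans (sampleAvg_mono m (χ := fun _ => 1) _ _ fun X _ => ?_)
    (sampleAvg_const m 1 _ _).le
  split_ifs with hX
  · refine (add_le_add_right (mul_le_mul_right (hψ _) _) _).trans (le_of_eq ?_)
    rw [mul_one, ENNReal.add_halves]
  · have : ψ (X ++ []) = 0 := by
      by_contra h0
      exact hX (h _ h0)
    rw [this, mul_zero, add_zero]

theorem prod_keepProb_le_sampleAvg (m : Bool) {l : List (List Bool)} {E Y : Finset (List Bool)}
    (hl : IsListing l E) (hY : Y ⊆ E) :
    ∏ e ∈ E, keepProb m (decide (e ∈ Y)) ≤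
      sampleAvg m (fun X => if X.toFinset = Y then 1 else 0) l.reverse [] := by
  have h := prod_keepProb_le m (fun e => decide (e ∈ Y)) l.reverse []
  rw [List.map_reverse, List.prod_reverse, ← List.prod_toFinset _ hl.1, hl.2] at h
  refine h.trans (sampleAvg_mono m _ _ fun X _ => ?_)
  split_ifs with h₁ h₂
  · exact le_rfl
  · refine absurd ?_ h₂
    rw [h₁]
    ext e
    have : e ∈ Y → e ∈ l := fun he => by
      rw [← List.mem_toFinset, hl.2]
      exact hY he
    simpa using this
  · exact zero_le
  · exact le_rfl

/-- Each k-subset of S is drawn with probability at least 2^(-|E|), and linearity adds these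
contributions. -/
theorem choose_mul_le_sampleAvg {l : List (List Bool)} {E S : Finset (List Bool)}
    (hl : IsListing l E) (hS : S ⊆ E) (k : ℕ) :
    (S.card.choose k : ℝ≥0∞) * (2 ^ E.card)⁻¹ ≤
      sampleAvg true (fun X => ∑ Y ∈ S.powersetCard k, if X.toFinset = Y then 1 else 0)
        l.reverse [] := by
  rw [sampleAvg_sum, ← Finset.card_powersetCard, ← nsmul_eq_mul]
  refine Finset.card_nsmul_le_sum _ _ _ fun Y hY => ?_
  refine le_trans (le_of_eq ?_)
    (prod_keepProb_le_sampleAvg true hl ((Finset.mem_powersetCard.1 hY).1.trans hS))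
  simp [keepProb, ENNReal.inv_pow]

theorem keepProb_false_prod {E S : Finset (List Bool)} (hS : S ⊆ E) :
    ∏ e ∈ E, keepProb false (decide (e ∈ S)) = 3 ^ (E.card - S.card) * (4 ^ E.card)⁻¹ := by
  classical
  rw [← Finset.prod_sdiff hS, Finset.prod_congr rfl (g := fun _ => (3 / 4 : ℝ≥0∞)) fun e he => ?_,
    Finset.prod_congr (s₁ := S) rfl (g := fun _ => (1 / 4 : ℝ≥0∞)) fun e he => ?_]
  · rw [Finset.prod_const, Finset.prod_const, Finset.card_sdiff_of_subset hS, div_eq_mul_inv,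
      mul_pow, one_div, mul_assoc, ← pow_add, Nat.sub_add_cancel (Finset.card_le_card hS),
      ENNReal.inv_pow]
  · simp [keepProb, he]
  · simp [keepProb, (Finset.mem_sdiff.1 he).2]

/-- With j = a - i one has j ≤ 2^(j-1) for j ≥ 1, and 4·2^a ≤ n. The factor 8 is what the sparse
mode needs to compare 3^(n-|S|) with 2^(n+w). -/
theorem two_pow_mul_le {a i n : ℕ} (ha : a = Nat.log 2 n - 2) (hi : i ≤ a) :
    8 * ((a - i) * 2 ^ i) ≤ n := by
  rcases Nat.eq_zero_or_pos a with h | h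
  · simp [h]
  have hn : n ≠ 0 := by
    rintro rfl
    simp at ha
    omega
  have h₁ : 2 ^ Nat.log 2 n ≤ n := Nat.pow_log_le_self 2 hn
  obtain ⟨j, rfl⟩ : ∃ j, a = i + j := ⟨a - i, by omega⟩
  rw [show Nat.log 2 n = i + j + 2 by omega] at h₁
  rcases j with _ | j
  · simp
  have h₂ : j + 1 ≤ 2 ^ j := Nat.lt_two_pow_self
  refine le_trans ?_ h₁
  calc 8 * ((i + (j + 1) - i) * 2 ^ i) = 8 * ((j + 1) * 2 ^ i) := by rw [Nat.add_sub_cancel_left]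
    _ ≤ 8 * (2 ^ j * 2 ^ i) := by gcongr
    _ = _ := by ring

/-- It is enough that one of the two modes succeeds with probability 2^(-(n-w))/2; choosing it costs
another factor 1/2. A member S of 𝓕 with at least 2^a elements is found by the uniform mode, a
smaller one by the sparse mode. -/
theorem trialFail_add_le {I : SetInstance} {l : List (List Bool)} (hl : IsListing l I.E)
    (hF : I.F.Nonempty) {a i : ℕ} (ha : a = Nat.log 2 l.length - 2) (hi : i ≤ a) :
    trialFail I l i + (2 ^ (l.length + 2 - (a - i) * 2 ^ i))⁻¹ ≤ 1 := by
  classical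
  obtain ⟨S, hSF⟩ := hF
  have hSE := I.F_subset S hSF
  have hcard : l.length = I.E.card := by rw [← hl.2, List.toFinset_card_of_nodup hl.1]
  set n := l.length with hn
  set w := (a - i) * 2 ^ i with hw
  have h8 : 8 * w ≤ n := two_pow_mul_le ha hi
  have hone : ∀ m, failProb I l i m ≤ 1 := fun m =>
    (le_self_add).trans (failProb_add_le I l i m (ψ := fun _ => 0) (by simp) (by simp))
  have hquarter : ((2 : ℝ≥0∞) ^ (n + 2 - w))⁻¹ = (2 ^ (n - w))⁻¹ / 2 / 2 := by
    rw [show n + 2 - w = n - w + 1 + 1 by omega, pow_succ, pow_succ, div_eq_mul_inv, div_eq_mul_inv,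
      ENNReal.mul_inv (by simp) (by simp), ENNReal.mul_inv (by simp) (by simp)]
  have key : ∀ m, failProb I l i m + (2 ^ (n - w))⁻¹ / 2 ≤ 1 →
      trialFail I l i + (2 ^ (n + 2 - w))⁻¹ ≤ 1 := by
    intro m hm
    rw [hquarter, trialFail, ← ENNReal.add_div]
    have hle : failProb I l i true + failProb I l i false + (2 ^ (n - w))⁻¹ / 2 ≤ 1 + 1 := by
      cases m
      · rw [add_assoc]
        exact add_le_add (hone true) hm
      · rw [add_right_comm]
        exact add_le_add hm (hone false)
    exact (ENNReal.div_le_div_right hle 2).trans (ENNReal.half_add_half 1).le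
  rcases le_or_gt (2 ^ a) S.card with hk | hk
  · have h2i : 2 ^ i ≤ S.card := (Nat.pow_le_pow_right (by norm_num) hi).trans hk
    -- The event that X is a subset of S missing exactly 2^i elements; S \ X is then the required
    -- extension.
    set ψ : List (List Bool) → ℝ≥0∞ := fun X =>
      ∑ Y ∈ S.powersetCard (S.card - 2 ^ i), if X.toFinset = Y then 1 else 0 with hψ
    refine key true (le_trans (add_le_add_right (ENNReal.div_le_div_right ?_ 2) _)
      (failProb_add_le I l i true (ψ := ψ) (fun X => ?_) fun X hX => ?_))
    · refine le_trans ?_ (choose_mul_le_sampleAvg hl hSE _)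
      rw [Nat.choose_symm h2i, ← hcard]
      have hch : (2 ^ w : ℕ) ≤ S.card.choose (2 ^ i) := by
        rw [hw, pow_mul]
        refine Nat.pow_le_choose_of_mul_le (le_trans (le_of_eq ?_) hk)
        rw [← pow_add, Nat.sub_add_cancel hi]
      refine le_trans (le_of_eq ?_) (mul_le_mul_left (Nat.cast_le.2 hch) _)
      rw [show n = n - w + w by omega, Nat.add_sub_cancel, pow_add,
        ENNReal.mul_inv (by simp) (by simp), mul_comm, mul_assoc, Nat.cast_pow, Nat.cast_ofNat,
        ENNReal.inv_mul_cancel (by simp) (by simp), mul_one]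
    · simp only [hψ, Finset.sum_ite_eq]
      split_ifs <;> simp
    · simp only [hψ, Finset.sum_ite_eq, ne_eq, ite_eq_right_iff, one_ne_zero, imp_false, not_not,
        Finset.mem_powersetCard] at hX
      refine ⟨S \ X.toFinset, Finset.sdiff_subset_sdiff hSE le_rfl, ?_, ?_⟩
      · rwa [Finset.union_sdiff_of_subset hX.1]
      · rw [Finset.card_sdiff_of_subset hX.1, hX.2, modeSize, if_pos rfl]
        exact Nat.sub_sub_self h2i
  · refine key false (le_trans (add_le_add_right (ENNReal.div_le_div_right ?_ 2) _)
      (failProb_add_le I l i false (ψ := fun X => if X.toFinset = S then 1 else 0)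
        (fun X => by split_ifs <;> simp) fun X hX => ?_))
    · refine le_trans ?_ (prod_keepProb_le_sampleAvg false hl hSE)
      rw [keepProb_false_prod hSE, ← hcard]
      have h4k : 4 * S.card ≤ n := by
        rcases Nat.eq_zero_or_pos a with h | h
        · rw [h, pow_zero, Nat.lt_one_iff] at hk
          omega
        · have hn0 : n ≠ 0 := by
            intro h0
            rw [h0] at ha
            simp at ha
            omega
          have h₁ : 2 ^ Nat.log 2 n ≤ n := Nat.pow_log_le_self 2 hn0
          rw [show Nat.log 2 n = a + 2 by omega, pow_add] at h₁
          omega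
      -- Compared after raising to the eighth power: 8(n + w) ≤ 9n, 2^9 = 512 ≤ 729 = 3^6, and 6n ≤
      -- 8(n - |S|) because 4|S| ≤ n.
      have hnat : 2 ^ (n + w) ≤ 3 ^ (n - S.card) := by
        refine le_of_pow_le_pow_left₀ (n := 8) (by norm_num) (by positivity) ?_
        rw [← pow_mul, ← pow_mul]
        calc 2 ^ ((n + w) * 8) ≤ 2 ^ (9 * n) := Nat.pow_le_pow_right (by norm_num) (by omega)
          _ = 512 ^ n := by rw [pow_mul]; norm_num
          _ ≤ 729 ^ n := Nat.pow_le_pow_left (by norm_num) n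
          _ = 3 ^ (6 * n) := by rw [pow_mul]; norm_num
          _ ≤ _ := Nat.pow_le_pow_right (by norm_num) (by omega)
      have hcast : (2 : ℝ≥0∞) ^ (n + w) ≤ 3 ^ (n - S.card) := by exact_mod_cast hnat
      refine le_trans (le_of_eq ?_) (mul_le_mul_left hcast _)
      rw [show (4 : ℝ≥0∞) ^ n = 2 ^ (n + w) * 2 ^ (n - w) by
        rw [← pow_add, show n + w + (n - w) = 2 * n by omega, pow_mul]; norm_num,
        ENNReal.mul_inv (by simp) (by simp), ← mul_assoc,
        ENNReal.mul_inv_cancel (by simp) (by simp), one_mul]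
    · have hXS : X.toFinset = S := by simpa using hX
      exact ⟨∅, by simp, by rwa [hXS, Finset.union_empty], by simp [modeSize]⟩

end Frag

/-! ### The machine of the algorithm and its specification -/

noncomputable instance : Fintype TapeSymbol := Fintype.ofFinite _

namespace Frag

variable (N M : OracleTM)

/-- The machine of the algorithm. -/
noncomputable def machine : OracleTM :=
  (algorithm N M).toTM (.inl .inp) (.inl .out) (.inl .qry) (none, N.startState, M.startState)

variable {N M}

theorem machine_spec {I : SetInstance} {t : ℕ} (hN : N.HaltsWithin I.answer (encBits I.B) t)
    (hNout : ∀ r : Fin t → Bool,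
      ∃ l, IsListing l I.E ∧ N.output I.answer (encBits I.B) r = encList l)
    {τ : ℕ → ℕ} (hM : ExtendsWithin M I τ) {n a s C K T u : ℕ} (hn : I.E.card = n)
    (ha : Nat.log 2 n - 2 = a) (hs : I.B.length + N.growth * t ≤ s)
    (hC : 11 * (s + I.B.length + a) + 2 * M.growth + 2 * Fintype.card M.K + 40 ≤ C)
    (hK : 7 * s + (7 * 2 ^ a + 10) * a + 3 * a + 9 * 2 ^ a +
      2 * (C + 6 * (n + 2) + 8) + 2 * (n + 2) + 200 ≤ K)
    (hT : ∀ m, τ (modeSize (u % (a + 1)) m) ≤ T)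
    (hu : (u + 2) * 2 ^ (n + 2 - (a - u % (a + 1)) * 2 ^ (u % (a + 1))) * T ≤ 2 ^ (u + 1))
    {Z : ℕ} (hZ : Z = K * (2 ^ (u + 2) - 2) + 2 * t + 10 * I.B.length + 12 * s +
      (8 * s + 12) * (s + 1) + 18 + 1) :
    (machine N M).HaltsWithin I.answer (encBits I.B) Z ∧
    (∀ r : Fin Z → Bool, ∃ b, (machine N M).output I.answer (encBits I.B) r = encAnswer b) ∧
    (I.F.Nonempty →
      1 / 2 ≤ (machine N M).prob I.answer (encBits I.B) Z fun w => w = encAnswer true) ∧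
    (¬ I.F.Nonempty →
      (machine N M).prob I.answer (encBits I.B) Z (fun w => w = encAnswer false) = 1) := by
  classical
  subst hZ
  -- A "no" is an error only if 𝓕 is nonempty; for empty 𝓕 the bound to be proved becomes 0.
  set δ : ℝ≥0∞ := if I.F.Nonempty then 1 else 0 with hδ
  have hspec := toTM_spec (algorithm N M) (.inl .inp) (.inl .out) (.inl .qry)
    (none, N.startState, M.startState) I.answer (encBits I.B) (n := K * (2 ^ (u + 2) - 2) + 2 * t +
      10 * I.B.length + 12 * s + (8 * s + 12) * (s + 1) + 18) (p := I.F.Nonempty) (δ := δ)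
    (by rw [hδ]; split_ifs <;> simp)
    (wp_algorithm hN hNout (fun _ _ _ _ _ => le_rfl) hs fun l hl hle S hS => ?_)
  · obtain ⟨hhalt, hout, hprob, hno⟩ := hspec
    refine ⟨hhalt, fun r => ?_, fun hF => hprob (if_pos hF), hno⟩
    rcases hout r with h | h
    exacts [⟨_, h⟩, ⟨_, h.1⟩]
  · have hcard : l.length = n := by rw [← hn, ← hl.2, List.toFinset_card_of_nodup hl.1]
    rw [hcard, ha] at hS
    have := wp_search hM hl (a := a) (fun hF i hi => trialFail_add_le hl hF (by rw [hcard, ha]) hi)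
      (δ := δ) (fun hF => if_neg hF) (φ := fun _ _ S => if S (.inl .out) = encAnswer false then δ else
      if S (.inl .out) = encAnswer true ∧ I.F.Nonempty then 0 else ⊤) (fun _ _ _ _ _ => le_rfl)
      (fun hF n S h => by
        simp only [h]
        rw [if_neg (by simp [encAnswer]), if_pos ⟨trivial, hF⟩])
      (fun n S h => by simp only [h]; rw [if_pos trivial]) (C := C) (K := K) (by omega)
      (by rw [hcard]; omega) hT (by rw [hcard]; exact hu) 0 0 (Nat.zero_le _) (S := S)
      (by rw [Nat.zero_mod]; exact hS)
    simpa using this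

end Frag

/-! ### The running time -/

theorem gKLogK_two_pow (α : ℝ) (i : ℕ) :
    gKLogK α (2 ^ i) = ⌊(2 : ℝ) ^ (α * 2 ^ i * i)⌋₊ := by
  rw [gKLogK, Nat.cast_pow, Nat.cast_ofNat, Real.logb_pow, Real.logb_self_eq_one (by norm_num),
    mul_one]

theorem gKLogK_two_pow_le (α : ℝ) (i : ℕ) :
    (gKLogK α (2 ^ i) : ℝ) ≤ 2 ^ (α * 2 ^ i * i) := by
  rw [gKLogK_two_pow]
  exact Nat.floor_le (by positivity)

theorem one_le_gKLogK_two_pow {α : ℝ} (hα : 0 < α) (i : ℕ) : 1 ≤ gKLogK α (2 ^ i) := by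
  rw [gKLogK_two_pow, Nat.le_floor_iff (by positivity), Nat.cast_one]
  exact Real.one_le_rpow (by norm_num) (by positivity)

theorem gKLogK_modeSize_le {α : ℝ} (hα : 0 < α) (i : ℕ) (m : Bool) :
    gKLogK α (Frag.modeSize i m) ≤ gKLogK α (2 ^ i) := by
  cases m
  · have : gKLogK α 0 = 1 := by simp [gKLogK]
    exact this.trans_le (one_le_gKLogK_two_pow hα i)
  · exact le_rfl

/-- The saving in the exponent of the running time. -/
noncomputable def saving (α : ℝ) (n : ℕ) : ℝ :=
  if n < 16 then 0 else 1 / 2 * ((n : ℝ) / 16) ^ (1 / (1 + α))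

theorem saving_le {α : ℝ} (hα : 0 < α) (n : ℕ) : saving α n ≤ n := by
  unfold saving
  split_ifs with h
  · positivity
  · have h16 : (16 : ℝ) ≤ n := by exact_mod_cast not_lt.1 h
    have : ((n : ℝ) / 16) ^ (1 / (1 + α)) ≤ ((n : ℝ) / 16) ^ (1 : ℝ) :=
      Real.rpow_le_rpow_of_exponent_le (by linarith)
        (by rw [div_le_one (by linarith)]; linarith)
    rw [Real.rpow_one] at this
    linarith

theorem isOmega_saving {α : ℝ} : IsOmega (saving α) (fun n => (n : ℝ) ^ (1 / (1 + α))) := by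
  refine ⟨1 / 2 * (1 / 16) ^ (1 / (1 + α)), by positivity, eventually_atTop.2 ⟨16, fun n hn => ?_⟩⟩
  rw [saving, if_neg (not_lt.2 hn), div_eq_mul_one_div (n : ℝ) 16,
    Real.mul_rpow (Nat.cast_nonneg _) (by norm_num)]
  exact le_of_eq (by ring)

theorem two_pow_log_sub_two {n : ℕ} (hn : 16 ≤ n) : 4 * 2 ^ (Nat.log 2 n - 2) ≤ n := by
  have h₁ : 2 ^ Nat.log 2 n ≤ n := Nat.pow_log_le_self 2 (by omega)
  have h₂ : 4 ≤ Nat.log 2 n := Nat.le_log_of_pow_le (by norm_num) hn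
  obtain ⟨a, ha⟩ : ∃ a, Nat.log 2 n = a + 2 := ⟨Nat.log 2 n - 2, by omega⟩
  rw [ha, pow_add] at h₁
  rw [ha, Nat.add_sub_cancel]
  omega

/-- With b = a - 1 take i = ⌊b/(1+α)⌋. Then (1+α)i ≤ b makes the second factor at least 1, while i +
1 > b/(1+α) and n/16 ≤ 2^b give 2^(i+1) ≥ (n/16)^(1/(1+α)). For n < 16 no saving is claimed, and i =
0 works. -/
theorem exists_saving_le {α : ℝ} (hα : 0 < α) (n : ℕ) :
    ∃ i ≤ Nat.log 2 n - 2,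
      saving α n ≤ 2 ^ i * (((Nat.log 2 n - 2 : ℕ) : ℝ) - i - α * i) := by
  unfold saving
  split_ifs with h
  · exact ⟨0, Nat.zero_le _, by simp⟩
  · have hlog : 4 ≤ Nat.log 2 n := Nat.le_log_of_pow_le (by norm_num) (not_lt.1 h)
    obtain ⟨b, hb⟩ : ∃ b, Nat.log 2 n - 2 = b + 1 := ⟨Nat.log 2 n - 3, by omega⟩
    have hα1 : 0 < 1 + α := by linarith
    set i := ⌊(b : ℝ) / (1 + α)⌋₊ with hi
    have hib : (i : ℝ) ≤ b / (1 + α) := Nat.floor_le (by positivity)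
    have hib' : (b : ℝ) / (1 + α) < i + 1 := Nat.lt_floor_add_one _
    have hle : (1 + α) * i ≤ b := by rwa [le_div_iff₀' hα1] at hib
    rw [hb]
    refine ⟨i, ?_, ?_⟩
    · have : (i : ℝ) ≤ b := by nlinarith [Nat.cast_nonneg (α := ℝ) i]
      have : i ≤ b := by exact_mod_cast this
      omega
    · have hn : (n : ℝ) / 16 ≤ 2 ^ (b : ℝ) := by
        have h₁ : n < 2 ^ (Nat.log 2 n + 1) := Nat.lt_pow_succ_log_self (by norm_num) n
        rw [show Nat.log 2 n + 1 = b + 4 by omega, pow_add] at h₁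
        rw [Real.rpow_natCast, div_le_iff₀ (by norm_num)]
        have h₂ : n ≤ 2 ^ b * 16 := by omega
        exact_mod_cast h₂
      have hpow : ((n : ℝ) / 16) ^ (1 / (1 + α)) ≤ 2 ^ ((i : ℝ) + 1) := by
        refine (Real.rpow_le_rpow (by positivity) hn (by positivity)).trans ?_
        rw [← Real.rpow_mul (by norm_num), mul_one_div]
        exact Real.rpow_le_rpow_of_exponent_le (by norm_num) hib'.le
      rw [Real.rpow_add (by norm_num), Real.rpow_one, Real.rpow_natCast] at hpow
      have h2i : (0 : ℝ) < 2 ^ i := by positivity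
      push_cast
      nlinarith

/-- The term ℓ = 2^i of the maximum suffices, since 4·2^a ≤ n gives 2^(a-i) ≤ n/(4ℓ). -/
theorem saving_le_Phi {α : ℝ} (hα : 0 < α) {n : ℕ} (hn : 16 ≤ n) :
    saving α n ≤ Phi (gKLogK α) n := by
  obtain ⟨i, hi, hle⟩ := exists_saving_le hα n
  have hlog := two_pow_log_sub_two hn
  have h2i : 2 ^ i ≤ 2 ^ (Nat.log 2 n - 2) := Nat.pow_le_pow_right (by norm_num) hi
  refine hle.trans (le_trans ?_ (Finset.le_sup' (b := 2 ^ i) (fun ℓ : ℕ =>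
    (ℓ : ℝ) * Real.logb 2 ((n : ℝ) / (4 * ℓ)) - Real.logb 2 (gKLogK α ℓ))
    (Finset.mem_range.2 (by omega))))
  have h₁ : ((Nat.log 2 n - 2 : ℕ) : ℝ) - i ≤ Real.logb 2 ((n : ℝ) / (4 * (2 ^ i : ℕ))) := by
    rw [Real.le_logb_iff_rpow_le (by norm_num) (by positivity), ← Nat.cast_sub hi, Real.rpow_natCast,
      le_div_iff₀ (by positivity)]
    have : 2 ^ (Nat.log 2 n - 2 - i) * (4 * 2 ^ i) ≤ n := by
      refine le_trans (le_of_eq ?_) hlog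
      rw [mul_left_comm, ← pow_add, Nat.sub_add_cancel hi]
    exact_mod_cast this
  have h₂ : Real.logb 2 (gKLogK α (2 ^ i)) ≤ α * 2 ^ i * i := by
    rw [Real.logb_le_iff_le_rpow (by norm_num) (by exact_mod_cast one_le_gKLogK_two_pow hα i)]
    exact gKLogK_two_pow_le α i
  have h₃ : (0 : ℝ) < ((2 ^ i : ℕ) : ℝ) := by positivity
  have h₄ := mul_le_mul_of_nonneg_left h₁ h₃.le
  push_cast at h₄ ⊢
  linarith

theorem exists_add_mod_eq (b : ℕ) {a i : ℕ} (hi : i ≤ a) : ∃ e ≤ a, (b + e) % (a + 1) = i := by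
  have hr : b % (a + 1) < a + 1 := Nat.mod_lt b (Nat.succ_pos a)
  rcases le_or_gt (b % (a + 1)) i with h | h
  · refine ⟨i - b % (a + 1), by omega, ?_⟩
    rw [← Nat.mod_add_mod, Nat.add_sub_cancel' h]
    exact Nat.mod_eq_of_lt (by omega)
  · refine ⟨i + (a + 1) - b % (a + 1), by omega, ?_⟩
    rw [← Nat.mod_add_mod, Nat.add_sub_cancel' (by omega), Nat.add_mod_right]
    exact Nat.mod_eq_of_lt (by omega)

/-- The last round of the search. -/
theorem exists_last_round {z a i : ℕ} (hz : z ≠ 0) (hi : i ≤ a) :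
    ∃ u, u % (a + 1) = i ∧ (u + 2) * z ≤ 2 ^ (u + 1) ∧
      2 ^ (u + 2) ≤ 16 * z * (Nat.log 2 z + 1) * 2 ^ a := by
  set v := Nat.log 2 z with hv
  -- A clock of about z·log z suffices, whose exponent is about v + s; any a + 1 consecutive rounds
  -- contain one with the prescribed residue, at the price of a factor at most 2^a.
  set s := Nat.log 2 (v + 1) with hs
  obtain ⟨e, he, hmod⟩ := exists_add_mod_eq (v + s + 2) hi
  have h₁ : 2 ^ v ≤ z := Nat.pow_log_le_self 2 hz
  have h₂ : z < 2 ^ (v + 1) := Nat.lt_pow_succ_log_self (by norm_num) z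
  have h₃ : 2 ^ s ≤ v + 1 := Nat.pow_log_le_self 2 (by omega)
  have h₄ : v + 1 < 2 ^ (s + 1) := Nat.lt_pow_succ_log_self (by norm_num) (v + 1)
  refine ⟨v + s + 2 + e, hmod, ?_, ?_⟩
  · have h₅ : 2 ^ (s + 1) ≤ 2 ^ (s + e + 1) := Nat.pow_le_pow_right (by norm_num) (by omega)
    have h₆ : s + e + 1 < 2 ^ (s + e + 1) := Nat.lt_two_pow_self
    calc (v + s + 2 + e + 2) * z ≤ 2 ^ (s + e + 2) * 2 ^ (v + 1) := by
          refine Nat.mul_le_mul ?_ h₂.le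
          rw [pow_succ]
          omega
      _ = _ := by rw [← pow_add]; congr 1; omega
  · calc 2 ^ (v + s + 2 + e + 2) = 16 * 2 ^ v * 2 ^ s * 2 ^ e := by ring
      _ ≤ _ := by
        gcongr
        norm_num

namespace OracleTM

theorem stkSize_foldl_step (M : OracleTM) (O : List TapeSymbol → Bool) (r : List Bool) (c : M.Cfg) :
    stkSize (r.foldl (M.step O) c).stk ≤ stkSize c.stk + M.growth * r.length := by
  induction r generalizing c with
  | nil => simp
  | cons b r ih =>
    have h₁ := ih (M.step O c b)
    have h₂ := M.stkSize_step O c b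
    rw [List.foldl_cons, List.length_cons, Nat.mul_succ]
    omega

theorem length_output_le (M : OracleTM) (O : List TapeSymbol → Bool) (x : List TapeSymbol) {T : ℕ}
    (r : Fin T → Bool) : (M.output O x r).length ≤ x.length + M.growth * T := by
  have h := M.stkSize_foldl_step O (List.ofFn r) (M.initCfg x)
  rw [stkSize_initCfg, List.length_ofFn] at h
  exact (Finset.single_le_sum (f := fun i => ((M.run O x r).stk i).length) (fun _ _ => Nat.zero_le _)
    (Finset.mem_univ M.out)).trans h

end OracleTM

theorem saving_nonneg (α : ℝ) (n : ℕ) : 0 ≤ saving α n := by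
  unfold saving
  split_ifs <;> positivity

theorem two_pow_log_sub_two_le (n : ℕ) : 2 ^ (Nat.log 2 n - 2) ≤ n + 1 := by
  rcases Nat.eq_zero_or_pos n with rfl | h
  · simp
  · have h₁ : 2 ^ Nat.log 2 n ≤ n := Nat.pow_log_le_self 2 h.ne'
    have h₂ : 2 ^ (Nat.log 2 n - 2) ≤ 2 ^ Nat.log 2 n :=
      Nat.pow_le_pow_right (by norm_num) (Nat.sub_le _ _)
    omega

/-- The exponent of z is n minus (a - i)·2^i plus log g(2^i) ≤ α·2^i·i, hence at most n minus the
saving. Everything else is polynomial: log z is linear in n + p, and 2^a ≤ n + 1. -/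
theorem time_bound {α : ℝ} (hα : 0 < α) {n a i p s K u rest : ℕ} (ha : Nat.log 2 n - 2 = a)
    (hi : i ≤ a) (hsave : saving α n ≤ 2 ^ i * ((a : ℝ) - i - α * i)) (hn : n ≤ s) {z : ℕ}
    (hz : z = 2 ^ (n + 2 - (a - i) * 2 ^ i) * (gKLogK α (2 ^ i) * (p + 1)))
    (hu : 2 ^ (u + 2) ≤ 16 * z * (Nat.log 2 z + 1) * 2 ^ a) :
    ((K * (2 ^ (u + 2) - 2) + rest : ℕ) : ℝ) ≤ 2 ^ ((n : ℝ) - saving α n) *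
      ((K * (64 * (p + 1) * (s + 4 + p) * (s + 1)) + rest : ℕ) : ℝ) := by
  have hw : 8 * ((a - i) * 2 ^ i) ≤ n := Frag.two_pow_mul_le ha.symm hi
  set A : ℝ := 2 ^ ((n : ℝ) - saving α n) with hA
  -- The saving never exceeds n, so the polynomial overhead `rest` can also be multiplied by `A`.
  have hA1 : 1 ≤ A := Real.one_le_rpow (by norm_num) (by linarith [saving_le hα n])
  have hAn : A ≤ 2 ^ n := by
    rw [← Real.rpow_natCast]
    exact Real.rpow_le_rpow_of_exponent_le (by norm_num) (by linarith [saving_nonneg α n])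
  have hzA : (z : ℝ) ≤ A * 4 * (p + 1) := by
    have h₁ : (2 : ℝ) ^ (n + 2 - (a - i) * 2 ^ i) = 2 ^ ((n : ℝ) - ((a : ℝ) - i) * 2 ^ i) * 4 := by
      rw [← Real.rpow_natCast, Nat.cast_sub (by omega), Nat.cast_mul, Nat.cast_sub hi,
        show (4 : ℝ) = 2 ^ (2 : ℝ) by norm_num, ← Real.rpow_add (by norm_num)]
      congr 1
      push_cast
      ring
    have h₂ : (2 : ℝ) ^ ((n : ℝ) - ((a : ℝ) - i) * 2 ^ i) * 2 ^ (α * 2 ^ i * i) ≤ A := by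
      rw [← Real.rpow_add (by norm_num)]
      exact Real.rpow_le_rpow_of_exponent_le (by norm_num) (by linarith)
    rw [hz]
    push_cast
    rw [h₁]
    have h₃ := gKLogK_two_pow_le α i
    calc (2 : ℝ) ^ ((n : ℝ) - ((a : ℝ) - i) * 2 ^ i) * 4 * ((gKLogK α (2 ^ i) : ℝ) * (p + 1))
        ≤ (2 : ℝ) ^ ((n : ℝ) - ((a : ℝ) - i) * 2 ^ i) * 4 * (2 ^ (α * 2 ^ i * i) * (p + 1)) := by gcongr
      _ = (2 : ℝ) ^ ((n : ℝ) - ((a : ℝ) - i) * 2 ^ i) * 2 ^ (α * 2 ^ i * i) * 4 * (p + 1) := by ring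
      _ ≤ _ := by gcongr
  have hzn : z ≤ 2 ^ (n + 2 + p) := by
    have hp : p + 1 ≤ 2 ^ p := Nat.lt_two_pow_self
    have hp' : ((p : ℝ) + 1) ≤ 2 ^ p := by exact_mod_cast hp
    have : (z : ℝ) ≤ 2 ^ (n + 2 + p) := by
      refine hzA.trans ?_
      calc A * 4 * (p + 1) ≤ 2 ^ n * 4 * 2 ^ p := by gcongr
        _ = _ := by ring
    exact_mod_cast this
  have hv : Nat.log 2 z + 1 ≤ s + 4 + p := by
    have := Nat.log_mono_right (b := 2) hzn
    rw [Nat.log_pow (by norm_num)] at this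
    omega
  have h2a : 2 ^ a ≤ s + 1 := (ha ▸ two_pow_log_sub_two_le n).trans (Nat.succ_le_succ hn)
  have hmain : ((2 ^ (u + 2) - 2 : ℕ) : ℝ) ≤ A * (64 * (p + 1) * (s + 4 + p) * (s + 1)) := by
    have h₁ : 2 ^ (u + 2) - 2 ≤ 16 * z * (s + 4 + p) * (s + 1) :=
      (Nat.sub_le _ _).trans (hu.trans (by gcongr))
    calc ((2 ^ (u + 2) - 2 : ℕ) : ℝ) ≤ 16 * z * (s + 4 + p) * (s + 1) := by exact_mod_cast h₁
      _ ≤ 16 * (A * 4 * (p + 1)) * (s + 4 + p) * (s + 1) := by gcongr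
      _ = _ := by ring
  have hrest : (rest : ℝ) ≤ A * rest := le_mul_of_one_le_left (Nat.cast_nonneg _) hA1
  rw [Nat.cast_add, Nat.cast_mul]
  push_cast at hmain ⊢
  calc (K : ℝ) * ((2 ^ (u + 2) - 2 : ℕ) : ℝ) + rest
      ≤ K * (A * (64 * (p + 1) * (s + 4 + p) * (s + 1))) + A * rest := by gcongr
    _ = _ := by ring

/-! ### The main theorem -/

theorem mainTheorem7 (α : ℝ) (hα : 0 < α) :
    IsOmega (Phi (gKLogK α)) (fun n => (n : ℝ) ^ (1 / (1 + α))) ∧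
    ∃ f : ℕ → ℝ, IsOmega f (fun n => (n : ℝ) ^ (1 / (1 + α))) ∧
      ∀ P : Set SetInstance, PolyTimeComputable P → HasExtensionAlgorithm P (gKLogK α) →
        HasRandomizedAlgorithm P (fun n => (2 : ℝ) ^ ((n : ℝ) - f n)) := by
  refine ⟨?_, saving α, isOmega_saving, ?_⟩
  · obtain ⟨c, hc, h⟩ := isOmega_saving (α := α)
    refine ⟨c, hc, ?_⟩
    filter_upwards [h, eventually_ge_atTop 16] with n h₁ h₂
    exact h₁.trans (saving_le_Phi hα h₂)
  · rintro P ⟨⟨N, q, -, hN⟩, -⟩ ⟨M, p, hM⟩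
    -- `sP` bounds the length of the list of E, and thereby n; `CP` is the fuel per clock symbol and
    -- `KP` the fuel per unit of the clock of a round.
    obtain ⟨sP, hsP⟩ : ∃ sP : Polynomial ℕ, sP = .X + .C N.growth * q := ⟨_, rfl⟩
    obtain ⟨CP, hCP⟩ : ∃ CP : Polynomial ℕ, CP = .C 11 * (sP + .X + sP) +
      .C (2 * M.growth + 2 * Fintype.card M.K + 40) := ⟨_, rfl⟩
    obtain ⟨KP, hKP⟩ : ∃ KP : Polynomial ℕ, KP = .C 7 * sP + (.C 7 * (sP + .C 1) + .C 10) * sP +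
      .C 3 * sP + .C 9 * (sP + .C 1) + .C 2 * (CP + .C 6 * (sP + .C 2) + .C 8) +
      .C 2 * (sP + .C 2) + .C 200 := ⟨_, rfl⟩
    refine ⟨Frag.machine N M, KP * (.C 64 * (p + .C 1) * (sP + .C 4 + p) * (sP + .C 1)) +
      (.C 2 * q + .C 10 * .X + .C 12 * sP + (.C 8 * sP + .C 12) * (sP + .C 1) + .C 19),
      fun I hI => ?_⟩
    obtain ⟨hhalt, hout⟩ := hN I hI
    obtain ⟨a, ha⟩ : ∃ a, Nat.log 2 I.E.card - 2 = a := ⟨_, rfl⟩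
    obtain ⟨i, hi, hsave⟩ := exists_saving_le hα I.E.card
    rw [ha] at hi hsave
    set f := I.B.length with hf
    -- The time all trials need per factor u + 2 of their number. Using `p + 1` keeps z positive
    -- even where the polynomial vanishes.
    set z := 2 ^ (I.E.card + 2 - (a - i) * 2 ^ i) * (gKLogK α (2 ^ i) * (p.eval f + 1)) with hz
    have hz0 : z ≠ 0 := by
      have := one_le_gKLogK_two_pow hα i
      positivity
    obtain ⟨u, hmod, hu, hu'⟩ := exists_last_round hz0 hi
    have hs : sP.eval f = f + N.growth * q.eval f := by simp [hsP]
    have hn : I.E.card ≤ sP.eval f := by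
      obtain ⟨l, hl, hlout⟩ := hout fun _ => false
      have h₁ := N.length_output_le I.answer (encBits I.B) (fun _ : Fin (q.eval f) => false)
      rw [hlout] at h₁
      have h₂ := Frag.length_le_length_encList l
      rw [← hl.2, List.toFinset_card_of_nodup hl.1, hs]
      simp only [encBits, List.length_map] at h₁
      omega
    have haE : a ≤ I.E.card := by
      have := Nat.log_le_self 2 I.E.card
      omega
    have h2a : 2 ^ a ≤ sP.eval f + 1 :=
      (ha ▸ two_pow_log_sub_two_le _).trans (Nat.succ_le_succ hn)
    have hC : CP.eval f = 11 * (sP.eval f + f + sP.eval f) +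
        (2 * M.growth + 2 * Fintype.card M.K + 40) := by simp [hCP]
    have hK : KP.eval f = 7 * sP.eval f + (7 * (sP.eval f + 1) + 10) * sP.eval f + 3 * sP.eval f +
        9 * (sP.eval f + 1) + 2 * (CP.eval f + 6 * (sP.eval f + 2) + 8) + 2 * (sP.eval f + 2) + 200 := by
      simp [hKP]
    have hspec := Frag.machine_spec (I := I) (M := M) hhalt hout
      (τ := fun ℓ => gKLogK α ℓ * p.eval f) (hM I hI) rfl ha hs.ge (C := CP.eval f) (K := KP.eval f)
      (T := gKLogK α (2 ^ i) * (p.eval f + 1)) (u := u) (by omega) ?_ ?_ ?_ rfl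
    · refine ⟨_, ?_, hspec⟩
      have hb := time_bound hα (K := KP.eval f) (rest := 2 * q.eval f + 10 * f + 12 * sP.eval f +
        (8 * sP.eval f + 12) * (sP.eval f + 1) + 19) ha hi hsave hn hz hu'
      refine le_trans (le_of_eq ?_) (hb.trans (le_of_eq ?_))
      · exact congrArg _ (by rw [← hf]; ring)
      · congr 2
        simp
    · have h₁ : (7 * 2 ^ a + 10) * a ≤ (7 * (sP.eval f + 1) + 10) * sP.eval f :=
        Nat.mul_le_mul (by omega) (by omega)
      omega
    · intro m
      rw [hmod]
      exact Nat.mul_le_mul (gKLogK_modeSize_le hα i m) (Nat.le_succ _)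
    · rw [hmod, mul_assoc]
      exact hu
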